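/- Let $V=\mathbb{R}^{p,q}$ with its standard basis $(e_j)$, bilinear form $(\cdot,\cdot)$, $x^2=(x,x)$, $q(x)=x^2/2$, and let $L\subset V$ be an even lattice of signature $(p,q)$ with dual $L'$. Put $G=\mathrm{SO}(V)$, $k=(p+q)/2$, $e(t)=e^{2\pi i t}$. The Weil representation $\rho_L$ of $\mathrm{Mp}_2(\mathbb{Z})$ on $\mathbb{C}[L'/L]=\bigoplus_\gamma\mathbb{C}\,\mathfrak{e}_\gamma$ is given by $\rho_L(T)\mathfrak{e}_\gamma=e(q(\gamma))\mathfrak{e}_\gamma$ and $\rho_L(S)\mathfrak{e}_\gamma=\sqrt{i}^{\,q-p}|L'/L|^{-1/2}\sum_\delta e(-(\gamma,\delta))\mathfrak{e}_\delta$. Let $f=\sum_{\gamma}\sum_{n\in\mathbb{Z}+q(\gamma),\,n>0}c(f_\gamma,n)e(n\tau)\mathfrak{e}_\gamma$ be a cusp form of weight $k$ with respect to $\rho_L$. Let $z_0=\langle e_{p+1},\dots,e_{p+q}\rangle$. For $g\in G$ put $z=g^{-1}(z_0)$ and write $v_z,v_{z^\perp}$ for orthogonal projections. For $\boldsymbol\alpha=(\alpha_1,\dots,\alpha_q)\in\{1,\dots,p\}^q$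 let $\mathcal{P}_{\boldsymbol\alpha}(x)=2^{q/2}\prod_{i=1}^q x_{\alpha_i}$. With $\Delta=\sum_j\partial^2/\partial x_j^2$ and $\tau=x+iy$, put $$\Theta_L(\tau,g,\mathcal{P})=y^{q/2}\sum_{\gamma\in L'/L}\ \sum_{\lambda\in L+\gamma}\exp(-\Delta/8\pi y)(\mathcal{P})(g(\lambda))\,e\big(\tau q(\lambda_{z^\perp})+\bar\tau q(\lambda_z)\big)\mathfrak{e}_\gamma .$$ The defining integrals of the Kudla–Millson lift of $f$ are $$I_{\boldsymbol\alpha}(g)=\int_{\mathrm{SL}_2(\mathbb{Z})\backslash\mathbb{H}}y^k\langle f(\tau),\Theta_L(\tau,g,\mathcal{P}_{\boldsymbol\alpha})\rangle\frac{dx\,dy}{y^2},$$ where $\langle\cdot,\cdot\rangle$ is the standard scalar product of $\mathbb{C}[L'/L]$, antilinear in the second variable. Let $u\in L$ be primitive with $u^2=0$, $u'\in L'$ with $(u,u')=1$, $(u,L)=N\mathbb{Z}$ with $N>0$, and $\zeta\in L$ with $(\zeta,u)=N$. Let $M=L\cap u^\perp\cap u'^\perp\cong(L\cap u^\perp)/\mathbb{Z}u$,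 with dual $M'\subset M\otimes\mathbb{R}=u^\perp\cap u'^\perp$, and $L_0'=\{\lambda\in L':(\lambda,u)\equiv0\bmod N\}$. Let $\pi:L_0'\to M'$, $\pi(\lambda)=\lambda_M-\frac{(\lambda,u)}{N}\zeta_M$, where $v_M$ is the orthogonal projection of $v$ to $M\otimes\mathbb{R}$. An integer $t\ge1$ divides $\lambda\in M'$ if $\lambda/t\in M'$. For $g\in G$ let $w$, $w^\perp$ be the orthogonal complements of $u_z$ in $z$ and of $u_{z^\perp}$ in $z^\perp$, let $g^\#(v)=g(v_{w^\perp}+v_w)$, $|u_{z^\perp}|=\sqrt{u_{z^\perp}^2}$, and $$\mu=-u'+\frac{u_{z^\perp}}{2u_{z^\perp}^2}+\frac{u_z}{2u_z^2}.$$ Let $\mathcal{P}_{\boldsymbol\alpha,g^\#,h,0}$, $0\le h\le q$, be the polynomials on $g^\#(V)\cong\mathbb{R}^{p-1,q-1}$ with $\mathcal{P}_{\boldsymbol\alpha}(g(v))=\sum_{h=0}^q(v,u_{z^\perp})^h\,\mathcal{P}_{\boldsymbol\alpha,g^\#,h,0}(g^\#(v))$ for all $v\in V$; on them $\Delta$ is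 the Laplacian of $g^\#(V)$. Put $F_M(\tau)=\sum_{\gamma\in M'/M}\sum_{\delta\in L_0'/L,\ \pi(\delta)=\gamma}f_\delta(\tau)\,\mathfrak{e}_\gamma$ and $$\Theta_M(\tau,g^\#,\mathcal{P})=y^{(q-1)/2}\sum_{\gamma\in M'/M}\ \sum_{\lambda\in M+\gamma}\exp(-\Delta/8\pi y)(\mathcal{P})(g^\#(\lambda))\,e\big(\tau q(\lambda_{w^\perp})+\bar\tau q(\lambda_w)\big)\mathfrak{e}_\gamma.$$ **Theorem.** The integral $I_{\boldsymbol\alpha}(g)$ converges absolutely for every $g\in G$, and $$I_{\boldsymbol\alpha}(g)=\sum_{\lambda\in M'}c_\lambda(g)\,e\big((\lambda,\mu)\big)$$ (unconditionally convergent), where the functions $c_\lambda:G\to\mathbb{C}$ are invariant under $g\mapsto g\circ E(u,v)$ for all Eichler transformations $E(u,v)(x)=x-(x,u)v+(x,v)u-q(v)(x,u)u$, $v\in M\otimes\mathbb{R}$, and are as follows. * $\displaystyle c_0(g)=\int_{\mathrm{SL}_2(\mathbb{Z})\backslash\mathbb{H}}\frac{y^k}{\sqrt2\,|u_{z^\perp}|}\big\langle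 F_M(\tau),\Theta_M(\tau,g^\#,\mathcal{P}_{\boldsymbol\alpha,g^\#,0,0})\big\rangle\frac{dx\,dy}{y^2}$, an absolutely convergent integral. * $c_\lambda(g)=0$ if $\lambda\ne0$ and $q(\lambda)\le0$. * If $q(\lambda)>0$, then $$c_\lambda(g)=\frac{\sqrt2}{|u_{z^\perp}|}\sum_{t\ge1,\,t\mid\lambda}\ \sum_{h=0}^q\Big(\frac{t}{2i}\Big)^h\sum_{\substack{\delta\in L_0'/L\\ \pi(\delta)=\lambda/t+M}}e\big(t(\delta,u')\big)\,c\big(f_\delta,q(\lambda)/t^2\big)\int_0^\infty y^{q+(p-5)/2-h}\exp\Big(-\frac{2\pi y\lambda_{w^\perp}^2}{t^2}-\frac{\pi t^2}{2yu_{z^\perp}^2}\Big)\exp(-\Delta/8\pi y)\big(\mathcal{P}_{\boldsymbol\alpha,g^\#,h,0}\big)\big(g^\#(\lambda/t)\big)\,dy,$$ with absolutely convergent integrals over $y$. In particular, if $L=M\oplus U$ splits off a hyperbolic plane $U$ with standard generators $u,u'$ (so $u'\in L$, $u'^2=0$), then the expansion is $I_{\boldsymbol\alpha}(g)=\sum_{\lambda\in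 M',\,q(\lambda)\ge0}c_\lambda(g)e((\lambda,\mu))$, and for $q(\lambda)>0$ $$c_\lambda(g)=\frac{\sqrt2}{|u_{z^\perp}|}\sum_{t\ge1,\,t\mid\lambda}\ \sum_{h=0}^q\Big(\frac{t}{2i}\Big)^h c\big(f_{\lambda/t},q(\lambda)/t^2\big)\int_0^\infty y^{q+(p-5)/2-h}\exp\Big(-\frac{2\pi y\lambda_{w^\perp}^2}{t^2}-\frac{\pi t^2}{2yu_{z^\perp}^2}\Big)\exp(-\Delta/8\pi y)\big(\mathcal{P}_{\boldsymbol\alpha,g^\#,h,0}\big)\big(g^\#(\lambda/t)\big)\,dy.$$ -/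

import Mathlib

open scoped UpperHalfPlane MatrixGroups Manifold

noncomputable section

namespace KM

/-! ### The quadratic space `ℝ^{p,q}` and its isometries -/

/-- The index set of the coordinates: `inl j` is the `j`-th positive direction, `inr i` the `i`-th
negative direction. -/
abbrev Idx (p q : ℕ) := Fin p ⊕ Fin q

/-- The space `ℝ^{p,q}`. A lattice `L` of signature `(p,q)` with a chosen orthogonal basis
`(e_j)`, `e_j² = ±1`, of `L ⊗ ℝ` is the same as a lattice in this space; `(e_j)` is then the
standard basis. -/
abbrev Vpq (p q : ℕ) := Idx p q → ℝ

/-- The bilinear form `(x,y) = ∑_{j ≤ p} x_j y_j - ∑_{i ≤ q} x_{p+i} y_{p+i}`. -/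
def form (p q : ℕ) : LinearMap.BilinForm ℝ (Vpq p q) :=
  LinearMap.mk₂ ℝ
    (fun x y => (∑ j : Fin p, x (Sum.inl j) * y (Sum.inl j))
      - ∑ i : Fin q, x (Sum.inr i) * y (Sum.inr i))
    (fun x x' y => by simp only [Pi.add_apply, add_mul, Finset.sum_add_distrib]; ring)
    (fun c x y => by
      simp only [Pi.smul_apply, smul_eq_mul, mul_assoc, ← Finset.mul_sum]; ring)
    (fun x y y' => by simp only [Pi.add_apply, mul_add, Finset.sum_add_distrib]; ring)
    (fun c x y => by
      simp only [Pi.smul_apply, smul_eq_mul, mul_left_comm _ c, ← Finset.mul_sum]; ring)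

variable {p q : ℕ}

/-- The quadratic form `q(x) = (x,x)/2`. -/
def qf (x : Vpq p q) : ℝ := form p q x x / 2

/-- `e(t) = exp(2πit)`. -/
def e (t : ℂ) : ℂ := Complex.exp (2 * Real.pi * Complex.I * t)

/-- `g ∈ SO(V)`. -/
def IsSO (g : Vpq p q ≃ₗ[ℝ] Vpq p q) : Prop :=
  (∀ x y, form p q (g x) (g y) = form p q x y) ∧ LinearMap.det (g : Vpq p q →ₗ[ℝ] Vpq p q) = 1

/-- Orthogonal projection of `ℝ^{p,q}` to the base point `z₀ = span(e_{p+1},…,e_{p+q})`. -/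
def baseNeg (x : Vpq p q) : Vpq p q := Sum.elim (fun _ => 0) (fun i => x (Sum.inr i))

/-- Orthogonal projection of `ℝ^{p,q}` to `z₀^⊥ = span(e_1,…,e_p)`. -/
def basePos (x : Vpq p q) : Vpq p q := Sum.elim (fun j => x (Sum.inl j)) (fun _ => 0)

/-- `v_z`, the orthogonal projection of `v` to `z = g⁻¹(z₀)`. -/
def projZ (g : Vpq p q ≃ₗ[ℝ] Vpq p q) (v : Vpq p q) : Vpq p q := g.symm (baseNeg (g v))

/-- `v_{z^⊥}`, the orthogonal projection of `v` to `z^⊥ = g⁻¹(z₀^⊥)`. -/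
def projZperp (g : Vpq p q ≃ₗ[ℝ] Vpq p q) (v : Vpq p q) : Vpq p q := g.symm (basePos (g v))

/-- `u_z² = (u_z,u_z)`. -/
def normZ (g : Vpq p q ≃ₗ[ℝ] Vpq p q) (u : Vpq p q) : ℝ :=
  form p q (projZ g u) (projZ g u)

/-- `u_{z^⊥}² = (u_{z^⊥},u_{z^⊥})`. -/
def normZperp (g : Vpq p q ≃ₗ[ℝ] Vpq p q) (u : Vpq p q) : ℝ :=
  form p q (projZperp g u) (projZperp g u)

/-- `v_w`, where `w` is the orthogonal complement of `u_z` in `z`. -/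
def projW (g : Vpq p q ≃ₗ[ℝ] Vpq p q) (u v : Vpq p q) : Vpq p q :=
  projZ g v - (form p q v (projZ g u) / normZ g u) • projZ g u

/-- `v_{w^⊥}`, where `w^⊥` is the orthogonal complement of `u_{z^⊥}` in `z^⊥`. -/
def projWperp (g : Vpq p q ≃ₗ[ℝ] Vpq p q) (u v : Vpq p q) : Vpq p q :=
  projZperp g v - (form p q v (projZperp g u) / normZperp g u) • projZperp g u

/-- `g^#(v) = g(v_{w^⊥} + v_w)`. -/
def gSharp (g : Vpq p q ≃ₗ[ℝ] Vpq p q) (u v : Vpq p q) : Vpq p q :=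
  g (projWperp g u v + projW g u v)

/-- `μ = -u' + u_{z^⊥}/(2 u_{z^⊥}²) + u_z/(2 u_z²)`. -/
def mu (g : Vpq p q ≃ₗ[ℝ] Vpq p q) (u u' : Vpq p q) : Vpq p q :=
  -u' + (1 / (2 * normZperp g u)) • projZperp g u + (1 / (2 * normZ g u)) • projZ g u

/-- The Eichler transformation
`E(u,v)(x) = x - (x,u) v + (x,v) u - q(v) (x,u) u`. -/
def eichler (u v x : Vpq p q) : Vpq p q :=
  x - form p q x u • v + form p q x v • u - (qf v * form p q x u) • u

/-! ### Polynomials -/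

/-- The polynomial `P_α(x) = 2^{q/2} ∏_j x_j^{q_j}`, `q_j` the number of `i` with `α_i = j`. -/
def polyP (α : Fin q → Fin p) : MvPolynomial (Idx p q) ℝ :=
  MvPolynomial.C ((2 : ℝ) ^ ((q : ℝ) / 2)) *
    ∏ j : Fin p, MvPolynomial.X (Sum.inl j) ^ (Finset.univ.filter (fun i => α i = j)).card

/-- The Laplacian `Δ = ∑_j ∂²/∂x_j²`. -/
def lap (P : MvPolynomial (Idx p q) ℝ) : MvPolynomial (Idx p q) ℝ :=
  ∑ j, MvPolynomial.pderiv j (MvPolynomial.pderiv j P)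

/-- The value of `exp(-Δ/8πy)(P)` at `x`; only finitely many summands are non-zero. -/
def expLap (y : ℝ) (P : MvPolynomial (Idx p q) ℝ) (x : Vpq p q) : ℝ :=
  ∑' m : ℕ, (1 / (m.factorial : ℝ)) * (-1 / (8 * Real.pi * y)) ^ m *
    MvPolynomial.eval x (lap^[m] P)

/-- The polynomial `P_{g^#,h,0}`, for `P` depending only on the positive coordinates. It is
characterised by
`P(g(v)) = ∑_h (v,u_{z^⊥})^h P_{g^#,h,0}(g^#(v))`, so that `P_{g^#,h,0}(x)`, `x ∈ g^#(V)`, is the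
coefficient of `T^h` in `P(x + T g(u_{z^⊥})/u_{z^⊥}²)`; see `eval_polyP_eq_sum`.
A polynomial on the subspace `g^#(V)` is represented by its composition with the orthogonal
projection `g^# ∘ g⁻¹` of `ℝ^{p,q}` to `g^#(V)`. The Laplacian of `ℝ^{p,q}`, applied to such a
composition, is the Laplacian of `g^#(V) ≅ ℝ^{p-1,q-1}`, because this projection is orthogonal
also for the Euclidean structure `∑ x_j²`. -/
def redPoly (P : MvPolynomial (Idx p q) ℝ) (g : Vpq p q ≃ₗ[ℝ] Vpq p q) (u : Vpq p q) (h : ℕ) :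
    MvPolynomial (Idx p q) ℝ :=
  (MvPolynomial.aeval (fun i : Idx p q =>
      Polynomial.C (∑ j : Idx p q,
        MvPolynomial.C (gSharp g u (g.symm (Pi.single j 1)) i) * MvPolynomial.X j)
      + Polynomial.X * Polynomial.C (MvPolynomial.C (g (projZperp g u) i / normZperp g u))) P :
    Polynomial (MvPolynomial (Idx p q) ℝ)).coeff h

theorem gSharp_symm {g : Vpq p q ≃ₗ[ℝ] Vpq p q} (hg : IsSO g) (u x : Vpq p q) :
    gSharp g u (g.symm x) = x
      - (form p q x (g (projZperp g u)) / normZperp g u) • g (projZperp g u)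
      - (form p q x (g (projZ g u)) / normZ g u) • g (projZ g u) := by
  have h1 : ∀ y, form p q (g.symm x) y = form p q x (g y) := fun y => by
    rw [← hg.1 (g.symm x) y, LinearEquiv.apply_symm_apply]
  have h2 : basePos x + baseNeg x = x := by
    ext i; cases i <;> simp [basePos, baseNeg]
  have h3 : g (projZperp g (g.symm x) + projZ g (g.symm x)) = x := by
    simp [projZperp, projZ, h2]
  rw [map_add] at h3
  simp only [gSharp, projWperp, projW, map_add, map_sub, map_smul, h1]
  nth_rewrite 5 [← h3]
  abel

/-- The decomposition `P_α(g(v)) = ∑_{h=0}^q (v,u_{z^⊥})^h P_{α,g^#,h,0}(g^#(v))`. -/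
theorem eval_polyP_eq_sum (α : Fin q → Fin p) {g : Vpq p q ≃ₗ[ℝ] Vpq p q} (hg : IsSO g)
    (u v : Vpq p q) (hu : normZperp g u ≠ 0) :
    MvPolynomial.eval (g v) (polyP α) = ∑ h ∈ Finset.range (q + 1),
      form p q v (projZperp g u) ^ h *
        MvPolynomial.eval (gSharp g u v) (redPoly (polyP α) g u h) := by
  set a := g (projZperp g u) with ha
  set b := g (projZ g u) with hb
  have hab : form p q a b = 0 := by
    simp [ha, hb, projZ, projZperp, form, basePos, baseNeg]
  have hba : form p q b a = 0 := by
    simp [ha, hb, projZ, projZperp, form, basePos, baseNeg]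
  have haa : form p q a a = normZperp g u := hg.1 _ _
  have hbb : form p q b b = normZ g u := hg.1 _ _
  have hva : form p q v (projZperp g u) = form p q (g v) a := (hg.1 _ _).symm
  have hgv : gSharp g u v = g v - (form p q (g v) a / normZperp g u) • a
      - (form p q (g v) b / normZ g u) • b := by
    have := gSharp_symm hg u (g v)
    rwa [LinearEquiv.symm_apply_apply] at this
  set w := gSharp g u v with hw
  have hwa : form p q w a = 0 := by
    rw [hgv]; simp [haa, hba, hu]
  have hwb : form p q w b / normZ g u = 0 := by
    by_cases hz : normZ g u = 0
    · rw [hz, div_zero]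
    · rw [hgv]; simp [hbb, hab, hz]
  have hidem : ∀ i, ∑ j, gSharp g u (g.symm (Pi.single j 1)) i * w j = w i := by
    intro i
    have e1 : gSharp g u (g.symm w) = w := by
      rw [gSharp_symm hg, ← ha, ← hb, hwa, hwb]; simp
    have e2 : ∀ x : Vpq p q, ∑ j, x j • gSharp g u (g.symm (Pi.single j 1))
        = gSharp g u (g.symm x) := by
      intro x
      have hx : x = ∑ j, x j • (Pi.single j (1 : ℝ) : Vpq p q) := by
        ext i; simp [Finset.sum_apply, Pi.single_apply]
      simp only [gSharp_symm hg]
      conv_rhs => rw [hx]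
      simp only [map_sum, map_smul, LinearMap.sum_apply, LinearMap.smul_apply, smul_sub,
        Finset.sum_sub_distrib, Finset.sum_div, Finset.sum_smul, smul_eq_mul, smul_smul,
        mul_div_assoc]
    have := congrFun (e2 w) i
    rw [e1] at this
    rw [← this]
    simp [Finset.sum_apply, mul_comm]
  have hinl : ∀ j : Fin p, w (Sum.inl j)
      + form p q (g v) a * (a (Sum.inl j) / normZperp g u) = g v (Sum.inl j) := by
    intro j
    have hbj : b (Sum.inl j) = 0 := by simp [hb, projZ, baseNeg]
    rw [hgv]
    simp [hbj]
    ring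
  set Q : Polynomial (MvPolynomial (Idx p q) ℝ) :=
    MvPolynomial.aeval (fun i : Idx p q =>
      Polynomial.C (∑ j : Idx p q,
        MvPolynomial.C (gSharp g u (g.symm (Pi.single j 1)) i) * MvPolynomial.X j)
      + Polynomial.X * Polynomial.C (MvPolynomial.C (a i / normZperp g u))) (polyP α) with hQ
  have hcoeff : ∀ h, redPoly (polyP α) g u h = Q.coeff h := fun h => rfl
  have hdeg : Q.natDegree < q + 1 := by
    rw [Nat.lt_succ_iff, hQ, polyP, map_mul, map_prod]
    refine (Polynomial.natDegree_mul_le).trans ?_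
    have h0 : (MvPolynomial.aeval (fun i : Idx p q =>
        Polynomial.C (∑ j : Idx p q,
          MvPolynomial.C (gSharp g u (g.symm (Pi.single j 1)) i) * MvPolynomial.X j)
        + Polynomial.X * Polynomial.C (MvPolynomial.C (a i / normZperp g u)))
        (MvPolynomial.C ((2 : ℝ) ^ ((q : ℝ) / 2)) : MvPolynomial (Idx p q) ℝ) :
        Polynomial (MvPolynomial (Idx p q) ℝ)).natDegree = 0 := by
      rw [MvPolynomial.aeval_C]
      exact Polynomial.natDegree_C _
    rw [h0, zero_add]
    refine (Polynomial.natDegree_prod_le _ _).trans ?_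
    calc _ ≤ ∑ j : Fin p, (Finset.univ.filter (fun i => α i = j)).card := by
          refine Finset.sum_le_sum fun j _ => ?_
          rw [map_pow, MvPolynomial.aeval_X]
          refine Polynomial.natDegree_pow_le.trans ?_
          conv_rhs => rw [← mul_one (Finset.card _)]
          refine Nat.mul_le_mul_left _ ?_
          refine (Polynomial.natDegree_add_le _ _).trans ?_
          rw [Polynomial.natDegree_C]
          refine max_le (Nat.zero_le _) ?_
          exact (Polynomial.natDegree_mul_C_le _ _).trans Polynomial.natDegree_X_le
      _ = q := by
          rw [← Finset.card_eq_sum_card_fiberwise (f := α) (s := Finset.univ)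
            (t := Finset.univ) (fun _ _ => by simp)]
          simp
  have hev : Polynomial.eval₂ (MvPolynomial.eval w) (form p q (g v) a) Q
      = MvPolynomial.eval (g v) (polyP α) := by
    rw [hQ, polyP]
    simp only [map_mul, map_prod, map_pow, MvPolynomial.aeval_C, MvPolynomial.aeval_X,
      MvPolynomial.eval_C, MvPolynomial.eval_X, ← Polynomial.coe_eval₂RingHom]
    congr 1
    · simp [Polynomial.algebraMap_apply]
    · refine Finset.prod_congr rfl fun j _ => ?_
      congr 1
      rw [← hinl j, ← hidem (Sum.inl j)]
      simp only [Polynomial.coe_eval₂RingHom, Polynomial.eval₂_add, Polynomial.eval₂_mul,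
        Polynomial.eval₂_C, Polynomial.eval₂_X, map_sum, map_mul, MvPolynomial.eval_C,
        MvPolynomial.eval_X, Polynomial.eval₂_finsetSum]
  rw [← hev, Polynomial.eval₂_eq_sum_range' _ hdeg, hva]
  refine Finset.sum_congr rfl fun h _ => ?_
  rw [hcoeff, mul_comm]

/-! ### Lattices, discriminant groups, vector-valued cusp forms -/

/-- `L` is even. -/
def IsEven (L : Submodule ℤ (Vpq p q)) : Prop := ∀ x ∈ L, ∃ n : ℤ, qf x = n

/-- The dual lattice `L'`. -/
def dual (L : Submodule ℤ (Vpq p q)) : Submodule ℤ (Vpq p q) := (form p q).dualSubmodule L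

/-- The quotient `A'/A`; used for `L'/L` and `M'/M`. -/
abbrev Quo (A' A : Submodule ℤ (Vpq p q)) := A' ⧸ A.submoduleOf A'

/-- A representative in `V` of a class in `A'/A`. -/
def rep {A' A : Submodule ℤ (Vpq p q)} (γ : Quo A' A) : Vpq p q :=
  ((Quotient.out γ : A') : Vpq p q)

/-- The space `ℂ[A'/A]`; `φ` stands for `∑_γ φ(γ) 𝔢_γ`. -/
abbrev GrpAlg (A' A : Submodule ℤ (Vpq p q)) := Quo A' A → ℂ

/-- The standard scalar product, antilinear in the second variable. -/
def scal {A' A : Submodule ℤ (Vpq p q)} (φ ψ : GrpAlg A' A) : ℂ :=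
  ∑ᶠ γ, φ γ * starRingEnd ℂ (ψ γ)

/-- `ρ_L(T) 𝔢_γ = e(q(γ)) 𝔢_γ`. -/
def weilT (L : Submodule ℤ (Vpq p q)) (φ : GrpAlg (dual L) L) : GrpAlg (dual L) L :=
  fun γ => e (qf (rep γ)) * φ γ

/-- `ρ_L(S) 𝔢_γ = √i^{q-p} |L'/L|^{-1/2} ∑_δ e(-(γ,δ)) 𝔢_δ`; here `√i = e(1/8)`. -/
def weilS (L : Submodule ℤ (Vpq p q)) (φ : GrpAlg (dual L) L) : GrpAlg (dual L) L :=
  fun δ => e (((q : ℂ) - p) / 8) / (Real.sqrt (Nat.card (Quo (dual L) L)) : ℂ) *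
    ∑ᶠ γ, e (-(form p q (rep γ) (rep δ) : ℝ)) * φ γ

/-- The Fourier coefficient `c(f_γ,n) = ∫_0^1 f_γ(x+i) e(-n(x+i)) dx`. -/
def fcoeff {A' A : Submodule ℤ (Vpq p q)} (f : ℍ → GrpAlg A' A) (γ : Quo A' A) (n : ℝ) : ℂ :=
  ∫ x in (0 : ℝ)..1, f (x +ᵥ UpperHalfPlane.I) γ * e (-(n * (x + Complex.I)))

/-- The exponents `n ∈ ℤ + q(γ)`, `n > 0`. -/
def posExp (L : Submodule ℤ (Vpq p q)) (γ : Quo (dual L) L) : Set ℝ :=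
  {n | 0 < n ∧ ∃ m : ℤ, n = m + qf (rep γ)}

/-- `f` is a cusp form of weight `k = (p+q)/2` for the Weil representation `ρ_L` of `Mp₂(ℤ)`:
holomorphic, with the transformation laws under the generators `T = ((1 1; 0 1), 1)` and
`S = ((0 -1; 1 0), √τ)` of `Mp₂(ℤ)`, and with
`f_γ(τ) = ∑_{n ∈ ℤ + q(γ), n > 0} c(f_γ,n) e(nτ)`. -/
structure IsCuspForm (L : Submodule ℤ (Vpq p q)) (f : ℍ → GrpAlg (dual L) L) : Prop where
  holo : ∀ γ, MDifferentiable 𝓘(ℂ) 𝓘(ℂ) (fun τ => f τ γ)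
  mod_T : ∀ τ : ℍ, f ((1 : ℝ) +ᵥ τ) = weilT L (f τ)
  mod_S : ∀ τ : ℍ, f (ModularGroup.S • τ) =
    fun γ => (τ : ℂ) ^ (((p : ℂ) + q) / 2) * weilS L (f τ) γ
  cusp : ∀ γ (τ : ℍ), HasSum (fun n : posExp L γ => fcoeff f γ n * e ((n : ℝ) * τ)) (f τ γ)

/-! ### The defining integrals -/

/-- The Siegel theta function `Θ_L(τ,g,P)`, for `P` of degree `(m⁺,0)`. -/
def thetaL (L : Submodule ℤ (Vpq p q)) (P : MvPolynomial (Idx p q) ℝ)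
    (g : Vpq p q ≃ₗ[ℝ] Vpq p q) (τ : ℍ) : GrpAlg (dual L) L := fun γ =>
  ((τ.im ^ ((q : ℝ) / 2) : ℝ) : ℂ) * ∑' l : L,
    (expLap τ.im P (g (rep γ + l)) : ℂ) *
      e ((τ : ℂ) * (qf (projZperp g (rep γ + l)) : ℝ)
        + starRingEnd ℂ (τ : ℂ) * (qf (projZ g (rep γ + l)) : ℝ))

/-- The integrand `y^k ⟨f(τ), Θ_L(τ,g,P_α)⟩` of the defining integral. -/
def kernel (L : Submodule ℤ (Vpq p q)) (f : ℍ → GrpAlg (dual L) L) (α : Fin q → Fin p)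
    (g : Vpq p q ≃ₗ[ℝ] Vpq p q) (τ : ℍ) : ℂ :=
  ((τ.im ^ (((p : ℝ) + q) / 2) : ℝ) : ℂ) * scal (f τ) (thetaL L (polyP α) g τ)

/-- The defining integral `I_α(g)` of the lift of `f`, over the standard fundamental domain of
`SL₂(ℤ)` with respect to `dx dy / y²` (the measure `volume` of `ℍ`). -/
def defInt (L : Submodule ℤ (Vpq p q)) (f : ℍ → GrpAlg (dual L) L) (α : Fin q → Fin p)
    (g : Vpq p q ≃ₗ[ℝ] Vpq p q) : ℂ :=
  ∫ τ in ModularGroup.fd, kernel L f α g τ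

/-! ### The smaller lattice -/

/-- The elements of `A` orthogonal to `u` and to `u'`. -/
def orthIn (A : Submodule ℤ (Vpq p q)) (u u' : Vpq p q) : Submodule ℤ (Vpq p q) where
  carrier := {x | x ∈ A ∧ form p q x u = 0 ∧ form p q x u' = 0}
  add_mem' := by
    rintro a b ⟨ha, ha1, ha2⟩ ⟨hb, hb1, hb2⟩
    exact ⟨A.add_mem ha hb, by simp [ha1, hb1], by simp [ha2, hb2]⟩
  zero_mem' := ⟨A.zero_mem, by simp, by simp⟩
  smul_mem' := by
    rintro c x ⟨hx, h1, h2⟩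
    exact ⟨A.smul_mem c hx, by rw [map_zsmul, LinearMap.smul_apply, h1, smul_zero],
      by rw [map_zsmul, LinearMap.smul_apply, h2, smul_zero]⟩

/-- The lattice `M = (L ∩ u^⊥)/ℤu`, realised as `L ∩ u^⊥ ∩ u'^⊥`: for `u' ∈ L'` with
`(u,u') = 1` one has `L ∩ u^⊥ = (L ∩ u^⊥ ∩ u'^⊥) ⊕ ℤu`. -/
def latM (L : Submodule ℤ (Vpq p q)) (u u' : Vpq p q) : Submodule ℤ (Vpq p q) := orthIn L u u'

/-- The dual lattice `M'` of `M` in `M ⊗ ℝ = u^⊥ ∩ u'^⊥`. -/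
def dualM (L : Submodule ℤ (Vpq p q)) (u u' : Vpq p q) : Submodule ℤ (Vpq p q) :=
  orthIn (dual (latM L u u')) u u'

/-- The orthogonal projection of `V` to `M ⊗ ℝ`, for `(u,u) = 0` and `(u,u') = 1`. -/
def projM (u u' v : Vpq p q) : Vpq p q :=
  v - form p q v u • u' + (form p q v u * form p q u' u') • u - form p q v u' • u

/-- The projection `π : L'_0 → M'`, `π(v) = v_M - ((v,u)/N) ζ_M`, where `ζ ∈ L` and
`(ζ,u) = N`. -/
def piM (u u' ζ : Vpq p q) (N : ℕ) (v : Vpq p q) : Vpq p q :=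
  projM u u' v - (form p q v u / N) • projM u u' ζ

/-- The class `δ ∈ L'/L` lies in `L'_0/L`, that is `(δ,u) ≡ 0 mod N`, and `π(δ) = x + M`. -/
def LiesOver (L : Submodule ℤ (Vpq p q)) (u u' ζ : Vpq p q) (N : ℕ) (δ : Quo (dual L) L)
    (x : Vpq p q) : Prop :=
  (∃ m : ℤ, form p q (rep δ) u = m * N) ∧ piM u u' ζ N (rep δ) - x ∈ latM L u u'

/-- `F_M(τ;0,0) = ∑_{γ ∈ M'/M} ∑_{δ ∈ L'_0/L, π(δ) = γ} f_δ(τ) 𝔢_γ`. -/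
def FM (L : Submodule ℤ (Vpq p q)) (u u' ζ : Vpq p q) (N : ℕ) (f : ℍ → GrpAlg (dual L) L)
    (τ : ℍ) : GrpAlg (dualM L u u') (latM L u u') := fun γ =>
  ∑ᶠ (δ : Quo (dual L) L) (_ : LiesOver L u u' ζ N δ (rep γ)), f τ δ

/-- The Siegel theta function `Θ_M(τ,g^#,P)` of the lattice `M` of signature `(p-1,q-1)`, for a
polynomial `P` of degree `(m⁺,0)` on `g^#(V)`. -/
def thetaM (L : Submodule ℤ (Vpq p q)) (u u' : Vpq p q) (P : MvPolynomial (Idx p q) ℝ)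
    (g : Vpq p q ≃ₗ[ℝ] Vpq p q) (τ : ℍ) : GrpAlg (dualM L u u') (latM L u u') := fun γ =>
  ((τ.im ^ (((q : ℝ) - 1) / 2) : ℝ) : ℂ) * ∑' l : latM L u u',
    (expLap τ.im P (gSharp g u (rep γ + l)) : ℂ) *
      e ((τ : ℂ) * (qf (projWperp g u (rep γ + l)) : ℝ)
        + starRingEnd ℂ (τ : ℂ) * (qf (projW g u (rep γ + l)) : ℝ))

/-- The integrand of the constant term. -/
def constKernel (L : Submodule ℤ (Vpq p q)) (u u' ζ : Vpq p q) (N : ℕ)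
    (f : ℍ → GrpAlg (dual L) L) (α : Fin q → Fin p) (g : Vpq p q ≃ₗ[ℝ] Vpq p q) (τ : ℍ) : ℂ :=
  ((τ.im ^ (((p : ℝ) + q) / 2) / (Real.sqrt 2 * Real.sqrt (normZperp g u)) : ℝ) : ℂ) *
    scal (FM L u u' ζ N f τ) (thetaM L u u' (redPoly (polyP α) g u 0) g τ)

/-- The constant term
`∫ y^k / (√2 |u_{z^⊥}|) ⟨F_M(τ;0,0), Θ_M(τ,g^#,P_{α,g^#,0,0})⟩ dx dy / y²`. -/
def constTerm (L : Submodule ℤ (Vpq p q)) (u u' ζ : Vpq p q) (N : ℕ)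
    (f : ℍ → GrpAlg (dual L) L) (α : Fin q → Fin p) (g : Vpq p q ≃ₗ[ℝ] Vpq p q) : ℂ :=
  ∫ τ in ModularGroup.fd, constKernel L u u' ζ N f α g τ

/-- The integrand
`y^{q+(p-5)/2-h} exp(-2πy λ_{w^⊥}²/t² - πt²/(2y u_{z^⊥}²)) exp(-Δ/8πy)(P_{α,g^#,h,0})(g^#(λ/t))`. -/
def yKernel (u : Vpq p q) (α : Fin q → Fin p) (g : Vpq p q ≃ₗ[ℝ] Vpq p q) (lam : Vpq p q)
    (t h : ℕ) (y : ℝ) : ℝ :=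
  y ^ ((q : ℝ) + ((p : ℝ) - 5) / 2 - h) *
    Real.exp (-(2 * Real.pi * y * form p q (projWperp g u lam) (projWperp g u lam) / (t : ℝ) ^ 2)
      - Real.pi * (t : ℝ) ^ 2 / (2 * y * normZperp g u)) *
    expLap y (redPoly (polyP α) g u h) (gSharp g u ((1 / (t : ℝ)) • lam))

/-- The integers `t ≥ 1` dividing `λ ∈ M'`, i.e. with `λ/t ∈ M'`. -/
abbrev Divs (L : Submodule ℤ (Vpq p q)) (u u' lam : Vpq p q) :=
  {t : ℕ // 1 ≤ t ∧ (1 / (t : ℝ)) • lam ∈ dualM L u u'}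

/-- The unfolded part of the coefficient of index `λ`:
`∑_{t ∣ λ} √2/|u_{z^⊥}| ∑_{h=0}^q (t/2i)^h ∑_{δ ∈ L'_0/L, π(δ) = λ/t + M}
  e(t(δ,u')) c(f_δ, q(λ)/t²) ∫_0^∞ … dy`.
For `λ ≠ 0` the sum over `t` is finite. -/
def unfCoeff (L : Submodule ℤ (Vpq p q)) (u u' ζ : Vpq p q) (N : ℕ)
    (f : ℍ → GrpAlg (dual L) L) (α : Fin q → Fin p) (lam : Vpq p q)
    (g : Vpq p q ≃ₗ[ℝ] Vpq p q) : ℂ :=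
  ∑' t : Divs L u u' lam,
    ((Real.sqrt 2 / Real.sqrt (normZperp g u) : ℝ) : ℂ) *
      ∑ h ∈ Finset.range (q + 1), (((t : ℕ) : ℂ) / (2 * Complex.I)) ^ h *
        (∑ᶠ (δ : Quo (dual L) L) (_ : LiesOver L u u' ζ N δ ((1 / ((t : ℕ) : ℝ)) • lam)),
          e ((t : ℕ) * (form p q (rep δ) u' : ℝ)) * fcoeff f δ (qf lam / ((t : ℕ) : ℝ) ^ 2)) *
        ((∫ y in Set.Ioi (0 : ℝ), yKernel u α g lam t h y : ℝ) : ℂ)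

open Classical in
/-- The Fourier coefficient `c_λ(g)` of `I_α`: the unfolded part, and in addition the constant
term if `λ = 0`. -/
def coeff (L : Submodule ℤ (Vpq p q)) (u u' ζ : Vpq p q) (N : ℕ)
    (f : ℍ → GrpAlg (dual L) L) (α : Fin q → Fin p) (lam : Vpq p q)
    (g : Vpq p q ≃ₗ[ℝ] Vpq p q) : ℂ :=
  (if lam = 0 then constTerm L u u' ζ N f α g else 0) + unfCoeff L u u' ζ N f α lam g

open Classical in
/-- `c(f_{v+L},n)` for a vector `v ∈ L'` (if `L = M ⊕ U`, then `M' ⊆ L'`). -/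
def vecCoeff (L : Submodule ℤ (Vpq p q)) (f : ℍ → GrpAlg (dual L) L) (v : Vpq p q) (n : ℝ) : ℂ :=
  if hv : v ∈ dual L then fcoeff f (Submodule.Quotient.mk ⟨v, hv⟩) n else 0

/-- The divisor sum, if `L = M ⊕ U` and `u`, `u'` are the standard generators of `U`:
`√2/|u_{z^⊥}| ∑_{t ∣ λ} ∑_{h=0}^q (t/2i)^h c(f_{λ/t}, q(λ)/t²) ∫_0^∞ … dy`. -/
def splitCoeff (L : Submodule ℤ (Vpq p q)) (u u' : Vpq p q)
    (f : ℍ → GrpAlg (dual L) L) (α : Fin q → Fin p) (lam : Vpq p q)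
    (g : Vpq p q ≃ₗ[ℝ] Vpq p q) : ℂ :=
  ((Real.sqrt 2 / Real.sqrt (normZperp g u) : ℝ) : ℂ) *
    ∑' t : Divs L u u' lam, ∑ h ∈ Finset.range (q + 1), (((t : ℕ) : ℂ) / (2 * Complex.I)) ^ h *
      vecCoeff L f ((1 / ((t : ℕ) : ℝ)) • lam) (qf lam / ((t : ℕ) : ℝ) ^ 2) *
      ((∫ y in Set.Ioi (0 : ℝ), yKernel u α g lam t h y : ℝ) : ℂ)

end KM

end

open scoped UpperHalfPlane MatrixGroups Manifold

noncomputable section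

namespace KM

open MeasureTheory

section

variable {p q : ℕ}

/-! ### Hermite-type polynomials and the operator `exp(-Δ/8πy)` -/

/-! The proof is a Rankin–Selberg unfolding, with the isotropic vector u supplying the sum over
SL₂(ℤ). Let φ_τ be the complex conjugate of the theta summand (`kerFn`), and deform the integrand by
characteristics (a,b): P_τ(a,b) = y^{k+q/2} ∑_{x ∈ L'} f_x(τ) φ_τ(x+bu) e(a(x,u)) (`charKernel`). At
(0,0) this is the integrand of the lift. Since u ∈ L is isotropic, P_τ is ℤ²-periodic. The
generators T and S of SL₂(ℤ) act on it only through (a,b) ↦ (a-b,b) and (a,b) ↦ (b,-a)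
(`charKernel_T`, `charKernel_S`): Poisson summation over L' matches the Weil representation, and the
automorphy factors of f, of the Fourier transform of φ_τ and of the power of y cancel
(`fourierConst_mul`). Hence the Fourier coefficients C_n(τ), n ∈ ℤ², satisfy C_n(γτ) = C_{nγ}(τ)
(`charCoeff_smul`), and the integrand is ∑_n C_n(τ) wherever this sum converges absolutely.

Every n ≠ 0 is t·(0,1)γ with t = gcd(n) ≥ 1 and γ unique up to left multiplication by powers of T;
asking that 0 ≤ Re γτ < 1 makes γ unique (`bijective_rowVec`). As γ and -γ act alike, the
SL₂(ℤ)-translates of the fundamental domain cover ℍ twice, so the terms n ≠ 0 integrate to 2 ∑_t ∫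
C_{(0,t)} over the strip 0 ≤ Re τ < 1 (`unfold_kernel`). The term n = 0 is the constant term
(`constKernel_eq`).

In C_{(0,t)} the integral over a keeps the x with (x,u) = 0, and the integral over b together with
the sum over ℤu becomes an integral over the line x + ℝu. On this line φ_τ is a sum of Hermite
polynomials times a Gaussian. The Hermite variance produced by exp(-Δ/8πy) is exactly the one that
the Fourier transform removes, so pure powers (t/2iy)^h remain, with the factor exp(-πt²/(2y
u_{z^⊥}²)) and a phase that splits into e(t(x,μ)), for the projected vector x ∈ M', and e(t(δ,u'))
(`lineInt_eq`, `form_mu`, `hasSum_charCoeff_unfTerm`). The integral over Re τ then extracts c(f_δ,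
q(x)), which vanishes unless q(x) > 0, and λ = tx reorders the double sum over t and x ∈ M'
(`integral_unfTerm`, `bijective_divPair`).

Convergence rests on ‖f(τ)‖ ≤ C(1+1/y)^A e^{-εy} (`IsCuspForm.exists_bound`) and on the factor
exp(-ct²/y), which for t ≥ 1 beats every power of 1/y. Tonelli gives absolute convergence of ∑
C_n(τ) for almost every τ, so smoothness of P_τ in (a,b) is never needed. Eichler invariance holds
because c_λ depends on g only through g(u) and the restriction of g^# to u^⊥, and E(u,v) changes
neither. -/

/-- The polynomials with generating series `∑ hn s x n T^n / n! = exp (x T - s T² / 2)`. -/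
def hn {R : Type*} [CommRing R] (s x : R) : ℕ → R
  | 0 => 1
  | 1 => x
  | (n + 2) => x * hn s x (n + 1) - s * (n + 1) * hn s x n

/-- Replacing T by cT in the generating series. This turns the factors τ̄², τ̄ of a Fourier
transform into one automorphy factor τ̄ per degree. -/
theorem hn_smul {R : Type*} [CommRing R] (c s x : R) (n : ℕ) :
    hn (c ^ 2 * s) (c * x) n = c ^ n * hn s x n := by
  induction n using Nat.twoStepInduction with
  | zero => simp [hn]
  | one => simp [hn]
  | more n h0 h1 => simp only [hn, h0, h1]; ring

/-- The generating series degenerates to exp(xT). Used where the variances cancel and pure powers of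
t survive. -/
theorem hn_zero_left {R : Type*} [CommRing R] (x : R) (n : ℕ) : hn 0 x n = x ^ n := by
  induction n using Nat.twoStepInduction with
  | zero => simp [hn]
  | one => simp [hn]
  | more n h0 h1 => simp only [hn, h1]; ring

theorem ofReal_hn (s x : ℝ) (n : ℕ) : ((hn s x n : ℝ) : ℂ) = hn (s : ℂ) (x : ℂ) n := by
  induction n using Nat.twoStepInduction with
  | zero => simp [hn]
  | one => simp [hn]
  | more n h0 h1 => simp only [hn, ← h0, ← h1]; push_cast; ring

theorem continuous_hn (s : ℂ) (n : ℕ) : Continuous fun x : ℝ => hn s (x : ℂ) n := by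
  induction n using Nat.twoStepInduction with
  | zero => simp only [hn]; fun_prop
  | one => simp only [hn]; fun_prop
  | more n h0 h1 => simp only [hn]; fun_prop

/-- The Appell property: differentiating the generating series in x multiplies it by T. It feeds the
integration by parts in `integral_hn_gaussian`. -/
theorem hasDerivAt_hn (s : ℂ) (n : ℕ) (x : ℂ) :
    HasDerivAt (fun x => hn s x (n + 1)) ((n + 1) * hn s x n) x := by
  induction n using Nat.twoStepInduction with
  | zero =>
    simp only [hn, Nat.cast_zero, zero_add, mul_one]
    exact hasDerivAt_id x
  | one =>
    have h : HasDerivAt (fun x : ℂ => x * x - s * ((0 : ℕ) + 1) * 1) (1 * x + x * 1 - 0) x :=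
      ((hasDerivAt_id x).mul (hasDerivAt_id x)).sub (hasDerivAt_const _ _)
    refine h.congr_deriv ?_
    simp [hn]; ring
  | more n h0 h1 =>
    have h := ((hasDerivAt_id x).mul h1).sub (h0.const_mul (s * ((n + 1 : ℕ) + 1)))
    refine h.congr_deriv ?_
    simp only [hn]
    push_cast
    simp only [id]
    ring

/-- The linear form `∑ ℓ_i X_i`. -/
def linPoly (l : Vpq p q) : MvPolynomial (Idx p q) ℝ :=
  ∑ i, MvPolynomial.C (l i) * MvPolynomial.X i

/-- The derivative in the direction `ℓ`. -/
def dirDeriv (l : Vpq p q) (P : MvPolynomial (Idx p q) ℝ) : MvPolynomial (Idx p q) ℝ :=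
  ∑ i, MvPolynomial.C (l i) * MvPolynomial.pderiv i P

theorem pderiv_linPoly (l : Vpq p q) (i : Idx p q) :
    MvPolynomial.pderiv i (linPoly l) = MvPolynomial.C (l i) := by
  simp [linPoly, MvPolynomial.pderiv_X, Pi.single_apply, -Fintype.sum_sum_type]

/-- Leibniz rule: second derivatives of a linear form vanish, so only the cross term 2∂_ℓ is left as
commutator of Δ and ℓ. -/
theorem lap_linPoly_mul (l : Vpq p q) (P : MvPolynomial (Idx p q) ℝ) :
    lap (linPoly l * P) = linPoly l * lap P + 2 * dirDeriv l P := by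
  simp only [lap, dirDeriv, Finset.mul_sum, ← Finset.sum_add_distrib]
  refine Finset.sum_congr rfl fun i _ => ?_
  simp only [MvPolynomial.pderiv_mul, map_add, pderiv_linPoly, MvPolynomial.pderiv_C]
  ring

theorem pderiv_lap (i : Idx p q) (P : MvPolynomial (Idx p q) ℝ) :
    MvPolynomial.pderiv i (lap P) = lap (MvPolynomial.pderiv i P) := by
  simp only [lap, map_sum]
  refine Finset.sum_congr rfl fun j _ => ?_
  have hcomm : ∀ F : MvPolynomial (Idx p q) ℝ, MvPolynomial.pderiv i (MvPolynomial.pderiv j F) =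
      MvPolynomial.pderiv j (MvPolynomial.pderiv i F) := fun F => by
    -- The commutator of two derivations is a derivation, so its vanishing may be checked on the
    -- variables.
    have h : ⁅MvPolynomial.pderiv (R := ℝ) i, MvPolynomial.pderiv (R := ℝ) j⁆ = 0 := by
      refine MvPolynomial.derivation_ext fun k => ?_
      simp [Derivation.commutator_apply, MvPolynomial.pderiv_X, Pi.single_apply,
        apply_ite (MvPolynomial.pderiv (R := ℝ) _)]
    have := DFunLike.congr_fun h F
    rwa [Derivation.commutator_apply, Derivation.zero_apply, sub_eq_zero] at this
  rw [hcomm, hcomm]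

theorem lap_C_mul (c : ℝ) (P : MvPolynomial (Idx p q) ℝ) :
    lap (MvPolynomial.C c * P) = MvPolynomial.C c * lap P := by
  simp [lap, Finset.mul_sum, -Fintype.sum_sum_type]

theorem lap_add (P Q : MvPolynomial (Idx p q) ℝ) : lap (P + Q) = lap P + lap Q := by
  simp [lap, Finset.sum_add_distrib]

theorem lap_zero : lap (0 : MvPolynomial (Idx p q) ℝ) = 0 := by simp [lap]

theorem lap_iterate_zero (m : ℕ) : lap^[m] (0 : MvPolynomial (Idx p q) ℝ) = 0 :=
  Function.iterate_fixed lap_zero m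

theorem lap_iterate_add (m : ℕ) (P Q : MvPolynomial (Idx p q) ℝ) :
    lap^[m] (P + Q) = lap^[m] P + lap^[m] Q := by
  induction m with
  | zero => rfl
  | succ m ih => simp only [Function.iterate_succ_apply', ih, lap_add]

theorem lap_iterate_C_mul (m : ℕ) (c : ℝ) (P : MvPolynomial (Idx p q) ℝ) :
    lap^[m] (MvPolynomial.C c * P) = MvPolynomial.C c * lap^[m] P := by
  induction m with
  | zero => rfl
  | succ m ih => simp only [Function.iterate_succ_apply', ih, lap_C_mul]

theorem lap_sum {ι : Type*} (s : Finset ι) (P : ι → MvPolynomial (Idx p q) ℝ) :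
    lap (∑ i ∈ s, P i) = ∑ i ∈ s, lap (P i) := by
  simp only [lap, map_sum]
  exact Finset.sum_comm

theorem dirDeriv_lap (l : Vpq p q) (P : MvPolynomial (Idx p q) ℝ) :
    dirDeriv l (lap P) = lap (dirDeriv l P) := by
  simp only [dirDeriv, pderiv_lap, lap_sum, lap_C_mul]

theorem dirDeriv_lap_iterate (l : Vpq p q) (m : ℕ) (P : MvPolynomial (Idx p q) ℝ) :
    dirDeriv l (lap^[m] P) = lap^[m] (dirDeriv l P) := by
  induction m with
  | zero => rfl
  | succ m ih => simp only [Function.iterate_succ_apply', dirDeriv_lap, ih]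

theorem dirDeriv_zero (l : Vpq p q) : dirDeriv l 0 = 0 := by simp [dirDeriv]

/-- The commutator 2∂_ℓ commutes with Δ, so it appears m+1 times in the commutator of Δ^{m+1} with
ℓ. -/
theorem lap_iterate_linPoly_mul (l : Vpq p q) (m : ℕ) (P : MvPolynomial (Idx p q) ℝ) :
    lap^[m + 1] (linPoly l * P) =
      linPoly l * lap^[m + 1] P + MvPolynomial.C (2 * (m + 1 : ℝ)) * lap^[m] (dirDeriv l P) := by
  induction m with
  | zero => simp [lap_linPoly_mul, show (MvPolynomial.C 2 : MvPolynomial (Idx p q) ℝ) = 2 from rfl]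
  | succ m ih =>
    rw [Function.iterate_succ_apply', ih, lap_add, lap_linPoly_mul, lap_C_mul,
      ← Function.iterate_succ_apply' lap, ← Function.iterate_succ_apply' lap,
      dirDeriv_lap_iterate, add_assoc]
    congr 1
    push_cast
    simp only [map_mul, map_add, map_one, map_natCast, map_ofNat]
    ring

/-- Δ is nilpotent on each polynomial: by the commutator formula, multiplying by a variable costs at
most one more application of Δ. -/
theorem exists_lap_iterate_eq_zero (P : MvPolynomial (Idx p q) ℝ) :
    ∃ M, ∀ m, M ≤ m → lap^[m] P = 0 := by
  induction P using MvPolynomial.induction_on with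
  | C a =>
    refine ⟨1, fun m hm => ?_⟩
    obtain ⟨m, rfl⟩ := Nat.exists_eq_add_of_le' hm
    rw [Function.iterate_succ_apply]
    simp [lap, lap_iterate_zero]
  | add P Q hP hQ =>
    obtain ⟨M, hM⟩ := hP
    obtain ⟨M', hM'⟩ := hQ
    exact ⟨max M M', fun m hm => by
      rw [lap_iterate_add, hM m (le_of_max_le_left hm), hM' m (le_of_max_le_right hm), add_zero]⟩
  | mul_X P i hP =>
    obtain ⟨M, hM⟩ := hP
    refine ⟨M + 1, fun m hm => ?_⟩
    obtain ⟨m, rfl⟩ := Nat.exists_eq_add_of_le' (Nat.one_le_of_lt hm)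
    have hX : P * MvPolynomial.X i = linPoly (Pi.single i 1) * P := by
      simp [linPoly, Pi.single_apply, mul_comm, apply_ite MvPolynomial.C, Finset.sum_ite_eq']
    rw [hX, lap_iterate_linPoly_mul, hM _ (by omega), ← dirDeriv_lap_iterate, hM _ (by omega),
      dirDeriv_zero]
    simp

theorem summable_expLap (y : ℝ) (P : MvPolynomial (Idx p q) ℝ) (x : Vpq p q) :
    Summable fun m : ℕ => (1 / (m.factorial : ℝ)) * (-1 / (8 * Real.pi * y)) ^ m *
      MvPolynomial.eval x (lap^[m] P) := by
  obtain ⟨M, hM⟩ := exists_lap_iterate_eq_zero P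
  refine summable_of_ne_finset_zero (s := Finset.range M) fun m hm => ?_
  rw [hM m (by simpa using hm)]
  simp

/-- The cutoff M is independent of y and x, so `expLap` is a polynomial in 1/y and x; bounds and
continuity follow from this. -/
theorem expLap_eq_sum (P : MvPolynomial (Idx p q) ℝ) :
    ∃ M, ∀ y x, expLap y P x = ∑ m ∈ Finset.range M, (1 / (m.factorial : ℝ)) *
      (-1 / (8 * Real.pi * y)) ^ m * MvPolynomial.eval x (lap^[m] P) := by
  obtain ⟨M, hM⟩ := exists_lap_iterate_eq_zero P
  refine ⟨M, fun y x => tsum_eq_sum fun m hm => ?_⟩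
  rw [hM m (by simpa using hm)]
  simp

theorem expLap_add (y : ℝ) (P Q : MvPolynomial (Idx p q) ℝ) (x : Vpq p q) :
    expLap y (P + Q) x = expLap y P x + expLap y Q x := by
  rw [expLap, expLap, expLap, ← (summable_expLap y P x).tsum_add (summable_expLap y Q x)]
  simp only [lap_iterate_add, map_add, mul_add]

theorem expLap_C_mul (y : ℝ) (c : ℝ) (P : MvPolynomial (Idx p q) ℝ) (x : Vpq p q) :
    expLap y (MvPolynomial.C c * P) x = c * expLap y P x := by
  rw [expLap, expLap, ← tsum_mul_left]
  refine tsum_congr fun m => ?_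
  rw [lap_iterate_C_mul, map_mul, MvPolynomial.eval_C]
  ring

theorem expLap_zero (y : ℝ) (x : Vpq p q) :
    expLap y (0 : MvPolynomial (Idx p q) ℝ) x = 0 := by
  simpa using expLap_C_mul y 0 (0 : MvPolynomial (Idx p q) ℝ) x

theorem expLap_one (y : ℝ) (x : Vpq p q) :
    expLap y (1 : MvPolynomial (Idx p q) ℝ) x = 1 := by
  rw [expLap, tsum_eq_single 0]
  · simp
  · intro m hm
    obtain ⟨m, rfl⟩ := Nat.exists_eq_succ_of_ne_zero hm
    have : lap (1 : MvPolynomial (Idx p q) ℝ) = 0 := by simp [lap]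
    rw [Nat.succ_eq_add_one, Function.iterate_succ_apply, this, lap_iterate_zero]
    simp

theorem expLap_sum {ι : Type*} (s : Finset ι) (y : ℝ) (P : ι → MvPolynomial (Idx p q) ℝ)
    (x : Vpq p q) : expLap y (∑ i ∈ s, P i) x = ∑ i ∈ s, expLap y (P i) x := by
  classical
  induction s using Finset.induction_on with
  | empty => simp [expLap_zero]
  | insert a s ha ih => rw [Finset.sum_insert ha, Finset.sum_insert ha, expLap_add, ih]

/-- Exponentiating the commutator 2∂_ℓ: conjugating multiplication by ℓ with exp(-Δ/8πy) turns it
into ℓ - ∂_ℓ/(4πy). -/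
theorem expLap_linPoly_mul (y : ℝ) (l : Vpq p q) (P : MvPolynomial (Idx p q) ℝ) (x : Vpq p q) :
    expLap y (linPoly l * P) x = MvPolynomial.eval x (linPoly l) * expLap y P x
      - 1 / (4 * Real.pi * y) * expLap y (dirDeriv l P) x := by
  have h1 := summable_expLap y (linPoly l * P) x
  have h2 := summable_expLap y P x
  rw [expLap, h1.tsum_eq_zero_add, expLap, h2.tsum_eq_zero_add, expLap, mul_add, ← tsum_mul_left,
    ← tsum_mul_left, add_sub_assoc,
    ← (((summable_nat_add_iff 1).2 h2).mul_left _).tsum_sub ((summable_expLap y _ x).mul_left _)]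
  congr 1
  · simp
  · refine tsum_congr fun m => ?_
    rw [lap_iterate_linPoly_mul, map_add, map_mul, map_mul, MvPolynomial.eval_C,
      Nat.factorial_succ]
    have : (m.factorial : ℝ) ≠ 0 := by positivity
    -- Division by zero gives 0, so every term on both sides vanishes at y = 0.
    by_cases hy : y = 0
    · subst hy; simp [pow_succ]
    push_cast
    have h4 : -1 / (8 * Real.pi * y) = -(1 / (4 * Real.pi * y)) / 2 := by
      field_simp
      norm_num
    rw [h4]
    generalize 1 / (4 * Real.pi * y) = w
    field_simp
    ring

theorem dirDeriv_mul (l : Vpq p q) (P Q : MvPolynomial (Idx p q) ℝ) :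
    dirDeriv l (P * Q) = dirDeriv l P * Q + P * dirDeriv l Q := by
  simp only [dirDeriv, MvPolynomial.pderiv_mul, Finset.sum_mul, Finset.mul_sum,
    ← Finset.sum_add_distrib]
  exact Finset.sum_congr rfl fun i _ => by ring

theorem dirDeriv_linPoly_pow (l : Vpq p q) (h : ℕ) :
    dirDeriv l (linPoly l ^ (h + 1)) =
      MvPolynomial.C ((h + 1 : ℝ) * ∑ i, l i ^ 2) * linPoly l ^ h := by
  simp only [dirDeriv, MvPolynomial.pderiv_pow, pderiv_linPoly, map_mul, map_sum, map_pow]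
  rw [Finset.mul_sum, Finset.sum_mul]
  refine Finset.sum_congr rfl fun i _ => ?_
  simp only [map_add, map_one, map_natCast, Nat.add_sub_cancel]
  push_cast
  ring

/-- The heat operator on `ℓ^h R`, where `R` is constant in the direction of `ℓ`. -/
theorem expLap_linPoly_pow_mul (y : ℝ) (l : Vpq p q) {R : MvPolynomial (Idx p q) ℝ}
    (hR : dirDeriv l R = 0) (h : ℕ) (x : Vpq p q) :
    expLap y (linPoly l ^ h * R) x =
      hn ((∑ i, l i ^ 2) / (4 * Real.pi * y)) (MvPolynomial.eval x (linPoly l)) h *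
        expLap y R x := by
  induction h using Nat.twoStepInduction with
  | zero => simp [hn]
  | one => simp [hn, expLap_linPoly_mul, hR, expLap_zero]
  | more h h0 h1 =>
    -- Since ∂_ℓ ℓ^{h+1} = (h+1)|ℓ|² ℓ^h and ∂_ℓ R = 0, the commutator formula becomes the recursion
    -- that defines `hn`, with s = |ℓ|²/(4πy).
    rw [pow_succ' _ (h + 1), mul_assoc (linPoly l), expLap_linPoly_mul, h1, dirDeriv_mul, hR,
      mul_zero, add_zero, dirDeriv_linPoly_pow, mul_assoc (MvPolynomial.C _), expLap_C_mul, h0]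
    simp only [hn]
    ring

theorem exists_eval_bound (P : MvPolynomial (Idx p q) ℝ) :
    ∃ C > 0, ∃ A : ℕ, ∀ x : Vpq p q, |MvPolynomial.eval x P| ≤ C * (1 + ‖x‖) ^ A := by
  induction P using MvPolynomial.induction_on with
  | C a => exact ⟨|a| + 1, by positivity, 0, fun x => by simp⟩
  | add P Q hP hQ =>
    obtain ⟨C, hC, A, h⟩ := hP
    obtain ⟨C', hC', A', h'⟩ := hQ
    refine ⟨C + C', by positivity, A + A', fun x => ?_⟩
    have h1 : (1 : ℝ) ≤ 1 + ‖x‖ := by simp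
    rw [map_add, add_mul]
    refine (abs_add_le _ _).trans (add_le_add ((h x).trans ?_) ((h' x).trans ?_)) <;> gcongr
        <;> first | exact h1 | omega
  | mul_X P i hP =>
    obtain ⟨C, hC, A, h⟩ := hP
    refine ⟨C, hC, A + 1, fun x => ?_⟩
    rw [map_mul, MvPolynomial.eval_X, abs_mul, pow_succ, ← mul_assoc]
    have := norm_le_pi_norm x i
    rw [Real.norm_eq_abs] at this
    have h0 := norm_nonneg x
    gcongr
    · exact h x
    · linarith

theorem exists_expLap_bound (P : MvPolynomial (Idx p q) ℝ) :
    ∃ C > 0, ∃ A : ℕ, ∀ y > 0, ∀ x : Vpq p q,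
      |expLap y P x| ≤ C * (1 + 1 / y) ^ A * (1 + ‖x‖) ^ A := by
  obtain ⟨M, hM⟩ := expLap_eq_sum P
  choose C hC A hA using fun m => exists_eval_bound (lap^[m] P)
  refine ⟨1 + ∑ m ∈ Finset.range M, C m, ?_, M + ∑ m ∈ Finset.range M, A m, fun y hy x => ?_⟩
  · have := Finset.sum_nonneg fun m (_ : m ∈ Finset.range M) => (hC m).le
    positivity
  rw [hM]
  have h1 : (1 : ℝ) ≤ 1 + ‖x‖ := by simp
  have h2 : (1 : ℝ) ≤ 1 + 1 / y := by simp [hy.le]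
  set B := (1 + 1 / y) ^ (M + ∑ m ∈ Finset.range M, A m) *
    (1 + ‖x‖) ^ (M + ∑ m ∈ Finset.range M, A m) with hB
  have hB0 : 0 ≤ B := by positivity
  have hterm : ∀ m ∈ Finset.range M, |(1 / (m.factorial : ℝ)) *
      (-1 / (8 * Real.pi * y)) ^ m * MvPolynomial.eval x (lap^[m] P)| ≤ C m * B := by
    intro m hm
    rw [abs_mul, abs_mul, abs_pow]
    have e1 : |1 / (m.factorial : ℝ)| ≤ 1 := by
      rw [abs_of_nonneg (by positivity), div_le_one (by positivity)]
      exact_mod_cast Nat.one_le_iff_ne_zero.2 m.factorial_ne_zero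
    have e2 : |-1 / (8 * Real.pi * y)| ≤ 1 + 1 / y := by
      rw [abs_div, abs_neg, abs_one, abs_of_pos (by positivity)]
      have : 1 / (8 * Real.pi * y) ≤ 1 / y := by
        apply one_div_le_one_div_of_le hy
        nlinarith [Real.pi_gt_three]
      linarith
    have e3 : (1 + 1 / y) ^ m ≤ (1 + 1 / y) ^ (M + ∑ m ∈ Finset.range M, A m) := by
      refine pow_le_pow_right₀ h2 ?_
      have := Finset.mem_range.1 hm
      omega
    have e4 : (1 + ‖x‖) ^ A m ≤ (1 + ‖x‖) ^ (M + ∑ m ∈ Finset.range M, A m) := by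
      refine pow_le_pow_right₀ h1 ?_
      have := Finset.single_le_sum (f := A) (fun _ _ => Nat.zero_le _) hm
      omega
    calc _ ≤ 1 * (1 + 1 / y) ^ m * (C m * (1 + ‖x‖) ^ A m) := by
          gcongr
          exact hA m x
      _ = C m * ((1 + 1 / y) ^ m * (1 + ‖x‖) ^ A m) := by ring
      _ ≤ C m * B := by
          rw [hB]
          have := (hC m).le
          gcongr
  calc _ ≤ ∑ m ∈ Finset.range M, C m * B :=
        (Finset.abs_sum_le_sum_abs _ _).trans (Finset.sum_le_sum hterm)
    _ = (∑ m ∈ Finset.range M, C m) * B := by rw [Finset.sum_mul]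
    _ ≤ (1 + ∑ m ∈ Finset.range M, C m) * B := by gcongr; linarith
    _ = _ := by rw [hB]; ring

theorem continuousOn_expLap (P : MvPolynomial (Idx p q) ℝ) :
    ContinuousOn (fun z : ℝ × Vpq p q => expLap z.1 P z.2) (Set.Ioi 0 ×ˢ Set.univ) := by
  obtain ⟨M, hM⟩ := expLap_eq_sum P
  simp only [hM]
  refine continuousOn_finsetSum _ fun m _ => ?_
  refine ContinuousOn.mul (ContinuousOn.mul continuousOn_const (ContinuousOn.pow ?_ _)) ?_
  · refine ContinuousOn.div continuousOn_const (by fun_prop) ?_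
    rintro ⟨y, x⟩ ⟨hy, -⟩
    have : (0 : ℝ) < y := hy
    positivity
  · exact ((MvPolynomial.continuous_eval _).comp continuous_snd).continuousOn

theorem continuousOn_expLap_left (P : MvPolynomial (Idx p q) ℝ) (x : Vpq p q) :
    ContinuousOn (fun y => expLap y P x) (Set.Ioi 0) :=
  (continuousOn_expLap P).comp (f := fun y : ℝ => (y, x)) (by fun_prop) fun y hy => ⟨hy, trivial⟩

/-- The heat operator on the monomial `P_α`. -/
theorem expLap_polyP (y : ℝ) (α : Fin q → Fin p) (x : Vpq p q) :
    expLap y (polyP α) x = (2 : ℝ) ^ ((q : ℝ) / 2) * ∏ j : Fin p,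
      hn (1 / (4 * Real.pi * y)) (x (Sum.inl j)) (Finset.univ.filter (fun i => α i = j)).card := by
  rw [polyP, expLap_C_mul]
  congr 1
  have hX : ∀ i : Idx p q, MvPolynomial.X i = linPoly (Pi.single i (1 : ℝ) : Vpq p q) := fun i => by
    simp [linPoly, Pi.single_apply, apply_ite MvPolynomial.C, ite_mul]
  have key : ∀ s : Finset (Fin p), expLap y (∏ j ∈ s, (MvPolynomial.X (Sum.inl j) :
      MvPolynomial (Idx p q) ℝ) ^ (Finset.univ.filter (fun i => α i = j)).card) x =
      ∏ j ∈ s, hn (1 / (4 * Real.pi * y)) (x (Sum.inl j))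
        (Finset.univ.filter (fun i => α i = j)).card := by
    intro s
    induction s using Finset.induction_on with
    | empty => simp [expLap_one]
    | insert j s hj ih =>
      rw [Finset.prod_insert hj, Finset.prod_insert hj, hX, expLap_linPoly_pow_mul, ih]
      · congr 2
        · simp [Pi.single_apply]
        · simp [linPoly, Pi.single_apply]
      -- The remaining variables differ from X_j, so their product is constant in that direction;
      -- subsets t of s make the induction run.
      · have : ∀ t ⊆ s, MvPolynomial.pderiv (Sum.inl j) (∏ j ∈ t, (MvPolynomial.X (Sum.inl j) :
            MvPolynomial (Idx p q) ℝ) ^ (Finset.univ.filter (fun i => α i = j)).card) = 0 := by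
          intro t ht
          induction t using Finset.induction_on with
          | empty => simp
          | insert i t hi iht =>
            have hij : i ≠ j := by
              rintro rfl
              exact hj (ht (Finset.mem_insert_self _ _))
            rw [Finset.prod_insert hi, MvPolynomial.pderiv_mul,
              iht fun a ha => ht (Finset.mem_insert_of_mem ha), MvPolynomial.pderiv_pow,
              MvPolynomial.pderiv_X_of_ne (by simpa using hij)]
            simp
        simp [dirDeriv, Pi.single_apply, this s (le_refl s)]
  exact key Finset.univ

end

section

variable {p q : ℕ}

/-! ### Gaussian decay and Gaussian integrals -/

theorem exists_pow_mul_exp_bound (A : ℕ) {β : ℝ} (hβ : 0 < β) (γ : ℝ) :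
    ∃ C > 0, ∀ x : ℝ, 0 ≤ x → (1 + x) ^ A * Real.exp (-β * x ^ 2 + γ * x) ≤ C := by
  -- By (1+x)^A ≤ e^{Ax} the exponent is at most (A+γ)x - βx², whose maximum is (A+γ)²/(4β).
  refine ⟨Real.exp ((A + γ) ^ 2 / (4 * β)), Real.exp_pos _, fun x hx => ?_⟩
  have h1 : (1 + x) ^ A ≤ Real.exp (A * x) := by
    rw [Real.exp_nat_mul]
    gcongr
    linarith [Real.add_one_le_exp x]
  calc _ ≤ Real.exp (A * x) * Real.exp (-β * x ^ 2 + γ * x) := by gcongr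
    _ = Real.exp (A * x + (-β * x ^ 2 + γ * x)) := (Real.exp_add _ _).symm
    _ ≤ _ := by
      apply Real.exp_le_exp.2
      rw [le_div_iff₀ (by positivity)]
      nlinarith [sq_nonneg (2 * β * x - (A + γ))]

/-- Rescale to r√y, where the bound is independent of y; undoing the scaling costs powers of 1/√y ≤
1+1/y. -/
theorem exists_pow_mul_exp_bound_uniform (A : ℕ) {c : ℝ} (hc : 0 < c) :
    ∃ C > 0, ∀ y > 0, ∀ r : ℝ, 0 ≤ r →
      (1 + r) ^ A * Real.exp (-(c * y * r ^ 2)) ≤ C * (1 + 1 / y) ^ A := by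
  obtain ⟨C, hC, h⟩ := exists_pow_mul_exp_bound A hc 0
  refine ⟨C * 2 ^ A, by positivity, fun y hy r hr => ?_⟩
  have hs : 0 < Real.sqrt y := Real.sqrt_pos.2 hy
  have hsy : Real.sqrt y ^ 2 = y := Real.sq_sqrt hy.le
  have h1 : 1 / Real.sqrt y ≤ 1 + 1 / y := by
    rw [← hsy, Real.sqrt_sq hs.le, ← one_div_pow]
    nlinarith [sq_nonneg (1 / Real.sqrt y - 1)]
  have h2 : 1 + r ≤ (1 + r * Real.sqrt y) * (2 * (1 + 1 / y)) := by
    have h3 : r ≤ r * Real.sqrt y * (1 + 1 / y) := by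
      calc r = r * Real.sqrt y * (1 / Real.sqrt y) := by field_simp
        _ ≤ _ := by gcongr
    have h4 : 0 < 1 / y := by positivity
    have h5 : 0 ≤ r * Real.sqrt y * (1 + 1 / y) := by positivity
    nlinarith
  have h6 := h (r * Real.sqrt y) (by positivity)
  rw [zero_mul, add_zero, mul_pow, hsy] at h6
  calc _ ≤ ((1 + r * Real.sqrt y) * (2 * (1 + 1 / y))) ^ A * Real.exp (-(c * y * r ^ 2)) := by
        gcongr
    _ = ((1 + r * Real.sqrt y) ^ A * Real.exp (-c * (r ^ 2 * y))) * (2 ^ A * (1 + 1 / y) ^ A) := by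
        rw [mul_pow, mul_pow, show -(c * y * r ^ 2) = -c * (r ^ 2 * y) by ring]
        ring
    _ ≤ C * (2 ^ A * (1 + 1 / y) ^ A) := by gcongr
    _ = _ := by ring

theorem exists_hn_bound (s : ℂ) (n : ℕ) :
    ∃ C > 0, ∀ x : ℂ, ‖hn s x n‖ ≤ C * (1 + ‖x‖) ^ n := by
  induction n using Nat.twoStepInduction with
  | zero => exact ⟨1, one_pos, fun x => by simp [hn]⟩
  | one => exact ⟨1, one_pos, fun x => by simp [hn]⟩
  | more n h0 h1 =>
    obtain ⟨C, hC, h0⟩ := h0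
    obtain ⟨C', hC', h1⟩ := h1
    refine ⟨C' + ‖s * (n + 1)‖ * C, by positivity, fun x => ?_⟩
    have h2 : (1 : ℝ) ≤ 1 + ‖x‖ := by simp
    simp only [hn]
    refine (norm_sub_le _ _).trans ?_
    rw [norm_mul, norm_mul (s * (n + 1)), add_mul]
    refine add_le_add ?_ ?_
    · calc ‖x‖ * ‖hn s x (n + 1)‖ ≤ (1 + ‖x‖) * (C' * (1 + ‖x‖) ^ (n + 1)) := by
            gcongr
            · linarith
            · exact h1 x
        _ = _ := by ring
    · rw [mul_assoc]
      gcongr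
      refine (h0 x).trans ?_
      gcongr
      omega

theorem integrable_of_decay {F : ℝ → ℂ} (hF : Continuous F) {C : ℝ}
    (h : ∀ x, (1 + |x|) ^ 2 * ‖F x‖ ≤ C) : Integrable F := by
  refine (integrable_inv_one_add_sq.const_mul C).mono' hF.aestronglyMeasurable
    (.of_forall fun x => ?_)
  rw [← div_eq_mul_inv, le_div_iff₀ (by positivity)]
  refine le_trans ?_ (h x)
  rw [mul_comm]
  gcongr
  nlinarith [sq_abs x, abs_nonneg x]

/-- For complex w the linear term grows at most like e^{2π|Im w||x|}, which the Gaussian absorbs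
along with all polynomial factors. -/
theorem exists_hn_gaussian_decay {b : ℂ} (hb : 0 < b.re) (s w : ℂ) (n A : ℕ) :
    ∃ C > 0, ∀ x : ℝ, (1 + |x|) ^ A *
      ‖hn s x n * Complex.exp (-Real.pi * b * x ^ 2 - 2 * Real.pi * Complex.I * w * x)‖ ≤ C := by
  obtain ⟨C, hC, h⟩ := exists_hn_bound s n
  obtain ⟨C', hC', h'⟩ := exists_pow_mul_exp_bound (A + n)
    (mul_pos Real.pi_pos hb) (2 * Real.pi * |w.im|)
  refine ⟨C * C', by positivity, fun x => ?_⟩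
  rw [norm_mul, Complex.norm_exp]
  have h1 : (-Real.pi * b * x ^ 2 - 2 * Real.pi * Complex.I * w * x : ℂ).re ≤
      -(Real.pi * b.re) * |x| ^ 2 + 2 * Real.pi * |w.im| * |x| := by
    have e : (-Real.pi * b * x ^ 2 - 2 * Real.pi * Complex.I * w * x : ℂ) =
      -(((Real.pi * x ^ 2 : ℝ) : ℂ) * b) - ((2 * Real.pi * x : ℝ) : ℂ) * (Complex.I * w) := by
      push_cast; ring
    rw [e, Complex.sub_re, Complex.neg_re, Complex.re_ofReal_mul, Complex.re_ofReal_mul,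
      Complex.I_mul_re, sq_abs]
    have := le_abs_self (w.im * x)
    rw [abs_mul] at this
    nlinarith [Real.pi_pos]
  have h2 := h (x : ℂ)
  rw [Complex.norm_real, Real.norm_eq_abs] at h2
  calc _ ≤ (1 + |x|) ^ A * (C * (1 + |x|) ^ n *
        Real.exp (-(Real.pi * b.re) * |x| ^ 2 + 2 * Real.pi * |w.im| * |x|)) := by gcongr
    _ = C * ((1 + |x|) ^ (A + n) *
        Real.exp (-(Real.pi * b.re) * |x| ^ 2 + 2 * Real.pi * |w.im| * |x|)) := by
        rw [pow_add]; ring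
    _ ≤ C * C' := by gcongr; exact h' _ (abs_nonneg x)

theorem integrable_hn_gaussian {b : ℂ} (hb : 0 < b.re) (s w : ℂ) (n : ℕ) :
    Integrable fun x : ℝ =>
      hn s x n * Complex.exp (-Real.pi * b * x ^ 2 - 2 * Real.pi * Complex.I * w * x) := by
  obtain ⟨C, -, h⟩ := exists_hn_gaussian_decay hb s w n 2
  exact integrable_of_decay ((continuous_hn s n).mul (by fun_prop)) h

/-- The Fourier transform of a Hermite polynomial times a Gaussian. -/
theorem integral_hn_gaussian {b : ℂ} (hb : 0 < b.re) (s w : ℂ) (n : ℕ) :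
    ∫ x : ℝ, hn s x n * Complex.exp (-Real.pi * b * x ^ 2 - 2 * Real.pi * Complex.I * w * x) =
      1 / b ^ (1 / 2 : ℂ) * Complex.exp (-Real.pi * w ^ 2 / b) *
        hn (s - 1 / (2 * Real.pi * b)) (-Complex.I * w / b) n := by
  have hb0 : b ≠ 0 := by rintro rfl; simp at hb
  have hpi : (Real.pi : ℂ) ≠ 0 := by exact_mod_cast Real.pi_ne_zero
  have hE : ∀ x : ℝ, HasDerivAt (fun x : ℝ =>
      Complex.exp (-Real.pi * b * x ^ 2 - 2 * Real.pi * Complex.I * w * x))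
      (Complex.exp (-Real.pi * b * x ^ 2 - 2 * Real.pi * Complex.I * w * x) *
        (-2 * Real.pi * b * x - 2 * Real.pi * Complex.I * w)) x := by
    intro x
    have h1 : HasDerivAt (fun x : ℂ => -Real.pi * b * x ^ 2 - 2 * Real.pi * Complex.I * w * x)
        (-2 * Real.pi * b * x - 2 * Real.pi * Complex.I * w) (x : ℂ) := by
      have := ((hasDerivAt_pow 2 (x : ℂ)).const_mul (-Real.pi * b)).sub
        ((hasDerivAt_id (x : ℂ)).const_mul (2 * Real.pi * Complex.I * w))
      refine this.congr_deriv ?_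
      simp; ring
    exact h1.cexp.comp_ofReal
  set J := fun n => ∫ x : ℝ,
    hn s x n * Complex.exp (-Real.pi * b * x ^ 2 - 2 * Real.pi * Complex.I * w * x) with hJ
  have hint := integrable_hn_gaussian hb s w
  have hJ0 : J 0 = 1 / b ^ (1 / 2 : ℂ) * Complex.exp (-Real.pi * w ^ 2 / b) := by
    have h := integral_cexp_quadratic (b := -Real.pi * b) (by simpa using mul_pos Real.pi_pos hb)
      (-2 * Real.pi * Complex.I * w) 0
    have e1 : (Real.pi : ℂ) / -(-Real.pi * b) = b⁻¹ := by field_simp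
    -- Since Re b > 0, b stays off the branch cut and the principal square root commutes with
    -- inversion.
    have e2 : b.arg ≠ Real.pi := by
      intro h
      have := Complex.arg_eq_pi_iff.1 h
      linarith [this.1]
    rw [e1, Complex.inv_cpow _ _ e2] at h
    simp only [hJ, hn, one_mul]
    convert! h using 2
    · ext x; congr 1; ring
    · rw [one_div]
    · congr 1
      field_simp
      ring_nf
      simp
  have hJ1 : J 1 = -Complex.I * w / b * J 0 := by
    have h0 := integral_eq_zero_of_hasDerivAt_of_integrable (f := fun x : ℝ =>
      Complex.exp (-Real.pi * b * x ^ 2 - 2 * Real.pi * Complex.I * w * x)) hE ?_ ?_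
    · have e : ∀ x : ℝ, Complex.exp (-Real.pi * b * x ^ 2 - 2 * Real.pi * Complex.I * w * x) *
        (-2 * Real.pi * b * x - 2 * Real.pi * Complex.I * w) =
        (-2 * Real.pi * b) * (hn s x 1 *
          Complex.exp (-Real.pi * b * x ^ 2 - 2 * Real.pi * Complex.I * w * x)) -
        (2 * Real.pi * Complex.I * w) * (hn s x 0 *
          Complex.exp (-Real.pi * b * x ^ 2 - 2 * Real.pi * Complex.I * w * x)) := by
        intro x; simp only [hn]; ring
      simp_rw [e] at h0
      rw [integral_sub ((hint 1).const_mul _) ((hint 0).const_mul _), integral_const_mul,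
        integral_const_mul] at h0
      change (-2 * Real.pi * b) * J 1 - (2 * Real.pi * Complex.I * w) * J 0 = 0 at h0
      field_simp
      have : (2 * Real.pi : ℂ) * (b * J 1 + Complex.I * w * J 0) = 0 := by linear_combination -h0
      rcases mul_eq_zero.1 this with h | h
      · exact absurd h (by simp [hpi])
      · linear_combination h
    · have := ((hint 1).const_mul (-2 * Real.pi * b)).sub
        ((hint 0).const_mul (2 * Real.pi * Complex.I * w))
      refine this.congr (.of_forall fun x => ?_)
      simp only [hn, Pi.sub_apply]; ring
    · simpa [hn] using hint 0
  -- The total derivative of hn_{n+1} times the exponential integrates to 0. Its linear factor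
  -- raises the index through the recursion of `hn`, and the derivative of hn_{n+1} contributes the
  -- shift 1/(2πb) of s. So J obeys the recursion of `hn` at the new parameters.
  have hJs : ∀ n, J (n + 2) = -Complex.I * w / b * J (n + 1)
      - (s - 1 / (2 * Real.pi * b)) * (n + 1) * J n := by
    intro n
    have e : ∀ x : ℝ, ((n : ℂ) + 1) * hn s x n *
        Complex.exp (-Real.pi * b * x ^ 2 - 2 * Real.pi * Complex.I * w * x) +
        hn s x (n + 1) * (Complex.exp (-Real.pi * b * x ^ 2 - 2 * Real.pi * Complex.I * w * x) *
        (-2 * Real.pi * b * x - 2 * Real.pi * Complex.I * w)) =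
        ((n : ℂ) + 1) * (1 - 2 * Real.pi * b * s) * (hn s x n *
          Complex.exp (-Real.pi * b * x ^ 2 - 2 * Real.pi * Complex.I * w * x)) +
        ((-2 * Real.pi * b) * (hn s x (n + 2) *
          Complex.exp (-Real.pi * b * x ^ 2 - 2 * Real.pi * Complex.I * w * x)) -
        (2 * Real.pi * Complex.I * w) * (hn s x (n + 1) *
          Complex.exp (-Real.pi * b * x ^ 2 - 2 * Real.pi * Complex.I * w * x))) := by
      intro x
      simp only [hn]
      ring
    have h0 := integral_eq_zero_of_hasDerivAt_of_integrable (f := fun x : ℝ => hn s x (n + 1) *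
      Complex.exp (-Real.pi * b * x ^ 2 - 2 * Real.pi * Complex.I * w * x))
      (fun x => (hasDerivAt_hn s n x).comp_ofReal.mul (hE x)) ?_ (hint (n + 1))
    · simp_rw [e] at h0
      rw [integral_add ((hint n).const_mul _) (by
          exact ((hint (n + 2)).const_mul _).sub ((hint (n + 1)).const_mul _)),
        integral_sub ((hint (n + 2)).const_mul _) ((hint (n + 1)).const_mul _), integral_const_mul,
        integral_const_mul, integral_const_mul] at h0
      change ((n : ℂ) + 1) * (1 - 2 * Real.pi * b * s) * J n + ((-2 * Real.pi * b) * J (n + 2)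
        - (2 * Real.pi * Complex.I * w) * J (n + 1)) = 0 at h0
      have h2 : (2 * Real.pi * b : ℂ) ≠ 0 := by simp [hpi, hb0]
      apply mul_left_cancel₀ h2
      have e3 : (2 * Real.pi * b : ℂ) * (1 / (2 * Real.pi * b)) = 1 := by field_simp
      have e4 : b * (w / b) = w := by field_simp
      linear_combination -h0 + (-(n : ℂ) - 1) * J n * e3 +
        2 * Real.pi * Complex.I * J (n + 1) * e4
    · simp_rw [e]
      exact ((hint n).const_mul _).add
        (((hint (n + 2)).const_mul _).sub ((hint (n + 1)).const_mul _))
  change J n = _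
  induction n using Nat.twoStepInduction with
  | zero => simp [hJ0, hn]
  | one => rw [hJ1, hJ0]; simp only [hn]; ring
  | more n h0 h1 => rw [hJs, h0, h1]; simp only [hn]; ring

end

section

variable {p q : ℕ}

/-! ### Fourier series on tori and Poisson summation -/

theorem e_add (s t : ℂ) : e (s + t) = e s * e t := by
  rw [e, e, e, ← Complex.exp_add]; congr 1; ring

theorem e_zero : e 0 = 1 := by simp [e]

theorem e_neg_mul_self (t : ℂ) : e (-t) * e t = 1 := by rw [← e_add]; simp [e_zero]

theorem e_int (n : ℤ) : e n = 1 := by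
  rw [e, show 2 * Real.pi * Complex.I * (n : ℂ) = n * (2 * Real.pi * Complex.I) by ring,
    Complex.exp_int_mul_two_pi_mul_I]

theorem e_add_int (t : ℂ) (n : ℤ) : e (t + n) = e t := by rw [e_add, e_int, mul_one]

theorem norm_e (t : ℂ) : ‖e t‖ = Real.exp (-(2 * Real.pi * t.im)) := by
  rw [e, Complex.norm_exp]
  congr 1
  rw [show 2 * Real.pi * Complex.I * t = ((2 * Real.pi : ℝ) : ℂ) * (Complex.I * t) by
    push_cast; ring, Complex.re_ofReal_mul, Complex.I_mul_re]
  ring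

theorem norm_e_ofReal (t : ℝ) : ‖e t‖ = 1 := by simp [norm_e]

@[fun_prop]
theorem continuous_e : Continuous e := by unfold e; fun_prop

theorem conj_e (t : ℂ) : starRingEnd ℂ (e t) = e (-starRingEnd ℂ t) := by
  rw [e, e, ← Complex.exp_conj]
  congr 1
  simp only [map_mul, Complex.conj_I, Complex.conj_ofReal, Complex.conj_ofNat]
  ring

theorem e_sum {ι : Type*} (s : Finset ι) (f : ι → ℂ) : e (∑ i ∈ s, f i) = ∏ i ∈ s, e (f i) := by
  simp only [e, Finset.mul_sum, Complex.exp_sum]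

theorem mFourier_coe {ι : Type*} [Fintype ι] (n : ι → ℤ) (x : ι → ℝ) :
    UnitAddTorus.mFourier n (fun i => (x i : UnitAddCircle)) = e ((∑ i, n i * x i : ℝ) : ℂ) := by
  simp only [UnitAddTorus.mFourier, ContinuousMap.coe_mk, fourier_coe_apply]
  push_cast
  rw [e_sum]
  refine Finset.prod_congr rfl fun i _ => ?_
  rw [e]; congr 1; simp; ring

/-- ℝ^ι → (ℝ/ℤ)^ι is an open quotient map and P is constant on its fibres, so composing P with any
section is continuous. -/
theorem exists_torus_lift {ι : Type*} [Finite ι] {P : (ι → ℝ) → ℂ} (hP : Continuous P)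
    (hper : ∀ (x : ι → ℝ) (m : ι → ℤ), P (fun i => x i + m i) = P x) :
    ∃ G : C(UnitAddTorus ι, ℂ), ∀ x : ι → ℝ, G (fun i => (x i : UnitAddCircle)) = P x := by
  have hquot : IsOpenQuotientMap (Pi.map fun (_ : ι) (t : ℝ) => (t : UnitAddCircle)) :=
    IsOpenQuotientMap.piMap fun _ => QuotientAddGroup.isOpenQuotientMap_mk
  have hG : ∀ x : ι → ℝ,
      P (Function.surjInv hquot.surjective (fun i => (x i : UnitAddCircle))) = P x := by
    intro x
    have h := Function.surjInv_eq hquot.surjective (fun i => (x i : UnitAddCircle))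
    have h' : ∀ i, ∃ m : ℤ, Function.surjInv hquot.surjective
        (fun i => (x i : UnitAddCircle)) i = x i + m := by
      intro i
      have hi : ((Function.surjInv hquot.surjective (fun i => (x i : UnitAddCircle)) i : ℝ) :
        UnitAddCircle) = (x i : UnitAddCircle) := congrFun h i
      rw [← sub_eq_zero, ← AddCircle.coe_sub, AddCircle.coe_eq_zero_iff] at hi
      obtain ⟨m, hm⟩ := hi
      exact ⟨m, by rw [zsmul_eq_mul, mul_one] at hm; linarith⟩
    choose m hm using h'
    rw [← hper x m]
    congr 1
    exact funext hm
  refine ⟨⟨fun t => P (Function.surjInv hquot.surjective t), ?_⟩, hG⟩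
  rw [hquot.isQuotientMap.continuous_iff]
  exact hP.congr fun x => (hG x).symm

/-- A Peetre-type inequality: it trades decay at a + b for decay at a, with a loss that is
polynomial in b. -/
theorem one_add_norm_le {E : Type*} [SeminormedAddCommGroup E] (a b : E) :
    1 + ‖a‖ ≤ (1 + ‖a + b‖) * (1 + ‖b‖) := by
  have : ‖a‖ ≤ ‖a + b‖ + ‖b‖ := by simpa using norm_sub_le (a + b) b
  nlinarith [norm_nonneg (a + b), norm_nonneg b]

theorem summable_one_add_norm_lattice {E : Type*} [NormedAddCommGroup E] [NormedSpace ℝ E]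
    [FiniteDimensional ℝ E] (L : Submodule ℤ E) [DiscreteTopology L] {N : ℕ}
    (hN : Module.finrank ℤ L < N) : Summable fun l : L => 1 / (1 + ‖(l : E)‖) ^ N := by
  have h := ZLattice.summable_norm_rpow L (-(N : ℝ)) (by simpa using hN)
  refine Summable.of_norm_bounded_eventually h ?_
  have hf : ({0} : Set L).Finite := Set.finite_singleton 0
  filter_upwards [hf.compl_mem_cofinite] with l hl
  have hl0 : 0 < ‖l‖ := norm_pos_iff.2 hl
  rw [Real.norm_of_nonneg (by positivity), Real.rpow_neg hl0.le, Real.rpow_natCast, one_div]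
  have : ‖l‖ ≤ 1 + ‖(l : E)‖ := by simp
  gcongr

theorem intCast_mem_span_basisFun {ι : Type*} [Fintype ι] (n : ι → ℤ) :
    (fun i => (n i : ℝ)) ∈ Submodule.span ℤ (Set.range (Pi.basisFun ℝ ι)) := by
  rw [Module.Basis.mem_span_iff_repr_mem]
  intro i
  simp

theorem summable_one_add_norm_int {ι : Type*} [Fintype ι] {N : ℕ} (hN : Fintype.card ι < N) :
    Summable fun n : ι → ℤ => 1 / (1 + ‖fun i => (n i : ℝ)‖) ^ N := by
  have h := summable_one_add_norm_lattice (Submodule.span ℤ (Set.range (Pi.basisFun ℝ ι)))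
    (N := N) (by rwa [ZLattice.rank ℝ, Module.finrank_fintype_fun_eq_card])
  let i : (ι → ℤ) → Submodule.span ℤ (Set.range (Pi.basisFun ℝ ι)) :=
    fun n => ⟨fun i => (n i : ℝ), intCast_mem_span_basisFun n⟩
  have hinj : Function.Injective i := by
    intro a b hab
    ext j
    have : (a j : ℝ) = b j := congrFun (congrArg Subtype.val hab) j
    exact_mod_cast this
  refine (h.comp_injective hinj).congr fun n => ?_
  rfl

/-- The integer translates of the half-open unit box tile space without overlap. -/
theorem hasSum_integral_box {ι : Type*} [Fintype ι] {E : Type*} [NormedAddCommGroup E]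
    [NormedSpace ℝ E] {F : (ι → ℝ) → E} (hF : Integrable F) :
    HasSum (fun n : ι → ℤ => ∫ x in {x : ι → ℝ | ∀ i, x i ∈ Set.Ioc (0 : ℝ) (0 + 1)},
      F (fun i => x i + n i)) (∫ x, F x) := by
  set s : (ι → ℤ) → Set (ι → ℝ) := fun n => {x | ∀ i, x i ∈ Set.Ioc (n i : ℝ) (n i + 1)} with hs
  have hmeas : ∀ n, MeasurableSet (s n) := fun n =>
    MeasurableSet.univ_pi' fun i => measurableSet_Ioc
  have hun : ⋃ n, s n = Set.univ := by
    -- The intervals are open on the left, hence ⌈x⌉ - 1 rather than ⌊x⌋.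
    refine Set.eq_univ_of_forall fun x => Set.mem_iUnion.2 ⟨fun i => ⌈x i⌉ - 1, fun i => ?_⟩
    constructor
    · push_cast; linarith [Int.ceil_lt_add_one (x i)]
    · push_cast; linarith [Int.le_ceil (x i)]
  have hd : Pairwise (Function.onFun Disjoint s) := by
    intro m n hmn
    refine Set.disjoint_left.2 fun x hx hx' => hmn (funext fun i => ?_)
    have h1 := hx i
    have h2 := hx' i
    have a1 : (m i : ℝ) < n i + 1 := h1.1.trans_le h2.2
    have a2 : (n i : ℝ) < m i + 1 := h2.1.trans_le h1.2
    have b1 : m i < n i + 1 := by exact_mod_cast a1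
    have b2 : n i < m i + 1 := by exact_mod_cast a2
    omega
  have h := hasSum_integral_iUnion hmeas hd (f := F) (μ := volume)
      (by rw [hun]; exact hF.integrableOn)
  rw [hun, setIntegral_univ] at h
  convert! h using 2 with n
  have hmp : MeasurePreserving (fun x : ι → ℝ => x + fun i => (n i : ℝ)) volume volume :=
    measurePreserving_add_right _ _
  have h2 := hmp.setIntegral_preimage_emb (MeasurableEquiv.addRight _).measurableEmbedding F (s n)
  rw [← h2]
  congr 1
  congr 1
  ext x
  simp [hs, add_comm (x _)]

/-- The periodization of a continuous function of rapid decay is continuous. -/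
theorem continuous_tsum_translates {ι : Type*} [Fintype ι] {F : (ι → ℝ) → ℂ} (hF : Continuous F)
    {C : ℝ} {N : ℕ} (hN : Fintype.card ι < N) (hdec : ∀ x, ‖F x‖ ≤ C / (1 + ‖x‖) ^ N) :
    Continuous fun x : ι → ℝ => ∑' n : ι → ℤ, F (fun i => x i + n i) := by
  have hC : 0 ≤ C := by simpa using (norm_nonneg _).trans (hdec 0)
  refine continuous_iff_continuousAt.2 fun x₀ => ?_
  have h : ContinuousOn (fun x : ι → ℝ => ∑' n : ι → ℤ, F (fun i => x i + n i))
      (Metric.ball 0 (‖x₀‖ + 1)) := by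
    refine continuousOn_tsum (u := fun n : ι → ℤ =>
      C * (1 + (‖x₀‖ + 1)) ^ N * (1 / (1 + ‖fun i => (n i : ℝ)‖) ^ N)) (fun n => by fun_prop)
      ((summable_one_add_norm_int hN).mul_left _) fun n x hx => ?_
    have hx' : ‖x‖ < ‖x₀‖ + 1 := by simpa using hx
    have h1 := one_add_norm_le (fun i => (n i : ℝ)) x
    rw [add_comm (fun i => (n i : ℝ)) x] at h1
    refine (hdec _).trans ?_
    rw [mul_one_div, div_le_div_iff₀ (by positivity) (by positivity), mul_assoc, ← mul_pow]
    gcongr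
    refine h1.trans ?_
    rw [mul_comm]
    gcongr
    rfl
  exact h.continuousAt (Metric.isOpen_ball.mem_nhds (by simp))

theorem integrable_of_decay_pi {ι : Type*} [Fintype ι] {F : (ι → ℝ) → ℂ} (hF : Continuous F)
    {C : ℝ} {N : ℕ} (hN : Fintype.card ι < N) (hdec : ∀ x, ‖F x‖ ≤ C / (1 + ‖x‖) ^ N) :
    Integrable F := by
  have h := integrable_one_add_norm (E := ι → ℝ) (μ := volume) (r := N) (by
    rw [Module.finrank_fintype_fun_eq_card]; exact_mod_cast hN)
  refine (h.const_mul C).mono' hF.aestronglyMeasurable (.of_forall fun x => ?_)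
  rw [Real.rpow_neg (by positivity), Real.rpow_natCast, ← div_eq_mul_inv]
  exact hdec x

/-- Poisson summation for the lattice `ℤ^ι`. -/
theorem poisson_int {ι : Type*} [Fintype ι] {F : (ι → ℝ) → ℂ} (hF : Continuous F) {C : ℝ} {N : ℕ}
    (hN : Fintype.card ι < N) (hdec : ∀ x, ‖F x‖ ≤ C / (1 + ‖x‖) ^ N)
    (hsum : Summable fun m : ι → ℤ => ∫ x, F x * e ((-∑ i, m i * x i : ℝ) : ℂ)) :
    HasSum (fun m : ι → ℤ => ∫ x, F x * e ((-∑ i, m i * x i : ℝ) : ℂ))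
      (∑' n : ι → ℤ, F (fun i => n i)) := by
  have hint := integrable_of_decay_pi hF hN hdec
  obtain ⟨G, hG⟩ := exists_torus_lift (continuous_tsum_translates hF hN hdec) (fun x m => by
    rw [← (Equiv.addLeft m).tsum_eq fun n : ι → ℤ => F (fun i => x i + n i)]
    refine tsum_congr fun n => ?_
    simp [add_assoc])
  have hcoeff : ∀ m : ι → ℤ, UnitAddTorus.mFourierCoeff G m =
      ∫ x, F x * e ((-∑ i, m i * x i : ℝ) : ℂ) := by
    intro m
    have hint' : Integrable fun x => F x * e ((-∑ i, m i * x i : ℝ) : ℂ) := by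
      refine hint.mono (by fun_prop) (.of_forall fun x => ?_)
      rw [norm_mul, norm_e_ofReal, mul_one]
    have hbox := hasSum_integral_box hint'
    rw [UnitAddTorus.mFourierCoeff_eq_integral _ _ 0, ← hbox.tsum_eq]
    -- Sum and integral over the box are exchanged: the integrals of the norms add up to the L¹-norm
    -- of F, and the character is unchanged by integer translations.
    have h1 := hasSum_integral_of_summable_integral_norm
      (μ := volume.restrict {x : ι → ℝ | ∀ i, x i ∈ Set.Ioc (0 : ℝ) (0 + 1)})
      (F := fun (n : ι → ℤ) (x : ι → ℝ) => F (fun i => x i + n i) *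
        e ((-∑ i, m i * (x i + n i) : ℝ) : ℂ)) (fun n => ?_) ?_
    · rw [h1.tsum_eq]
      refine setIntegral_congr_fun (MeasurableSet.univ_pi' fun i => measurableSet_Ioc)
        fun x hx => ?_
      simp only [hG, mFourier_coe, smul_eq_mul]
      rw [← tsum_mul_left]
      refine tsum_congr fun n => ?_
      rw [mul_comm]
      congr 1
      have : (((-∑ i, m i * (x i + n i) : ℝ)) : ℂ) =
          ((∑ i, ((-m) i : ℤ) * x i : ℝ) : ℂ) + ((-∑ i, m i * n i : ℤ) : ℂ) := by
        push_cast
        simp only [mul_add, Finset.sum_add_distrib, Pi.neg_apply]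
        push_cast
        simp only [neg_mul, Finset.sum_neg_distrib]
        ring
      rw [this, e_add_int]
    · have := hint'.comp_add_right (fun i => (n i : ℝ))
      exact this.integrableOn
    · refine (hasSum_integral_box hint.norm).summable.congr fun n => ?_
      refine integral_congr_ae (.of_forall fun x => ?_)
      simp only [norm_mul, norm_e_ofReal, mul_one]
  -- Summable Fourier coefficients make the series converge pointwise to the periodization; it is
  -- evaluated at 0.
  have h := UnitAddTorus.hasSum_mFourier_series_apply_of_summable (f := G)
    (by simpa only [← hcoeff] using hsum) (fun i => ((0 : ℝ) : UnitAddCircle))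
  rw [hG (fun _ => 0)] at h
  simp only [hcoeff, zero_add] at h
  convert! h using 2 with m
  rw [mFourier_coe]
  simp [e_zero]

end

section

variable {p q : ℕ}

/-! ### The bilinear form, the dual lattice and the discriminant group -/

/-- The sign of a coordinate. -/
def sgn : Idx p q → ℝ := Sum.elim (fun _ => 1) (fun _ => -1)

theorem form_eq_sum (x y : Vpq p q) : form p q x y = ∑ i, sgn i * (x i * y i) := by
  simp [form, sgn, Fintype.sum_sum_type, sub_eq_add_neg]

theorem form_comm (x y : Vpq p q) : form p q x y = form p q y x := by
  simp only [form_eq_sum, mul_comm (x _)]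

theorem form_isSymm : (form p q).IsSymm := ⟨form_comm⟩

theorem form_single (x : Vpq p q) (i : Idx p q) : form p q x (Pi.single i 1) = sgn i * x i := by
  rw [form_eq_sum, Finset.sum_eq_single i] <;> simp +contextual

theorem sgn_ne_zero (i : Idx p q) : sgn i ≠ 0 := by
  rcases i with i | i <;> simp [sgn]

theorem abs_sgn (i : Idx p q) : |sgn i| = 1 := by
  rcases i with i | i <;> simp [sgn]

theorem form_nondegenerate : (form p q).Nondegenerate := by
  rw [LinearMap.BilinForm.nondegenerate_iff_ker_eq_bot, LinearMap.ker_eq_bot']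
  intro x hx
  ext i
  have := LinearMap.congr_fun hx (Pi.single i 1)
  rw [form_single] at this
  simpa [sgn_ne_zero] using this

theorem qf_add (x y : Vpq p q) : qf (x + y) = qf x + qf y + form p q x y := by
  simp only [qf, map_add, LinearMap.add_apply, form_comm y x]
  ring

theorem qf_smul (c : ℝ) (x : Vpq p q) : qf (c • x) = c ^ 2 * qf x := by
  simp only [qf, map_smul, LinearMap.smul_apply, smul_eq_mul]
  ring

@[fun_prop]
theorem continuous_form : Continuous fun z : Vpq p q × Vpq p q => form p q z.1 z.2 := by
  simp only [form_eq_sum]; fun_prop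

theorem mem_dual {L : Submodule ℤ (Vpq p q)} {x : Vpq p q} :
    x ∈ dual L ↔ ∀ y ∈ L, ∃ n : ℤ, form p q x y = n := by
  rw [dual, LinearMap.BilinForm.mem_dualSubmodule]
  refine forall₂_congr fun y _ => ?_
  rw [Submodule.mem_one]
  simp [eq_comm]

theorem IsEven.le_dual {L : Submodule ℤ (Vpq p q)} (hL : IsEven L) : L ≤ dual L := by
  intro x hx
  rw [mem_dual]
  intro y hy
  obtain ⟨a, ha⟩ := hL _ (L.add_mem hx hy)
  obtain ⟨b, hb⟩ := hL _ hx
  obtain ⟨c, hc⟩ := hL _ hy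
  refine ⟨a - b - c, ?_⟩
  have := qf_add x y
  push_cast
  linarith

theorem covolume_of_eq_span (Λ : Submodule ℤ (Vpq p q)) [DiscreteTopology Λ] [IsZLattice ℝ Λ]
    (b : Module.Basis (Idx p q) ℝ (Vpq p q)) (h : Λ = Submodule.span ℤ (Set.range b)) :
    ZLattice.covolume Λ = |(Matrix.of b).det| := by
  subst h
  rw [ZLattice.covolume_eq_det _ (b.restrictScalars ℤ)]
  congr 3
  ext i j
  simp

/-- A lattice basis, its dual basis, and the discriminant. -/
theorem exists_dual_bases (L : Submodule ℤ (Vpq p q)) [DiscreteTopology L] [IsZLattice ℝ L]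
    (hL : IsEven L) : ∃ b b' : Module.Basis (Idx p q) ℝ (Vpq p q),
      (∀ i j, form p q (b' i) (b j) = if j = i then 1 else 0) ∧
      L = Submodule.span ℤ (Set.range b) ∧ dual L = Submodule.span ℤ (Set.range b') ∧
      |(Matrix.of b').det|⁻¹ = Real.sqrt (Nat.card (Quo (dual L) L)) := by
  classical
  have hcard : Module.finrank ℤ L = Fintype.card (Idx p q) := by
    rw [ZLattice.rank ℝ, Module.finrank_fintype_fun_eq_card]
  have : Module.Free ℤ L := inferInstance
  let bL : Module.Basis (Idx p q) ℤ L := (Module.finBasisOfFinrankEq ℤ L hcard).reindex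
    (Fintype.equivFin _).symm
  let b := bL.ofZLatticeBasis ℝ L
  have hb : L = Submodule.span ℤ (Set.range b) := (bL.ofZLatticeBasis_span ℝ).symm
  let b' := (form p q).dualBasis form_nondegenerate b
  have hb' : dual L = Submodule.span ℤ (Set.range b') := by
    conv_lhs => rw [hb]
    exact LinearMap.BilinForm.dualSubmodule_span_of_basis (R := ℤ) (form p q) form_nondegenerate b
  have hdual : ∀ i j, form p q (b' i) (b j) = if j = i then 1 else 0 :=
    LinearMap.BilinForm.apply_dualBasis_left form_nondegenerate b
  refine ⟨b, b', hdual, hb, hb', ?_⟩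
  have : DiscreteTopology (dual L) := by rw [hb']; infer_instance
  have : IsZLattice ℝ (dual L) := by
    constructor
    rw [hb']
    exact ZSpan.span_top b'
  have h1 := covolume_of_eq_span L b hb
  have h2 := covolume_of_eq_span (dual L) b' hb'
  have h3 := ZLattice.covolume_div_covolume_eq_relIndex L (dual L) hL.le_dual
  have h4 : (L.toAddSubgroup.relIndex (dual L).toAddSubgroup) = Nat.card (Quo (dual L) L) := rfl
  -- Duality of the bases says B' · diag(±1) · Bᵀ = 1, so the two determinants are inverse up to
  -- sign.
  have h5 : |(Matrix.of b').det| * |(Matrix.of b).det| = 1 := by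
    have : (Matrix.of b') * Matrix.diagonal sgn * (Matrix.of b).transpose = 1 := by
      ext i j
      have h := hdual i j
      rw [form_eq_sum] at h
      rw [Matrix.mul_apply]
      simp only [Matrix.mul_diagonal, Matrix.one_apply, Matrix.of_apply,
        Matrix.transpose_apply, eq_comm (a := i), ← h]
      exact Finset.sum_congr rfl fun k _ => by ring
    have h6 := congrArg Matrix.det this
    rw [Matrix.det_mul, Matrix.det_mul, Matrix.det_one, Matrix.det_diagonal,
      Matrix.det_transpose] at h6
    have h7 := congrArg abs h6
    rw [abs_mul, abs_mul, Finset.abs_prod, abs_one] at h7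
    simpa [abs_sgn] using h7
  -- The index of L in L' is covol(L)/covol(L') = |det B'|⁻².
  rw [← h4, ← h3, h1, h2]
  have h8 : |(Matrix.of b').det| ≠ 0 := left_ne_zero_of_mul_eq_one h5
  rw [eq_inv_of_mul_eq_one_right h5, div_eq_mul_inv, Real.sqrt_mul_self (by positivity)]

theorem discreteTopology_dual (L : Submodule ℤ (Vpq p q)) [DiscreteTopology L] [IsZLattice ℝ L]
    (hL : IsEven L) : DiscreteTopology (dual L) := by
  obtain ⟨b, b', -, -, h, -⟩ := exists_dual_bases L hL
  rw [h]; infer_instance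

/-- An infinite quotient would have `Nat.card` equal to 0, and then |det B'|⁻¹ = 0 would contradict
that B' is a basis. -/
theorem card_quo_pos (L : Submodule ℤ (Vpq p q)) [DiscreteTopology L] [IsZLattice ℝ L]
    (hL : IsEven L) : 0 < Nat.card (Quo (dual L) L) := by
  obtain ⟨b, b', h0, -, h, h'⟩ := exists_dual_bases L hL
  rcases Nat.eq_zero_or_pos (Nat.card (Quo (dual L) L)) with h1 | h1
  · rw [h1, Nat.cast_zero, Real.sqrt_zero, inv_eq_zero, abs_eq_zero] at h'
    have : (Matrix.of b').det = (Pi.basisFun ℝ (Idx p q)).det b' := by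
      rw [Pi.basisFun_det_apply]
    rw [this] at h'
    exact absurd h' ((Pi.basisFun ℝ (Idx p q)).isUnit_det b').ne_zero
  · exact h1

theorem finite_quo (L : Submodule ℤ (Vpq p q)) [DiscreteTopology L] [IsZLattice ℝ L]
    (hL : IsEven L) : Finite (Quo (dual L) L) :=
  Nat.finite_of_card_ne_zero (card_quo_pos L hL).ne'

theorem dual_dual (L : Submodule ℤ (Vpq p q)) [DiscreteTopology L] [IsZLattice ℝ L]
    (hL : IsEven L) : dual (dual L) = L := by
  obtain ⟨b, b', -, h, -, -⟩ := exists_dual_bases L hL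
  rw [h]
  exact LinearMap.BilinForm.dualSubmodule_dualSubmodule_of_basis (R := ℤ) (form p q)
    form_nondegenerate form_isSymm b

/-- Poisson summation for the dual lattice. -/
theorem poisson_dual (L : Submodule ℤ (Vpq p q)) [DiscreteTopology L] [IsZLattice ℝ L]
    (hL : IsEven L) {F : Vpq p q → ℂ} (hF : Continuous F) {N : ℕ}
    (hN : Fintype.card (Idx p q) < N) (hdec : ∃ C, ∀ x, ‖F x‖ ≤ C / (1 + ‖x‖) ^ N)
    (hsum : Summable fun l : L => ∫ v, F v * e ((-form p q v l : ℝ) : ℂ)) :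
    ∑' x : dual L, F x = (Real.sqrt (Nat.card (Quo (dual L) L)) : ℂ) *
      ∑' l : L, ∫ v, F v * e ((-form p q v l : ℝ) : ℂ) := by
  classical
  obtain ⟨b, b', hbb, hb, hb', hdet⟩ := exists_dual_bases L hL
  set M := (Matrix.of b').transpose with hM
  have hdetM : M.det = (Matrix.of b').det := Matrix.det_transpose _
  have hdet0 : M.det ≠ 0 := by
    have := card_quo_pos L hL
    intro h
    rw [← hdetM, h] at hdet
    simp only [abs_zero, inv_zero] at hdet
    have h2 : (0 : ℝ) < Real.sqrt (Nat.card (Quo (dual L) L)) :=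
      Real.sqrt_pos.2 (by exact_mod_cast this)
    linarith
  have hT : ∀ x : Vpq p q, Matrix.toLin' M x = ∑ i, x i • b' i := by
    intro x
    ext j
    simp only [hM, Matrix.toLin'_apply, Matrix.mulVec, dotProduct, Finset.sum_apply, Pi.smul_apply,
      smul_eq_mul, Matrix.transpose_apply, Matrix.of_apply]
    exact Finset.sum_congr rfl fun i _ => mul_comm _ _
  have hmap : Measure.map (Matrix.toLin' M) volume =
      ENNReal.ofReal |M.det⁻¹| • (volume : Measure (Vpq p q)) :=
    Real.map_matrix_volume_pi_eq_smul_volume_pi hdet0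
  have hTc : Continuous (Matrix.toLin' M) := LinearMap.continuous_of_finiteDimensional _
  -- parametrizations of the two lattices
  let φ : (Idx p q → ℤ) ≃ L := ((b.restrictScalars ℤ).equivFun.symm.toEquiv).trans
    (Equiv.setCongr (congrArg _ hb.symm))
  let ψ : (Idx p q → ℤ) ≃ dual L := ((b'.restrictScalars ℤ).equivFun.symm.toEquiv).trans
    (Equiv.setCongr (congrArg _ hb'.symm))
  have hφ : ∀ m, ((φ m : L) : Vpq p q) = ∑ i, (m i : ℝ) • b i := by
    intro m
    have : ((φ m : _) : Vpq p q) = ((((b.restrictScalars ℤ).equivFun.symm m) :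
      Submodule.span ℤ (Set.range b)) : Vpq p q) := rfl
    rw [this, Module.Basis.equivFun_symm_apply, Submodule.coe_sum]
    refine Finset.sum_congr rfl fun i _ => ?_
    rw [Submodule.coe_smul, Module.Basis.restrictScalars_apply, Int.cast_smul_eq_zsmul]
  have hψ : ∀ m, ((ψ m : dual L) : Vpq p q) = ∑ i, (m i : ℝ) • b' i := by
    intro m
    have : ((ψ m : _) : Vpq p q) = ((((b'.restrictScalars ℤ).equivFun.symm m) :
      Submodule.span ℤ (Set.range b')) : Vpq p q) := rfl
    rw [this, Module.Basis.equivFun_symm_apply, Submodule.coe_sum]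
    refine Finset.sum_congr rfl fun i _ => ?_
    rw [Submodule.coe_smul, Module.Basis.restrictScalars_apply, Int.cast_smul_eq_zsmul]
  -- Substitute v = ∑ x_i b'_i: duality turns ∑ m_i x_i into (v, ∑ m_i b_i), and the Jacobian |det
  -- B'|⁻¹ is √|L'/L|.
  have hint : ∀ m : Idx p q → ℤ, ∫ x, F (Matrix.toLin' M x) * e ((-∑ i, m i * x i : ℝ) : ℂ) =
      (Real.sqrt (Nat.card (Quo (dual L) L)) : ℂ) *
        ∫ v, F v * e ((-form p q v (φ m) : ℝ) : ℂ) := by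
    intro m
    have h1 : ∀ x : Vpq p q, ∑ i, (m i : ℝ) * x i = form p q (Matrix.toLin' M x) (φ m) := by
      intro x
      rw [hT, hφ]
      simp only [map_sum, LinearMap.sum_apply, map_smul, LinearMap.smul_apply, hbb, smul_eq_mul]
      simp [-Fintype.sum_sum_type, mul_comm]
    simp_rw [h1]
    rw [← integral_map (φ := Matrix.toLin' M)
      (f := fun v => F v * e ((-form p q v (φ m) : ℝ) : ℂ)) hTc.measurable.aemeasurable
      (by
        have : Continuous fun v => F v * e ((-form p q v (φ m) : ℝ) : ℂ) := by
          have h2 : Continuous fun v : Vpq p q => form p q v (φ m) :=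
            continuous_form.comp (Continuous.prodMk continuous_id continuous_const)
          fun_prop
        exact this.aestronglyMeasurable), hmap, integral_smul_measure]
    rw [ENNReal.toReal_ofReal (abs_nonneg _), abs_inv, hdetM, hdet]
    simp
  obtain ⟨C, hC⟩ := hdec
  have hC0 : 0 ≤ C := by simpa using (norm_nonneg _).trans (hC 0)
  -- An injective linear map in finite dimension is bounded below, so the decay of F passes to its
  -- pullback.
  obtain ⟨K, hK0, hK⟩ : ∃ K > 0, ∀ x : Vpq p q, ‖x‖ ≤ K * ‖Matrix.toLin' M x‖ := by
    let T := (Matrix.toLin' M)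
    have hker : LinearMap.ker T = ⊥ := by
      rw [LinearMap.ker_eq_bot]
      exact Matrix.mulVec_injective_of_isUnit ((Matrix.isUnit_iff_isUnit_det M).2
        (isUnit_iff_ne_zero.2 hdet0))
    obtain ⟨K, hK, hK'⟩ := LinearMap.exists_antilipschitzWith T hker
    refine ⟨K, by exact_mod_cast hK, fun x => ?_⟩
    simpa [T] using hK'.le_mul_dist x 0
  have hdec' : ∀ x, ‖F (Matrix.toLin' M x)‖ ≤ (C * (1 + K) ^ N) / (1 + ‖x‖) ^ N := by
    intro x
    refine (hC _).trans ?_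
    rw [div_le_div_iff₀ (by positivity) (by positivity), mul_assoc, ← mul_pow]
    gcongr
    nlinarith [hK x, norm_nonneg (Matrix.toLin' M x)]
  have hP := poisson_int (F := fun x => F (Matrix.toLin' M x)) (hF.comp hTc) hN hdec' (by
    simp_rw [hint]
    exact ((φ.summable_iff (f := fun l : L => ∫ v, F v * e ((-form p q v l : ℝ) : ℂ))).2
      hsum).mul_left _)
  rw [← ψ.tsum_eq, ← φ.tsum_eq, ← tsum_mul_left]
  have h3 := hP.tsum_eq
  simp_rw [hint] at h3
  rw [h3]
  refine tsum_congr fun n => ?_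
  rw [hψ, hT]

/-! ### Classes and representatives -/

theorem rep_mem {A' A : Submodule ℤ (Vpq p q)} (γ : Quo A' A) : rep γ ∈ A' :=
  (Quotient.out γ : A').2

theorem mk_rep {A' A : Submodule ℤ (Vpq p q)} (γ : Quo A' A) :
    (Submodule.Quotient.mk ⟨rep γ, rep_mem γ⟩ : Quo A' A) = γ :=
  Quotient.out_eq γ

theorem quo_mk_eq_iff {A' A : Submodule ℤ (Vpq p q)} (x y : A') :
    (Submodule.Quotient.mk x : Quo A' A) = Submodule.Quotient.mk y ↔ (x : Vpq p q) - y ∈ A := by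
  rw [Submodule.Quotient.eq]; rfl

theorem rep_mk_sub_mem {A' A : Submodule ℤ (Vpq p q)} (x : A') :
    rep (Submodule.Quotient.mk x : Quo A' A) - x ∈ A :=
  (quo_mk_eq_iff (A := A) ⟨_, rep_mem _⟩ x).1 (mk_rep _)

/-- A vector of `A'` as a representative of its class plus a vector of `A`. -/
def quoEquiv {A' A : Submodule ℤ (Vpq p q)} (h : A ≤ A') : Quo A' A × A ≃ A' where
  toFun z := ⟨rep z.1 + z.2, A'.add_mem (rep_mem _) (h z.2.2)⟩
  invFun x := (Submodule.Quotient.mk x, ⟨x - rep (Submodule.Quotient.mk x : Quo A' A), by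
    have := A.neg_mem (rep_mk_sub_mem (A := A) x); simpa using this⟩)
  left_inv := by
    rintro ⟨γ, l⟩
    have h1 : (Submodule.Quotient.mk (⟨rep γ + l, A'.add_mem (rep_mem _) (h l.2)⟩ : A') :
        Quo A' A) = γ := by
      conv_rhs => rw [← mk_rep γ]
      rw [quo_mk_eq_iff]
      simp
    ext1
    · exact h1
    · ext1
      simp [h1]
  right_inv x := by ext1; simp

theorem quoEquiv_mk {A' A : Submodule ℤ (Vpq p q)} (h : A ≤ A') (z : Quo A' A × A) :
    (Submodule.Quotient.mk (quoEquiv h z) : Quo A' A) = z.1 :=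
  congrArg Prod.fst ((quoEquiv h).left_inv z)

/-! ### Unitarity of the Weil representation -/

theorem exists_form_int {L : Submodule ℤ (Vpq p q)} {x y : Vpq p q} (hx : x ∈ dual L)
    (hy : y ∈ L) : ∃ n : ℤ, form p q x y = n := mem_dual.1 hx y hy

theorem e_form_congr {L : Submodule ℤ (Vpq p q)} {x y y' : Vpq p q} (hx : x ∈ dual L)
    (hy : y - y' ∈ L) : e (form p q x y : ℝ) = e (form p q x y' : ℝ) := by
  obtain ⟨n, hn⟩ := exists_form_int hx hy
  rw [map_sub] at hn
  rw [show form p q x y = form p q x y' + n by linarith]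
  push_cast
  rw [e_add_int]

theorem e_eq_one_iff (t : ℝ) : e (t : ℂ) = 1 ↔ ∃ n : ℤ, t = n := by
  rw [e, Complex.exp_eq_one_iff]
  refine exists_congr fun n => ?_
  rw [mul_comm, mul_left_inj' (by simp [Real.pi_ne_zero])]
  norm_cast

/-- Orthogonality of characters: as x ∉ L = L'', some y ∈ L' has e((x,y)) ≠ 1, and translating by
the class of y multiplies the sum by this number. -/
theorem sum_e_form (L : Submodule ℤ (Vpq p q)) [DiscreteTopology L] [IsZLattice ℝ L]
    (hL : IsEven L) [Fintype (Quo (dual L) L)] {x : Vpq p q} (hx : x ∈ dual L) (hxL : x ∉ L) :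
    ∑ δ : Quo (dual L) L, e (form p q x (rep δ) : ℝ) = 0 := by
  rw [← dual_dual L hL, mem_dual] at hxL
  push Not at hxL
  obtain ⟨y, hy, hy'⟩ := hxL
  have h1 : e (form p q x y : ℝ) ≠ 1 := by
    rw [Ne, e_eq_one_iff]
    rintro ⟨n, hn⟩
    exact hy' n hn
  have h2 : e (form p q x y : ℝ) * ∑ δ : Quo (dual L) L, e (form p q x (rep δ) : ℝ) =
      ∑ δ : Quo (dual L) L, e (form p q x (rep δ) : ℝ) := by
    rw [Finset.mul_sum, ← Equiv.sum_comp
      (Equiv.addRight (Submodule.Quotient.mk ⟨y, hy⟩ : Quo (dual L) L))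
      fun δ => e (form p q x (rep δ) : ℝ)]
    refine Finset.sum_congr rfl fun δ _ => ?_
    rw [← e_add, ← Complex.ofReal_add, ← map_add]
    refine (e_form_congr hx ?_).symm
    have h3 := rep_mk_sub_mem (A := L) (⟨rep δ, rep_mem δ⟩ + ⟨y, hy⟩ : dual L)
    rw [Submodule.Quotient.mk_add, mk_rep] at h3
    simpa [add_comm] using h3
  by_contra h3
  exact h1 (mul_right_cancel₀ h3 (by rw [h2, one_mul]))

theorem sum_norm_sq_weilS (L : Submodule ℤ (Vpq p q)) [DiscreteTopology L] [IsZLattice ℝ L]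
    (hL : IsEven L) [Fintype (Quo (dual L) L)] (φ : GrpAlg (dual L) L) :
    ∑ δ, ‖weilS L φ δ‖ ^ 2 = ∑ γ, ‖φ γ‖ ^ 2 := by
  classical
  set D := Nat.card (Quo (dual L) L) with hD
  have hD0 : (0 : ℝ) < D := by exact_mod_cast card_quo_pos L hL
  have h1 : ∀ δ, ‖weilS L φ δ‖ ^ 2 =
      (D : ℝ)⁻¹ * ‖∑ γ, e (-(form p q (rep γ) (rep δ) : ℝ)) * φ γ‖ ^ 2 := by
    intro δ
    rw [weilS, norm_mul, mul_pow, norm_div, finsum_eq_sum_of_fintype]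
    have : ‖e (((q : ℂ) - p) / 8)‖ = 1 := by
      rw [show ((q : ℂ) - p) / 8 = ((((q : ℝ) - p) / 8 : ℝ) : ℂ) by push_cast; ring, norm_e_ofReal]
    rw [this, Complex.norm_real, Real.norm_of_nonneg (Real.sqrt_nonneg _), one_div, inv_pow,
      Real.sq_sqrt hD0.le]
  simp_rw [h1]
  rw [← Finset.mul_sum, inv_mul_eq_iff_eq_mul₀ hD0.ne']
  have h2 : ∀ z : ℂ, ((‖z‖ ^ 2 : ℝ) : ℂ) = z * starRingEnd ℂ z := fun z => by
    rw [Complex.mul_conj, Complex.normSq_eq_norm_sq]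
  have h3 : ((∑ δ : Quo (dual L) L, ‖∑ γ, e (-(form p q (rep γ) (rep δ) : ℝ)) * φ γ‖ ^ 2 : ℝ) : ℂ) =
      ((D * ∑ γ, ‖φ γ‖ ^ 2 : ℝ) : ℂ) := by
    push_cast
    simp_rw [← Complex.ofReal_pow, h2, map_sum, map_mul, Finset.sum_mul_sum, conj_e]
    rw [Finset.sum_comm, Finset.mul_sum]
    refine Finset.sum_congr rfl fun γ _ => ?_
    rw [Finset.sum_comm]
    have h4 : ∀ γ', ∑ δ : Quo (dual L) L, e (-(form p q (rep γ) (rep δ) : ℝ)) * φ γ *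
        (e (-starRingEnd ℂ (-((form p q (rep γ') (rep δ) : ℝ) : ℂ))) * starRingEnd ℂ (φ γ')) =
        (if γ = γ' then (D : ℂ) else 0) * (φ γ * starRingEnd ℂ (φ γ')) := by
      intro γ'
      have h5 : ∀ δ : Quo (dual L) L, e (-(form p q (rep γ) (rep δ) : ℝ)) * φ γ *
        (e (-starRingEnd ℂ (-((form p q (rep γ') (rep δ) : ℝ) : ℂ))) * starRingEnd ℂ (φ γ')) =
        e (form p q (rep γ' - rep γ) (rep δ) : ℝ) * (φ γ * starRingEnd ℂ (φ γ')) := by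
        intro δ
        rw [map_sub, LinearMap.sub_apply, Complex.ofReal_sub, sub_eq_add_neg, e_add]
        simp only [map_neg, Complex.conj_ofReal, neg_neg]
        ring
      simp_rw [h5]
      rw [← Finset.sum_mul]
      congr 1
      split_ifs with h6
      · subst h6
        simp [e_zero, hD]
      · refine sum_e_form L hL ((dual L).sub_mem (rep_mem _) (rep_mem _)) fun h7 => h6 ?_
        rw [← mk_rep γ, ← mk_rep γ']
        exact ((quo_mk_eq_iff _ _).2 h7).symm
    simp_rw [h4]
    simp
  exact_mod_cast h3

end

section

variable {p q : ℕ}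

/-! ### Growth and Fourier coefficients of the cusp form -/

theorem exists_pow_mul_exp_neg_bound (A : ℕ) {c : ℝ} (hc : 0 < c) :
    ∃ C > 0, ∀ y : ℝ, 0 ≤ y → (1 + y) ^ A * Real.exp (-(c * y)) ≤ C := by
  refine ⟨A.factorial / c ^ A * Real.exp c, by positivity, fun y hy => ?_⟩
  have h := Real.pow_div_factorial_le_exp (c * (1 + y)) (by positivity) A
  rw [mul_pow, div_le_iff₀ (by positivity)] at h
  have h2 : (1 + y) ^ A ≤ A.factorial / c ^ A * Real.exp (c * (1 + y)) := by
    rw [div_mul_eq_mul_div, le_div_iff₀ (by positivity)]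
    linarith
  calc _ ≤ A.factorial / c ^ A * Real.exp (c * (1 + y)) * Real.exp (-(c * y)) := by gcongr
    _ = _ := by rw [mul_assoc, ← Real.exp_add]; congr 2; ring

/-- The exponents lie in one coset of ℤ, whose positive elements are at least the fractional part,
or 1 if that is zero. -/
theorem exists_posExp_lower_bound (L : Submodule ℤ (Vpq p q)) (γ : Quo (dual L) L) :
    ∃ n₀ > 0, ∀ n ∈ posExp L γ, n₀ ≤ n := by
  set r := qf (rep γ)
  have hr : (⌊r⌋ : ℝ) + Int.fract r = r := Int.floor_add_fract r
  by_cases h0 : Int.fract r = 0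
  · refine ⟨1, one_pos, ?_⟩
    rintro n ⟨hn, m, hm⟩
    have h1 : n = ((m + ⌊r⌋ : ℤ) : ℝ) := by push_cast; rw [hm]; linarith
    rw [h1] at hn ⊢
    have : 0 < m + ⌊r⌋ := by exact_mod_cast hn
    exact_mod_cast this
  · have h1 : 0 < Int.fract r := lt_of_le_of_ne (Int.fract_nonneg r) (Ne.symm h0)
    refine ⟨Int.fract r, h1, ?_⟩
    rintro n ⟨hn, m, hm⟩
    have h2 : n = ((m + ⌊r⌋ : ℤ) : ℝ) + Int.fract r := by push_cast; rw [hm]; linarith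
    have h3 := Int.fract_lt_one r
    have h4 : (-1 : ℝ) < ((m + ⌊r⌋ : ℤ) : ℝ) := by linarith
    have h5 : (-1 : ℤ) < m + ⌊r⌋ := by exact_mod_cast h4
    have h6 : (0 : ℝ) ≤ ((m + ⌊r⌋ : ℤ) : ℝ) := by
      have : 0 ≤ m + ⌊r⌋ := by omega
      exact_mod_cast this
    linarith

theorem norm_e_mul_coe (n : ℝ) (τ : ℍ) :
    ‖e (n * (τ : ℂ))‖ = Real.exp (-(2 * Real.pi * (n * τ.im))) := by
  rw [norm_e]
  simp

section
variable {L : Submodule ℤ (Vpq p q)} {f : ℍ → GrpAlg (dual L) L}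

/-- Compare the expansion termwise with the one at i/2: (n-n₀)(y-1/2) ≥ 0 yields the common factor
e^{πn₀} e^{-2πn₀y}. -/
theorem IsCuspForm.exists_exp_decay (hf : IsCuspForm L f) (γ : Quo (dual L) L) :
    ∃ C > 0, ∃ ε > 0, ∀ τ : ℍ, 1 / 2 ≤ τ.im → ‖f τ γ‖ ≤ C * Real.exp (-(ε * τ.im)) := by
  obtain ⟨n₀, hn₀, h⟩ := exists_posExp_lower_bound L γ
  let τ₀ : ℍ := ⟨Complex.I / 2, by simp⟩
  have hτ₀ : τ₀.im = 1 / 2 := by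
    change (Complex.I / 2).im = _
    simp
  have hs := (hf.cusp γ τ₀).summable.norm
  set B := ∑' n : posExp L γ, ‖fcoeff f γ n * e ((n : ℝ) * τ₀)‖ with hB
  have hB0 : 0 ≤ B := tsum_nonneg fun _ => norm_nonneg _
  refine ⟨(B + 1) * Real.exp (Real.pi * n₀), by positivity, 2 * Real.pi * n₀, by positivity,
    fun τ hτ => ?_⟩
  refine ((hf.cusp γ τ).norm_le_of_bounded
    (hs.hasSum.mul_right (Real.exp (Real.pi * n₀) * Real.exp (-(2 * Real.pi * n₀ * τ.im))))
    fun n => ?_).trans ?_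
  · rw [norm_mul, norm_mul, norm_e_mul_coe, norm_e_mul_coe, mul_assoc ‖fcoeff f γ n‖,
      ← Real.exp_add, ← Real.exp_add, hτ₀]
    gcongr
    have := h n n.2
    nlinarith [Real.pi_pos, mul_nonneg Real.pi_pos.le (mul_nonneg (sub_nonneg.2 this)
        (sub_nonneg.2 hτ))]
  · rw [← hB, mul_assoc (B + 1)]
    exact mul_le_mul_of_nonneg_right (by linarith) (by positivity)

theorem norm_weilT (φ : GrpAlg (dual L) L) (γ : Quo (dual L) L) : ‖weilT L φ γ‖ = ‖φ γ‖ := by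
  rw [weilT, norm_mul, norm_e_ofReal, one_mul]

variable [DiscreteTopology L] [IsZLattice ℝ L]

/-- Checked on generators: T acts by phases, and S by a unitary matrix times |τ|^k, which Im(Sτ) =
y/|τ|² compensates. -/
theorem IsCuspForm.invariant (hL : IsEven L) (hf : IsCuspForm L f) [Fintype (Quo (dual L) L)]
    (g : SL(2, ℤ)) : ∀ τ : ℍ,
    (g • τ).im ^ (((p : ℝ) + q) / 2) * ∑ γ, ‖f (g • τ) γ‖ ^ 2 =
      τ.im ^ (((p : ℝ) + q) / 2) * ∑ γ, ‖f τ γ‖ ^ 2 := by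
  have hg : g ∈ Subgroup.closure {ModularGroup.S, ModularGroup.T} := by
    rw [SpecialLinearGroup.SL2Z_generators]; trivial
  induction hg using Subgroup.closure_induction with
  | mem x hx =>
    intro τ
    rcases hx with rfl | rfl
    · have h1 : ∀ γ, ‖f (ModularGroup.S • τ) γ‖ ^ 2 =
          ‖(τ : ℂ)‖ ^ ((p : ℝ) + q) * ‖weilS L (f τ) γ‖ ^ 2 := by
        intro γ
        rw [hf.mod_S, norm_mul, mul_pow, Complex.norm_cpow_of_ne_zero τ.ne_zero]
        congr 1
        have e1 : (((p : ℂ) + q) / 2).im = 0 := by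
          rw [show ((p : ℂ) + q) / 2 = ((((p : ℝ) + q) / 2 : ℝ) : ℂ) by push_cast; ring]
          exact Complex.ofReal_im _
        have e2 : (((p : ℂ) + q) / 2).re = ((p : ℝ) + q) / 2 := by
          rw [show ((p : ℂ) + q) / 2 = ((((p : ℝ) + q) / 2 : ℝ) : ℂ) by push_cast; ring]
          exact Complex.ofReal_re _
        rw [e1, e2, mul_zero, Real.exp_zero, div_one, ← Real.rpow_natCast,
            ← Real.rpow_mul (by positivity)]
        congr 1
        push_cast
        ring
      simp_rw [h1]
      rw [← Finset.mul_sum, sum_norm_sq_weilS L hL, ← mul_assoc]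
      congr 1
      have h2 : (ModularGroup.S • τ).im = τ.im / ‖(τ : ℂ)‖ ^ 2 := by
        rw [ModularGroup.im_smul_eq_div_normSq, Complex.normSq_eq_norm_sq, ModularGroup.denom_S]
      have h3 : 0 < ‖(τ : ℂ)‖ := norm_pos_iff.2 τ.ne_zero
      rw [h2, Real.div_rpow τ.im_pos.le (by positivity), ← Real.rpow_natCast, ← Real.rpow_mul h3.le]
      rw [show ((2 : ℕ) : ℝ) * (((p : ℝ) + q) / 2) = (p : ℝ) + q by push_cast; ring]
      exact div_mul_cancel₀ _ (Real.rpow_pos_of_pos h3 _).ne'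
    · rw [UpperHalfPlane.modular_T_smul, hf.mod_T]
      simp [norm_weilT]
  | one => simp
  | mul x y _ _ hx hy => intro τ; rw [mul_smul, hx, hy]
  | inv x _ hx => intro τ; rw [← hx, smul_inv_smul]

/-- The cusp form is bounded by `C (1 + 1/y)^A e^{-εy}`. -/
theorem IsCuspForm.exists_bound (hL : IsEven L) (hf : IsCuspForm L f) :
    ∃ C > 0, ∃ A : ℕ, ∃ ε > 0, ∀ γ τ,
        ‖f τ γ‖ ≤ C * (1 + 1 / τ.im) ^ A * Real.exp (-(ε * τ.im)) := by
  have := finite_quo L hL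
  have := Fintype.ofFinite (Quo (dual L) L)
  choose C hC ε hε hdec using hf.exists_exp_decay
  obtain ⟨ε₀, hε₀, hεle⟩ : ∃ ε₀ > 0, ∀ γ, ε₀ ≤ ε γ := by
    have hne : (Finset.univ : Finset (Quo (dual L) L)).Nonempty := ⟨0, Finset.mem_univ _⟩
    exact ⟨Finset.univ.inf' hne ε, (Finset.lt_inf'_iff _).2 fun γ _ => hε γ,
      fun γ => Finset.inf'_le _ (Finset.mem_univ γ)⟩
  set C₀ := ∑ γ, C γ with hC₀
  have hCle : ∀ γ, C γ ≤ C₀ := fun γ =>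
    Finset.single_le_sum (f := C) (fun γ _ => (hC γ).le) (Finset.mem_univ γ)
  have hC₀0 : 0 < C₀ := (hC 0).trans_le (hCle 0)
  have hdec' : ∀ γ τ, 1 / 2 ≤ τ.im → ‖f τ γ‖ ≤ C₀ * Real.exp (-(ε₀ * τ.im)) := by
    intro γ τ hτ
    refine (hdec γ τ hτ).trans ?_
    have := τ.im_pos
    gcongr
    · exact hCle γ
    · exact hεle γ
  obtain ⟨B, hB, hB'⟩ := exists_pow_mul_exp_neg_bound (p + q) (c := 2 * ε₀) (by positivity)
  set D : ℝ := ((Fintype.card (Quo (dual L) L) : ℕ) : ℝ)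
  -- By invariance τ may be moved into the fundamental domain, where y > 1/2 and f decays
  -- exponentially.
  have hbdd : ∀ τ : ℍ, τ.im ^ (((p : ℝ) + q) / 2) * ∑ γ, ‖f τ γ‖ ^ 2 ≤ B * (D * C₀ ^ 2) := by
    intro τ
    obtain ⟨g, hg⟩ := ModularGroup.exists_smul_mem_fd τ
    rw [← hf.invariant hL g τ]
    set σ := g • τ
    have h3 := ModularGroup.three_le_four_mul_im_sq_of_mem_fd hg
    have hσ := σ.im_pos
    have h4 : 1 / 2 ≤ σ.im := by nlinarith
    have h5 : ∑ γ, ‖f σ γ‖ ^ 2 ≤ D * (C₀ ^ 2 * Real.exp (-(2 * ε₀ * σ.im))) := by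
      refine (Finset.sum_le_card_nsmul _ _ (C₀ ^ 2 * Real.exp (-(2 * ε₀ * σ.im)))
        fun γ _ => ?_).trans
        (le_of_eq ?_)
      · refine (pow_le_pow_left₀ (norm_nonneg _) (hdec' γ σ h4) 2).trans (le_of_eq ?_)
        rw [mul_pow, ← Real.exp_nat_mul]
        congr 2
        push_cast
        ring
      · simp [D]
    have h6 : σ.im ^ (((p : ℝ) + q) / 2) ≤ (1 + σ.im) ^ (p + q) := by
      rw [← Real.rpow_natCast]
      refine (Real.rpow_le_rpow hσ.le (by linarith : σ.im ≤ 1 + σ.im) (by positivity)).trans ?_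
      refine Real.rpow_le_rpow_of_exponent_le (by linarith) ?_
      push_cast
      have : (0 : ℝ) ≤ (p : ℝ) + q := by positivity
      linarith
    calc _ ≤ (1 + σ.im) ^ (p + q) * (D * (C₀ ^ 2 * Real.exp (-(2 * ε₀ * σ.im)))) := by
          gcongr
      _ = (1 + σ.im) ^ (p + q) * Real.exp (-(2 * ε₀ * σ.im)) * (D * C₀ ^ 2) := by ring
      _ ≤ _ := by gcongr; exact hB' _ hσ.le
  set E := B * (D * C₀ ^ 2)
  have hE : 0 ≤ E := by positivity
  refine ⟨C₀ + Real.sqrt E * Real.exp ε₀, by positivity, p + q, ε₀, hε₀, fun γ τ => ?_⟩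
  have hτ := τ.im_pos
  have h1 : (1 : ℝ) ≤ 1 + 1 / τ.im := by simp [hτ.le]
  have h1' : (1 : ℝ) ≤ (1 + 1 / τ.im) ^ (p + q) := one_le_pow₀ h1
  by_cases h2 : 1 / 2 ≤ τ.im
  · refine (hdec' γ τ h2).trans ?_
    gcongr
    have : 0 ≤ Real.sqrt E * Real.exp ε₀ := by positivity
    nlinarith
  · push Not at h2
    have h3 : ‖f τ γ‖ ^ 2 ≤ E * ((1 + 1 / τ.im) ^ (p + q)) ^ 2 := by
      have h4 : ‖f τ γ‖ ^ 2 ≤ ∑ γ, ‖f τ γ‖ ^ 2 :=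
        Finset.single_le_sum (f := fun γ => ‖f τ γ‖ ^ 2)
          (fun _ _ => by positivity) (Finset.mem_univ γ)
      have h5 : 0 < τ.im ^ (((p : ℝ) + q) / 2) := Real.rpow_pos_of_pos hτ _
      have h6 : ‖f τ γ‖ ^ 2 ≤ E * (1 / τ.im) ^ (((p : ℝ) + q) / 2) := by
        rw [one_div, Real.inv_rpow hτ.le, ← div_eq_mul_inv, le_div_iff₀ h5, mul_comm]
        exact (mul_le_mul_of_nonneg_left h4 h5.le).trans (hbdd τ)
      refine h6.trans ?_
      gcongr
      rw [← pow_mul, ← Real.rpow_natCast]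
      refine (Real.rpow_le_rpow (by positivity) (by linarith : 1 / τ.im ≤ 1 + 1 / τ.im)
        (by positivity)).trans ?_
      refine Real.rpow_le_rpow_of_exponent_le h1 ?_
      push_cast
      have : (0 : ℝ) ≤ (p : ℝ) + q := by positivity
      linarith
    have h7 : ‖f τ γ‖ ≤ Real.sqrt E * (1 + 1 / τ.im) ^ (p + q) := by
      refine abs_le_of_sq_le_sq' ?_ (by positivity) |>.2
      rwa [mul_pow, Real.sq_sqrt hE]
    -- For y < 1/2 the factor e^{-ε₀y} of the claim is not small; e^{ε₀} in the constant makes up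
    -- for it.
    have h8 : 1 ≤ Real.exp ε₀ * Real.exp (-(ε₀ * τ.im)) := by
      rw [← Real.exp_add]
      exact Real.one_le_exp (by nlinarith)
    calc _ ≤ Real.sqrt E * (1 + 1 / τ.im) ^ (p + q) * 1 := by rw [mul_one]; exact h7
      _ ≤ Real.sqrt E * (1 + 1 / τ.im) ^ (p + q) * (Real.exp ε₀ * Real.exp (-(ε₀ * τ.im))) := by
          gcongr
      _ = (Real.sqrt E * Real.exp ε₀) * (1 + 1 / τ.im) ^ (p + q) * Real.exp (-(ε₀ * τ.im)) := by
          ring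
      _ ≤ _ := by gcongr; linarith

end

/-! ### Fourier coefficients at arbitrary height -/

section
variable {L : Submodule ℤ (Vpq p q)} {f : ℍ → GrpAlg (dual L) L}

theorem integral_e_int (k : ℤ) : ∫ x in (0 : ℝ)..1, e ((k : ℂ) * x) = if k = 0 then 1 else 0 := by
  split_ifs with hk
  · simp [hk, e_zero]
  · have h := integral_exp_mul_complex (a := 0) (b := 1) (c := 2 * Real.pi * Complex.I * k)
      (by simp [hk, Real.pi_ne_zero])
    have h2 : ∀ x : ℝ, e ((k : ℂ) * x) = Complex.exp (2 * Real.pi * Complex.I * k * x) :=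
        fun x => by
      rw [e]; congr 1; ring
    simp_rw [h2]
    rw [h]
    have h3 := e_int k
    rw [e] at h3
    simp [h3]

theorem countable_posExp (L : Submodule ℤ (Vpq p q)) (γ : Quo (dual L) L) :
    Countable (posExp L γ) := by
  refine Set.Countable.to_subtype ((Set.countable_range fun m : ℤ => (m : ℝ) + qf (rep γ)).mono ?_)
  rintro n ⟨-, m, rfl⟩
  exact ⟨m, rfl⟩

/-- The Fourier coefficients of the cusp form, computed at an arbitrary height. -/
theorem IsCuspForm.integral_eq_ite (hf : IsCuspForm L f) (γ : Quo (dual L) L) (τ : ℍ) {n : ℝ}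
    (hn : ∃ m : ℤ, n = m + qf (rep γ)) :
    ∫ x in (0 : ℝ)..1, f (x +ᵥ τ) γ * e (-(n * (x + (τ : ℂ)))) =
      if 0 < n then fcoeff f γ n else 0 := by
  classical
  have := countable_posExp L γ
  have hdiff : ∀ n' : posExp L γ, ∃ k : ℤ, (n' : ℝ) - n = k := by
    rintro ⟨n', -, m', hm'⟩
    obtain ⟨m, hm⟩ := hn
    exact ⟨m' - m, by simp only [hm, hm']; push_cast; ring⟩
  choose k hk using hdiff
  have hterm : ∀ (n' : posExp L γ) (x : ℝ), fcoeff f γ n' * e ((n' : ℝ) * ((x +ᵥ τ : ℍ) : ℂ)) *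
      e (-(n * (x + (τ : ℂ)))) = fcoeff f γ n' * e ((k n' : ℂ) * τ) * e ((k n' : ℂ) * x) := by
    intro n' x
    rw [mul_assoc, mul_assoc, ← e_add, ← e_add]
    congr 2
    rw [UpperHalfPlane.coe_vadd]
    have : ((n' : ℝ) : ℂ) - n = (k n' : ℂ) := by exact_mod_cast hk n'
    linear_combination (x + (τ : ℂ)) * this
  have hnorm : ∀ (n' : posExp L γ) (x : ℝ),
      ‖fcoeff f γ n' * e ((k n' : ℂ) * τ) * e ((k n' : ℂ) * x)‖
      = ‖fcoeff f γ n' * e ((n' : ℝ) * τ)‖ * ‖e (-(n * (τ : ℂ)))‖ := by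
    intro n' x
    have h1 : ‖e ((k n' : ℂ) * x)‖ = 1 := by
      rw [show (k n' : ℂ) * x = ((k n' * x : ℝ) : ℂ) by push_cast; ring, norm_e_ofReal]
    rw [norm_mul, h1, mul_one, ← norm_mul, mul_assoc, ← e_add]
    congr 3
    have : ((n' : ℝ) : ℂ) - n = (k n' : ℂ) := by exact_mod_cast hk n'
    linear_combination -(τ : ℂ) * this
  rw [intervalIntegral.integral_of_le zero_le_one]
  have hsumm : Summable fun n' : posExp L γ =>
      ‖fcoeff f γ n' * e ((n' : ℝ) * τ)‖ * ‖e (-(n * (τ : ℂ)))‖ :=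
    (hf.cusp γ τ).summable.norm.mul_right _
  have h := hasSum_integral_of_summable_integral_norm (μ := volume.restrict (Set.Ioc (0 : ℝ) 1))
    (F := fun (n' : posExp L γ) (x : ℝ) =>
      fcoeff f γ n' * e ((k n' : ℂ) * τ) * e ((k n' : ℂ) * x)) (fun n' => by
        have : Continuous fun x : ℝ => fcoeff f γ n' * e ((k n' : ℂ) * τ) * e ((k n' : ℂ) * x) := by
          fun_prop
        exact (this.intervalIntegrable 0 1).1) (by
        refine hsumm.congr fun n' => ?_
        simp_rw [hnorm]
        simp)
  have h2 : ∀ x : ℝ, ∑' n' : posExp L γ, fcoeff f γ n' * e ((k n' : ℂ) * τ) * e ((k n' : ℂ) * x) =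
      f (x +ᵥ τ) γ * e (-(n * (x + (τ : ℂ)))) := by
    intro x
    rw [← (hf.cusp γ (x +ᵥ τ)).tsum_eq, ← tsum_mul_right]
    exact tsum_congr fun n' => (hterm n' x).symm
  simp_rw [h2] at h
  rw [← h.tsum_eq]
  -- All exponents differ from n by integers, so orthogonality leaves only n' = n. If n ≤ 0, no
  -- exponent matches.
  have h3 : ∀ n' : posExp L γ, ∫ x in Set.Ioc (0 : ℝ) 1,
      fcoeff f γ n' * e ((k n' : ℂ) * τ) * e ((k n' : ℂ) * x) =
      if (n' : ℝ) = n then fcoeff f γ n else 0 := by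
    intro n'
    rw [integral_const_mul, ← intervalIntegral.integral_of_le zero_le_one, integral_e_int]
    have h4 : (n' : ℝ) = n ↔ k n' = 0 := by
      rw [← sub_eq_zero, hk n']; norm_cast
    by_cases h5 : (n' : ℝ) = n
    · rw [if_pos h5, if_pos (h4.1 h5), h4.1 h5, h5]
      simp [e_zero]
    · rw [if_neg h5, if_neg (fun h => h5 (h4.2 h)), mul_zero]
  simp_rw [h3]
  split_ifs with hpos
  · rw [tsum_eq_single ⟨n, hpos, hn⟩]
    · simp
    · intro n' hn'
      rw [if_neg]
      exact fun h => hn' (Subtype.ext h)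
  · rw [tsum_congr (g := fun _ => (0 : ℂ))]
    · simp
    · intro n'
      rw [if_neg]
      intro h
      exact hpos (h ▸ n'.2.1)

/-- `fcoeff` is the coefficient integral taken at height 1, so the general formula applies at τ = i.
-/
theorem IsCuspForm.fcoeff_eq_zero (hf : IsCuspForm L f) (γ : Quo (dual L) L) {n : ℝ}
    (hn : ∃ m : ℤ, n = m + qf (rep γ)) (hn0 : n ≤ 0) : fcoeff f γ n = 0 := by
  have h := hf.integral_eq_ite γ UpperHalfPlane.I hn
  rw [if_neg (not_lt.2 hn0)] at h
  rw [← h, fcoeff]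
  simp

theorem IsCuspForm.integral_eq_fcoeff (hf : IsCuspForm L f) (γ : Quo (dual L) L) (τ : ℍ) {n : ℝ}
    (hn : ∃ m : ℤ, n = m + qf (rep γ)) :
    ∫ x in (0 : ℝ)..1, f (x +ᵥ τ) γ * e (-(n * (x + (τ : ℂ)))) = fcoeff f γ n := by
  rw [hf.integral_eq_ite γ τ hn]
  split_ifs with h
  · rfl
  · exact (hf.fcoeff_eq_zero γ hn (not_lt.1 h)).symm

theorem IsCuspForm.continuous (hf : IsCuspForm L f) (γ : Quo (dual L) L) :
    Continuous fun τ => f τ γ := (hf.holo γ).continuous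

end

end

section

variable {p q : ℕ}

/-! ### The Gaussian summand of the theta function and its Fourier transform -/

/-- The complex conjugate of the summand of the Siegel theta function. -/
def kerFn (α : Fin q → Fin p) (g : Vpq p q ≃ₗ[ℝ] Vpq p q) (τ : ℍ) (x : Vpq p q) : ℂ :=
  (expLap τ.im (polyP α) (g x) : ℂ) * e (-(starRingEnd ℂ (τ : ℂ) * (qf (projZperp g x) : ℝ))
    - (τ : ℂ) * (qf (projZ g x) : ℝ))

theorem qf_projZperp {g : Vpq p q ≃ₗ[ℝ] Vpq p q} (hg : IsSO g) (x : Vpq p q) :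
    qf (projZperp g x) = (∑ j, g x (Sum.inl j) ^ 2) / 2 := by
  rw [qf, ← hg.1, projZperp, LinearEquiv.apply_symm_apply]
  simp [form, basePos, sq]

theorem qf_projZ {g : Vpq p q ≃ₗ[ℝ] Vpq p q} (hg : IsSO g) (x : Vpq p q) :
    qf (projZ g x) = -(∑ i, g x (Sum.inr i) ^ 2) / 2 := by
  rw [qf, ← hg.1, projZ, LinearEquiv.apply_symm_apply]
  simp [form, baseNeg, sq]

/-- The one-dimensional factors of `gaussFn`. -/
def gaussFactor (α : Fin q → Fin p) (τ : ℍ) : Idx p q → ℝ → ℂ :=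
  Sum.elim
    (fun j t => hn ((1 / (4 * Real.pi * τ.im) : ℝ) : ℂ) t
      (Finset.univ.filter (fun i => α i = j)).card *
        Complex.exp (-Real.pi * (Complex.I * starRingEnd ℂ (τ : ℂ)) * t ^ 2))
    (fun _ t => Complex.exp (-Real.pi * (-Complex.I * (τ : ℂ)) * t ^ 2))

/-- The summand of the theta function in the coordinates of `ℝ^{p,q}`. -/
def gaussFn (α : Fin q → Fin p) (τ : ℍ) (X : Vpq p q) : ℂ :=
  (((2 : ℝ) ^ ((q : ℝ) / 2) : ℝ) : ℂ) * ∏ i, gaussFactor α τ i (X i)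

/-- In the coordinates X = g(x) the summand is a product of functions of one variable, which reduces
its Fourier transform to one-dimensional integrals. -/
theorem kerFn_eq (α : Fin q → Fin p) {g : Vpq p q ≃ₗ[ℝ] Vpq p q} (hg : IsSO g) (τ : ℍ)
    (x : Vpq p q) : kerFn α g τ x = gaussFn α τ (g x) := by
  rw [kerFn, gaussFn, expLap_polyP, qf_projZperp hg, qf_projZ hg, Fintype.prod_sum_type]
  simp only [gaussFactor, Sum.elim_inl, Sum.elim_inr, Finset.prod_mul_distrib, ← Complex.exp_sum]
  push_cast
  simp only [ofReal_hn, mul_assoc, e, ← Complex.exp_add]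
  push_cast
  congr 3
  simp only [← Finset.mul_sum]
  ring

theorem continuous_gaussFn (α : Fin q → Fin p) (τ : ℍ) : Continuous (gaussFn α τ) := by
  unfold gaussFn
  refine continuous_const.mul (continuous_finsetProd _ fun i _ => ?_)
  rcases i with i | i
  · simp only [gaussFactor, Sum.elim_inl]
    exact ((continuous_hn _ _).comp (continuous_apply _)).mul (by fun_prop)
  · simp only [gaussFactor, Sum.elim_inr]
    fun_prop

theorem continuous_kerFn (α : Fin q → Fin p) {g : Vpq p q ≃ₗ[ℝ] Vpq p q} (hg : IsSO g) (τ : ℍ) :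
    Continuous (kerFn α g τ) := by
  have h : Continuous g := LinearMap.continuous_of_finiteDimensional (g : Vpq p q →ₗ[ℝ] Vpq p q)
  rw [funext fun x => kerFn_eq α hg τ x]
  exact (continuous_gaussFn α τ).comp h

theorem norm_sq_le_sum_sq (X : Vpq p q) : ‖X‖ ^ 2 ≤ ∑ i, X i ^ 2 := by
  have h : ‖X‖ ≤ Real.sqrt (∑ i, X i ^ 2) := by
    rw [pi_norm_le_iff_of_nonneg (Real.sqrt_nonneg _)]
    intro i
    rw [Real.norm_eq_abs]
    apply Real.abs_le_sqrt
    exact Finset.single_le_sum (f := fun i => X i ^ 2) (fun _ _ => sq_nonneg _) (Finset.mem_univ i)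
  calc ‖X‖ ^ 2 ≤ Real.sqrt (∑ i, X i ^ 2) ^ 2 := by gcongr
    _ = _ := Real.sq_sqrt (Finset.sum_nonneg fun _ _ => sq_nonneg _)

/-- Conjugation of τ on z^⊥ and the sign of q on z combine: the modulus involves the positive
definite majorant, not the indefinite form. -/
theorem norm_kerFn (α : Fin q → Fin p) {g : Vpq p q ≃ₗ[ℝ] Vpq p q} (hg : IsSO g) (τ : ℍ)
    (x : Vpq p q) : ‖kerFn α g τ x‖ = |expLap τ.im (polyP α) (g x)| *
      Real.exp (-(Real.pi * τ.im * ∑ i, g x i ^ 2)) := by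
  rw [kerFn, norm_mul, Complex.norm_real, Real.norm_eq_abs, norm_e, qf_projZperp hg, qf_projZ hg]
  congr 3
  simp only [Complex.sub_im, Complex.neg_im, Complex.im_mul_ofReal, Complex.conj_im,
    UpperHalfPlane.coe_im, Fintype.sum_sum_type]
  ring

theorem exists_norm_le_mul_norm_apply (g : Vpq p q ≃ₗ[ℝ] Vpq p q) :
    ∃ K > 0, ∀ x : Vpq p q, 1 + ‖x‖ ≤ K * (1 + ‖g x‖) := by
  obtain ⟨K, hK, hK'⟩ := LinearMap.exists_antilipschitzWith (g : Vpq p q →ₗ[ℝ] Vpq p q)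
    (LinearEquiv.ker g)
  refine ⟨1 + K, by positivity, fun x => ?_⟩
  have h : ‖x‖ ≤ K * ‖g x‖ := by simpa using hK'.le_mul_dist x 0
  have : (0 : ℝ) < K := by exact_mod_cast hK
  nlinarith [norm_nonneg (g x)]

theorem exists_kerFn_decay (α : Fin q → Fin p) {g : Vpq p q ≃ₗ[ℝ] Vpq p q} (hg : IsSO g) (τ : ℍ)
    (N : ℕ) : ∃ C > 0, ∀ x, ‖kerFn α g τ x‖ ≤ C / (1 + ‖x‖) ^ N := by
  obtain ⟨C, hC, A, h⟩ := exists_expLap_bound (polyP α)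
  have hy := τ.im_pos
  obtain ⟨C', hC', h'⟩ := exists_pow_mul_exp_bound (A + N) (mul_pos Real.pi_pos hy) 0
  obtain ⟨K, hK, hK'⟩ := exists_norm_le_mul_norm_apply g
  refine ⟨C * (1 + 1 / τ.im) ^ A * C' * K ^ N, by positivity, fun x => ?_⟩
  rw [le_div_iff₀ (by positivity), norm_kerFn α hg]
  have h1 : Real.exp (-(Real.pi * τ.im * ∑ i, g x i ^ 2)) ≤
      Real.exp (-(Real.pi * τ.im) * ‖g x‖ ^ 2 + 0 * ‖g x‖) := by
    apply Real.exp_le_exp.2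
    have := mul_le_mul_of_nonneg_left (norm_sq_le_sum_sq (g x)) (mul_pos Real.pi_pos hy).le
    linarith
  calc _ ≤ C * (1 + 1 / τ.im) ^ A * (1 + ‖g x‖) ^ A *
        Real.exp (-(Real.pi * τ.im) * ‖g x‖ ^ 2 + 0 * ‖g x‖) * (K * (1 + ‖g x‖)) ^ N := by
        gcongr
        · exact h _ hy _
        · exact hK' x
    _ = C * (1 + 1 / τ.im) ^ A * ((1 + ‖g x‖) ^ (A + N) *
        Real.exp (-(Real.pi * τ.im) * ‖g x‖ ^ 2 + 0 * ‖g x‖)) * K ^ N := by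
        rw [mul_pow, pow_add]; ring
    _ ≤ _ := by gcongr; exact h' _ (norm_nonneg _)

theorem coe_S_smul (τ : ℍ) : ((ModularGroup.S • τ : ℍ) : ℂ) = -1 / (τ : ℂ) := by
  rw [UpperHalfPlane.modular_S_smul]
  change (-(τ : ℂ))⁻¹ = _
  rw [neg_div, one_div, inv_neg]

theorem im_S_smul (τ : ℍ) : (((ModularGroup.S • τ).im : ℝ) : ℂ) =
    τ.im / ((τ : ℂ) * starRingEnd ℂ (τ : ℂ)) := by
  rw [ModularGroup.im_smul_eq_div_normSq, ModularGroup.denom_S, Complex.mul_conj]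
  push_cast
  rfl

/-- The constant in the Fourier transform of `gaussFn`. -/
def fourierConst (p q : ℕ) (τ : ℍ) : ℂ :=
  (1 / (Complex.I * starRingEnd ℂ ((ModularGroup.S • τ : ℍ) : ℂ)) ^ (1 / 2 : ℂ)) ^ p *
  (1 / (-Complex.I * ((ModularGroup.S • τ : ℍ) : ℂ)) ^ (1 / 2 : ℂ)) ^ q * starRingEnd ℂ (τ : ℂ) ^ q

theorem sum_card_fiber (α : Fin q → Fin p) :
    ∑ j, (Finset.univ.filter (fun i => α i = j)).card = q := by
  rw [← Finset.card_eq_sum_card_fiberwise (f := α) (s := Finset.univ)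
    (t := Finset.univ) (fun _ _ => by simp)]
  simp

/-- The Gaussian parameter is b = iσ̄ with σ = -1/τ. The transform replaces the variance by
τ̄²/(4πy) and the argument by τ̄ξ, so `hn_smul` takes out one factor τ̄ per degree. -/
theorem integral_gaussFactor_inl (α : Fin q → Fin p) (τ : ℍ) (j : Fin p) (ξ : ℝ) :
    ∫ t, gaussFactor (q := q) α (ModularGroup.S • τ) (Sum.inl j) t * e ((-(t * ξ) : ℝ) : ℂ) =
      1 / (Complex.I * starRingEnd ℂ ((ModularGroup.S • τ : ℍ) : ℂ)) ^ (1 / 2 : ℂ) *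
      starRingEnd ℂ (τ : ℂ) ^ (Finset.univ.filter (fun i => α i = j)).card *
      gaussFactor α τ (Sum.inl j) ξ := by
  set σ := ModularGroup.S • τ with hσ
  have hτ0 : (τ : ℂ) ≠ 0 := τ.ne_zero
  have hτ0' : starRingEnd ℂ (τ : ℂ) ≠ 0 := by simpa using hτ0
  have hb : 0 < (Complex.I * starRingEnd ℂ (σ : ℂ)).re := by
    simp [σ.im_pos]
  have hσc : starRingEnd ℂ (σ : ℂ) = -1 / starRingEnd ℂ (τ : ℂ) := by
    rw [hσ, coe_S_smul]; simp
  have hpi : (Real.pi : ℂ) ≠ 0 := by exact_mod_cast Real.pi_ne_zero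
  have hy : (τ.im : ℂ) ≠ 0 := by exact_mod_cast τ.im_pos.ne'
  have h := integral_hn_gaussian hb ((1 / (4 * Real.pi * σ.im) : ℝ) : ℂ) ξ
    (Finset.univ.filter (fun i => α i = j)).card
  have hdiff : (τ : ℂ) - starRingEnd ℂ (τ : ℂ) = 2 * τ.im * Complex.I := by
    rw [Complex.sub_conj]; push_cast; rfl
  -- Uses Im σ = y/|τ|² and τ - τ̄ = 2iy.
  have e1 : ((1 / (4 * Real.pi * σ.im) : ℝ) : ℂ) -
      1 / (2 * Real.pi * (Complex.I * starRingEnd ℂ (σ : ℂ))) =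
      starRingEnd ℂ (τ : ℂ) ^ 2 * ((1 / (4 * Real.pi * τ.im) : ℝ) : ℂ) := by
    push_cast
    rw [hσ, im_S_smul, ← hσ, hσc]
    field_simp
    have hI : Complex.I ^ 2 = -1 := Complex.I_sq
    linear_combination (2 * Complex.I : ℂ) * hdiff + (4 * τ.im : ℂ) * hI
  have e2 : -Complex.I * (ξ : ℂ) / (Complex.I * starRingEnd ℂ (σ : ℂ)) =
      starRingEnd ℂ (τ : ℂ) * ξ := by
    rw [hσc]
    field_simp
  rw [e1, e2, hn_smul] at h
  simp only [gaussFactor, Sum.elim_inl]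
  have h3 : ∀ t : ℝ, hn ((1 / (4 * Real.pi * σ.im) : ℝ) : ℂ) t
      (Finset.univ.filter (fun i => α i = j)).card *
      Complex.exp (-Real.pi * (Complex.I * starRingEnd ℂ (σ : ℂ)) * t ^ 2) *
      e ((-(t * ξ) : ℝ) : ℂ) = hn ((1 / (4 * Real.pi * σ.im) : ℝ) : ℂ) t
      (Finset.univ.filter (fun i => α i = j)).card *
      Complex.exp (-Real.pi * (Complex.I * starRingEnd ℂ (σ : ℂ)) * t ^ 2 -
        2 * Real.pi * Complex.I * ξ * t) := by
    intro t
    rw [e, mul_assoc, ← Complex.exp_add]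
    congr 2
    push_cast
    ring
  simp_rw [h3]
  rw [h]
  have e3 : -Real.pi * (ξ : ℂ) ^ 2 / (Complex.I * starRingEnd ℂ (σ : ℂ)) =
      -Real.pi * (Complex.I * starRingEnd ℂ (τ : ℂ)) * ξ ^ 2 := by
    rw [hσc]
    field_simp
    simp
  rw [e3]
  ring

theorem integral_gaussFactor_inr (α : Fin q → Fin p) (τ : ℍ) (i : Fin q) (ξ : ℝ) :
    ∫ t, gaussFactor (p := p) α (ModularGroup.S • τ) (Sum.inr i) t * e ((t * ξ : ℝ) : ℂ) =
      1 / (-Complex.I * ((ModularGroup.S • τ : ℍ) : ℂ)) ^ (1 / 2 : ℂ) *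
      gaussFactor α τ (Sum.inr i) ξ := by
  set σ := ModularGroup.S • τ with hσ
  have hτ0 : (τ : ℂ) ≠ 0 := τ.ne_zero
  have hb : 0 < (-Complex.I * (σ : ℂ)).re := by
    simp [σ.im_pos]
  have hσc : (σ : ℂ) = -1 / (τ : ℂ) := by
    rw [hσ, coe_S_smul]
  have h := integral_hn_gaussian hb 0 (-ξ) 0
  simp only [hn, one_mul, mul_one] at h
  simp only [gaussFactor, Sum.elim_inr]
  have h3 : ∀ t : ℝ, Complex.exp (-Real.pi * (-Complex.I * (σ : ℂ)) * t ^ 2) *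
      e ((t * ξ : ℝ) : ℂ) =
      Complex.exp (-Real.pi * (-Complex.I * (σ : ℂ)) * t ^ 2 -
        2 * Real.pi * Complex.I * -ξ * t) := by
    intro t
    rw [e, ← Complex.exp_add]
    congr 1
    push_cast
    ring
  simp_rw [h3]
  rw [h]
  congr 2
  rw [hσc]
  field_simp
  simp

/-- The form carries a sign on the negative coordinates, so their characters are conjugate. The
degrees of the positive factors add up to q, whence τ̄^q in the constant. -/
theorem integral_gaussFn (α : Fin q → Fin p) (τ : ℍ) (Ξ : Vpq p q) :
    ∫ X, gaussFn α (ModularGroup.S • τ) X * e ((-form p q X Ξ : ℝ) : ℂ) =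
      fourierConst p q τ * gaussFn α τ Ξ := by
  have h1 : ∀ X : Vpq p q, gaussFn α (ModularGroup.S • τ) X * e ((-form p q X Ξ : ℝ) : ℂ) =
      (((2 : ℝ) ^ ((q : ℝ) / 2) : ℝ) : ℂ) * ∏ i, (gaussFactor α (ModularGroup.S • τ) i (X i) *
        e ((-(sgn i * (X i * Ξ i)) : ℝ) : ℂ)) := by
    intro X
    rw [gaussFn, Finset.prod_mul_distrib, ← e_sum, form_eq_sum, ← Finset.sum_neg_distrib]
    push_cast
    ring
  simp_rw [h1]
  rw [integral_const_mul, integral_fintype_prod_volume_eq_prod (fun (i : Idx p q) (t : ℝ) =>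
    gaussFactor α (ModularGroup.S • τ) i t * e ((-(sgn i * (t * Ξ i)) : ℝ) : ℂ)),
    Fintype.prod_sum_type]
  have h2 : ∀ j : Fin p, ∫ t, gaussFactor (q := q) α (ModularGroup.S • τ) (Sum.inl j) t *
      e ((-(sgn (Sum.inl j : Idx p q) * (t * Ξ (Sum.inl j))) : ℝ) : ℂ) =
      1 / (Complex.I * starRingEnd ℂ ((ModularGroup.S • τ : ℍ) : ℂ)) ^ (1 / 2 : ℂ) *
      starRingEnd ℂ (τ : ℂ) ^ (Finset.univ.filter (fun i => α i = j)).card *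
      gaussFactor α τ (Sum.inl j) (Ξ (Sum.inl j)) := fun j => by
    rw [← integral_gaussFactor_inl α τ j (Ξ (Sum.inl j))]
    simp [sgn]
  have h3 : ∀ i : Fin q, ∫ t, gaussFactor (p := p) α (ModularGroup.S • τ) (Sum.inr i) t *
      e ((-(sgn (Sum.inr i : Idx p q) * (t * Ξ (Sum.inr i))) : ℝ) : ℂ) =
      1 / (-Complex.I * ((ModularGroup.S • τ : ℍ) : ℂ)) ^ (1 / 2 : ℂ) *
      gaussFactor α τ (Sum.inr i) (Ξ (Sum.inr i)) := fun i => by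
    rw [← integral_gaussFactor_inr α τ i (Ξ (Sum.inr i))]
    simp [sgn]
  simp_rw [h2, h3]
  simp only [Finset.prod_mul_distrib, Finset.prod_const, Finset.card_univ, Fintype.card_fin,
    Finset.prod_pow_eq_pow_sum, sum_card_fiber, gaussFn, fourierConst, Fintype.prod_sum_type]
  ring

/-- The exponent `k + q/2` of `y` in the kernel. -/
abbrev wt (p q : ℕ) : ℝ := ((p : ℝ) + q) / 2 + (q : ℝ) / 2

/-- The automorphy factors cancel. -/
theorem fourierConst_mul (τ : ℍ) :
    (((ModularGroup.S • τ).im ^ wt p q : ℝ) : ℂ) *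
      ((τ : ℂ) ^ (((p : ℂ) + q) / 2) * e (((q : ℂ) - p) / 8) * fourierConst p q τ) =
      ((τ.im ^ wt p q : ℝ) : ℂ) := by
  set σ := ModularGroup.S • τ with hσ
  have hτ0 : (τ : ℂ) ≠ 0 := τ.ne_zero
  have hτ0' : starRingEnd ℂ (τ : ℂ) ≠ 0 := by simpa using hτ0
  have hpi : (Real.pi : ℂ) ≠ 0 := by exact_mod_cast Real.pi_ne_zero
  set l := Complex.log (τ : ℂ) with hl
  have hexp : Complex.exp l = τ := Complex.exp_log hτ0
  have hexp' : Complex.exp (starRingEnd ℂ l) = starRingEnd ℂ (τ : ℂ) := by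
    rw [Complex.exp_conj, hexp]
  have hlim : l.im = Complex.arg (τ : ℂ) := Complex.log_im _
  -- The strict bounds 0 < arg τ < π keep the logarithms below in the principal strip, so the
  -- branches of both square roots agree with exponentials of log τ.
  have harg0 : 0 < l.im := by
    rw [hlim]
    refine lt_of_le_of_ne (Complex.arg_nonneg_iff.2 τ.im_pos.le) fun h => ?_
    exact τ.im_pos.ne' (Complex.arg_eq_zero_iff.1 h.symm).2
  have harg1 : l.im < Real.pi := by
    rw [hlim]
    refine lt_of_le_of_ne (Complex.arg_le_pi _) fun h => ?_
    exact τ.im_pos.ne' (Complex.arg_eq_pi_iff.1 h).2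
  have hpos := Real.pi_pos
  have hI2 : Complex.exp (Real.pi / 2 * Complex.I) = Complex.I := Complex.exp_pi_div_two_mul_I
  have h1 : Complex.log (Complex.I * starRingEnd ℂ (σ : ℂ)) =
      -starRingEnd ℂ l - Real.pi / 2 * Complex.I := by
    rw [← Complex.log_exp (x := -starRingEnd ℂ l - Real.pi / 2 * Complex.I)]
    · congr 1
      rw [Complex.exp_sub, Complex.exp_neg, hexp', hI2, hσ, coe_S_smul]
      simp
      field_simp
    · simp; linarith
    · simp; linarith
  have h2 : Complex.log (-Complex.I * (σ : ℂ)) = -l + Real.pi / 2 * Complex.I := by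
    rw [← Complex.log_exp (x := -l + Real.pi / 2 * Complex.I)]
    · congr 1
      rw [Complex.exp_add, Complex.exp_neg, hexp, hI2, hσ, coe_S_smul]
      field_simp
    · simp; linarith
    · simp; linarith
  have hne1 : Complex.I * starRingEnd ℂ (σ : ℂ) ≠ 0 := by
    have := σ.ne_zero
    simpa using this
  have hne2 : -Complex.I * (σ : ℂ) ≠ 0 := by
    have := σ.ne_zero
    simpa using this
  have hsum : l + starRingEnd ℂ l = ((2 * Real.log ‖(τ : ℂ)‖ : ℝ) : ℂ) := by
    rw [Complex.add_conj, hl, Complex.log_re]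
  have h3 : Real.log σ.im = Real.log τ.im - 2 * Real.log ‖(τ : ℂ)‖ := by
    have : σ.im = τ.im / ‖(τ : ℂ)‖ ^ 2 := by
      rw [hσ, ModularGroup.im_smul_eq_div_normSq, ModularGroup.denom_S, ← Complex.normSq_eq_norm_sq]
    rw [this, Real.log_div τ.im_pos.ne' (by positivity), Real.log_pow]
    norm_num
  rw [Real.rpow_def_of_pos σ.im_pos, Real.rpow_def_of_pos τ.im_pos, h3, fourierConst,
    Complex.cpow_def_of_ne_zero hne1, Complex.cpow_def_of_ne_zero hne2,
    Complex.cpow_def_of_ne_zero hτ0, ← hl, h1, h2, ← hexp', e]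
  simp only [one_div, ← Complex.exp_neg, ← Complex.exp_nat_mul, ← Complex.exp_add,
    Complex.ofReal_exp]
  congr 1
  push_cast at hsum ⊢
  -- Both sides are now exponentials, with exponents differing by a multiple of l + l̄ = 2 log|τ|.
  linear_combination ((p : ℂ) / 2 + q) * hsum

end

section

variable {p q : ℕ}

/-! ### The kernel with characteristics -/

variable {L : Submodule ℤ (Vpq p q)} {f : ℍ → GrpAlg (dual L) L}

/-- The summand of the kernel with characteristics `v = (a,b)`. -/
def charTerm (f : ℍ → GrpAlg (dual L) L) (α : Fin q → Fin p) (g : Vpq p q ≃ₗ[ℝ] Vpq p q)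
    (u : Vpq p q) (τ : ℍ) (v : Fin 2 → ℝ) (x : dual L) : ℂ :=
  f τ (Submodule.Quotient.mk x) * kerFn α g τ (x + v 1 • u) * e ((v 0 * form p q x u : ℝ) : ℂ)

/-- The kernel `y^{k+q/2} ∑_{x ∈ L'} f_x(τ) φ_τ(x + bu) e(a(x,u))` with characteristics
`v = (a,b)`. -/
def charKernel (f : ℍ → GrpAlg (dual L) L) (α : Fin q → Fin p) (g : Vpq p q ≃ₗ[ℝ] Vpq p q)
    (u : Vpq p q) (τ : ℍ) (v : Fin 2 → ℝ) : ℂ :=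
  ((τ.im ^ wt p q : ℝ) : ℂ) * ∑' x : dual L, charTerm f α g u τ v x

theorem exists_charTerm_bound [Finite (Quo (dual L) L)] (f : ℍ → GrpAlg (dual L) L)
    (α : Fin q → Fin p) {g : Vpq p q ≃ₗ[ℝ] Vpq p q} (hg : IsSO g) (u : Vpq p q) (τ : ℍ) (N : ℕ) :
    ∃ C > 0, ∀ v x, ‖charTerm f α g u τ v x‖ ≤
      C * (1 + |v 1| * ‖u‖) ^ N * (1 / (1 + ‖(x : Vpq p q)‖) ^ N) := by
  obtain ⟨C, hC, h⟩ := exists_kerFn_decay α hg τ N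
  have := Fintype.ofFinite (Quo (dual L) L)
  refine ⟨(1 + ∑ γ, ‖f τ γ‖) * C, by positivity, fun v x => ?_⟩
  rw [charTerm, norm_mul, norm_mul, norm_e_ofReal, mul_one, mul_assoc _ C, mul_assoc]
  have h1 : ‖f τ (Submodule.Quotient.mk x)‖ ≤ 1 + ∑ γ, ‖f τ γ‖ := by
    have := Finset.single_le_sum (f := fun γ => ‖f τ γ‖) (fun _ _ => norm_nonneg _)
      (Finset.mem_univ (Submodule.Quotient.mk x : Quo (dual L) L))
    linarith
  gcongr
  refine (h _).trans ?_
  rw [mul_one_div, div_le_div_iff₀ (by positivity) (by positivity), mul_assoc]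
  gcongr
  rw [← mul_pow]
  gcongr
  have := one_add_norm_le (x : Vpq p q) (v 1 • u)
  rw [norm_smul, Real.norm_eq_abs] at this
  linarith

theorem summable_dual [DiscreteTopology L] [IsZLattice ℝ L] (hL : IsEven L) :
    ∃ N : ℕ, Fintype.card (Idx p q) < N ∧
      Summable fun x : dual L => 1 / (1 + ‖(x : Vpq p q)‖) ^ N := by
  have := discreteTopology_dual L hL
  exact ⟨Module.finrank ℤ (dual L) + Fintype.card (Idx p q) + 1, by omega,
    summable_one_add_norm_lattice (dual L) (by omega)⟩

theorem summable_charTerm [DiscreteTopology L] [IsZLattice ℝ L] (hL : IsEven L)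
    (f : ℍ → GrpAlg (dual L) L)
    (α : Fin q → Fin p) {g : Vpq p q ≃ₗ[ℝ] Vpq p q} (hg : IsSO g) (u : Vpq p q) (τ : ℍ)
    (v : Fin 2 → ℝ) : Summable (charTerm f α g u τ v) := by
  have := finite_quo L hL
  obtain ⟨N, -, hN⟩ := summable_dual hL
  obtain ⟨C, hC, h⟩ := exists_charTerm_bound f α hg u τ N
  exact Summable.of_norm_bounded (hN.mul_left _) (h v)

theorem continuous_charKernel [DiscreteTopology L] [IsZLattice ℝ L] (hL : IsEven L)
    (f : ℍ → GrpAlg (dual L) L)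
    (α : Fin q → Fin p) {g : Vpq p q ≃ₗ[ℝ] Vpq p q} (hg : IsSO g) (u : Vpq p q) (τ : ℍ) :
    Continuous (charKernel f α g u τ) := by
  have := finite_quo L hL
  obtain ⟨N, -, hN⟩ := summable_dual hL
  obtain ⟨C, hC, h⟩ := exists_charTerm_bound f α hg u τ N
  refine continuous_const.mul (continuous_iff_continuousAt.2 fun v₀ => ?_)
  have hS : IsOpen {v : Fin 2 → ℝ | |v 1| < |v₀ 1| + 1} :=
    isOpen_lt (by fun_prop) continuous_const
  refine ContinuousOn.continuousAt (s := {v : Fin 2 → ℝ | |v 1| < |v₀ 1| + 1}) ?_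
    (hS.mem_nhds (by simp))
  refine continuousOn_tsum (u := fun x : dual L => C * (1 + (|v₀ 1| + 1) * ‖u‖) ^ N *
    (1 / (1 + ‖(x : Vpq p q)‖) ^ N)) (fun x => ?_) (hN.mul_left _) fun x v hv => ?_
  · unfold charTerm
    have := continuous_kerFn α hg τ
    exact Continuous.continuousOn (by fun_prop)
  · refine (h v x).trans ?_
    gcongr
    exact hv.le

/-- Period in a: (x,u) ∈ ℤ for x ∈ L'. Period in b: shifting x by a multiple of u ∈ L changes
neither its class nor, u being isotropic, its pairing with u. -/
theorem charKernel_add_int (hL : IsEven L) (f : ℍ → GrpAlg (dual L) L)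
    (α : Fin q → Fin p) (g : Vpq p q ≃ₗ[ℝ] Vpq p q) {u : Vpq p q} (hu : u ∈ L)
    (hu0 : form p q u u = 0) (τ : ℍ) (v : Fin 2 → ℝ) (m : Fin 2 → ℤ) :
    charKernel f α g u τ (fun i => v i + m i) = charKernel f α g u τ v := by
  rw [charKernel, charKernel]
  congr 1
  have hmu : m 1 • u ∈ L := L.smul_mem _ hu
  rw [← (Equiv.addRight (⟨m 1 • u, hL.le_dual hmu⟩ : dual L)).tsum_eq (charTerm f α g u τ v)]
  refine tsum_congr fun x => ?_
  rw [charTerm, charTerm]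
  have h1 : (Submodule.Quotient.mk (Equiv.addRight (⟨m 1 • u, hL.le_dual hmu⟩ : dual L) x) :
      Quo (dual L) L) = Submodule.Quotient.mk x := by
    rw [quo_mk_eq_iff]
    simpa using hmu
  rw [h1]
  obtain ⟨n, hn⟩ := exists_form_int x.2 hu
  congr 1
  · congr 2
    simp only [Equiv.coe_addRight, Submodule.coe_add, add_smul, Int.cast_smul_eq_zsmul]
    abel
  · have h2 : form p q ((Equiv.addRight (⟨m 1 • u, hL.le_dual hmu⟩ : dual L) x : dual L) :
        Vpq p q) u = n := by
      simp only [Equiv.coe_addRight, Submodule.coe_add, map_add, LinearMap.add_apply, hn,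
        map_zsmul, LinearMap.smul_apply, hu0, smul_zero, add_zero]
    rw [h2, hn]
    have : (((v 0 + m 0) * n : ℝ) : ℂ) = ((v 0 * n : ℝ) : ℂ) + ((m 0 * n : ℤ) : ℂ) := by
      push_cast; ring
    rw [this, e_add_int]

theorem coe_quoEquiv {A' A : Submodule ℤ (Vpq p q)} (h : A ≤ A') (z : Quo A' A × A) :
    (quoEquiv h z : Vpq p q) = rep z.1 + z.2 := rfl

theorem tsum_dual_eq_sum [Fintype (Quo (dual L) L)] (hL : IsEven L) {F : dual L → ℂ}
    (hF : Summable F) : ∑' x, F x = ∑ γ : Quo (dual L) L, ∑' l : L,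
      F (quoEquiv hL.le_dual (γ, l)) := by
  rw [← (quoEquiv hL.le_dual).tsum_eq F, Summable.tsum_prod, tsum_fintype]
  exact (quoEquiv hL.le_dual).summable_iff.2 hF

theorem kernel_eq_charKernel [DiscreteTopology L] [IsZLattice ℝ L] (hL : IsEven L)
    (f : ℍ → GrpAlg (dual L) L) (α : Fin q → Fin p) {g : Vpq p q ≃ₗ[ℝ] Vpq p q} (hg : IsSO g)
    (u : Vpq p q) (τ : ℍ) : kernel L f α g τ = charKernel f α g u τ 0 := by
  have := finite_quo L hL
  have := Fintype.ofFinite (Quo (dual L) L)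
  rw [kernel, charKernel, scal, finsum_eq_sum_of_fintype,
    tsum_dual_eq_sum hL (summable_charTerm hL f α hg u τ 0), Real.rpow_add τ.im_pos,
    Complex.ofReal_mul, mul_assoc, Finset.mul_sum _ _ ((τ.im ^ ((q : ℝ) / 2) : ℝ) : ℂ)]
  congr 1
  refine Finset.sum_congr rfl fun γ _ => ?_
  rw [thetaL, map_mul, Complex.conj_ofReal, mul_left_comm]
  congr 1
  rw [Complex.conj_tsum, ← tsum_mul_left]
  refine tsum_congr fun l => ?_
  rw [charTerm, quoEquiv_mk]
  simp only [Pi.zero_apply, zero_mul, Complex.ofReal_zero, e_zero, mul_one, zero_smul, add_zero,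
    map_mul, Complex.conj_ofReal, conj_e, kerFn, coe_quoEquiv]
  congr 3
  simp only [map_add, map_mul, Complex.conj_ofReal, Complex.conj_conj]
  ring

theorem one_vadd_im (τ : ℍ) : ((1 : ℝ) +ᵥ τ).im = τ.im := by simp

theorem kerFn_vadd (α : Fin q → Fin p) {g : Vpq p q ≃ₗ[ℝ] Vpq p q} (hg : IsSO g) (τ : ℍ)
    (r : ℝ) (x : Vpq p q) :
    kerFn α g (r +ᵥ τ) x = kerFn α g τ x * e (-(r * qf x) : ℝ) := by
  have hq : qf x = qf (projZperp g x) + qf (projZ g x) := by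
    rw [qf_projZperp hg, qf_projZ hg, qf, ← hg.1, form]
    simp only [LinearMap.mk₂_apply, sq]
    ring
  rw [kerFn, kerFn, mul_assoc, ← e_add, UpperHalfPlane.vadd_im, hq]
  congr 2
  simp only [UpperHalfPlane.coe_vadd, map_add, Complex.conj_ofReal]
  push_cast
  ring

theorem e_qf_rep (hL : IsEven L) (x : dual L) :
    e (qf (rep (Submodule.Quotient.mk x : Quo (dual L) L)) : ℝ) = e (qf (x : Vpq p q) : ℝ) := by
  have h := rep_mk_sub_mem (A := L) x
  set l := rep (Submodule.Quotient.mk x : Quo (dual L) L) - (x : Vpq p q) with hl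
  have h2 : rep (Submodule.Quotient.mk x : Quo (dual L) L) = x + l := by rw [hl]; abel
  obtain ⟨n, hn⟩ := hL l h
  obtain ⟨m, hm⟩ := exists_form_int x.2 h
  rw [h2, qf_add, hn, hm]
  have : ((qf (x : Vpq p q) + n + m : ℝ) : ℂ) = (qf (x : Vpq p q) : ℝ) + ((n + m : ℤ) : ℂ) := by
    push_cast; ring
  rw [this, e_add_int]

/-- By isotropy q(x+bu) = q(x) + b(x,u). The phase e(q(x)) cancels against that of f, and e(-b(x,u))
moves a to a - b. -/
theorem charKernel_T (hL : IsEven L) (hf : IsCuspForm L f) (α : Fin q → Fin p)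
    {g : Vpq p q ≃ₗ[ℝ] Vpq p q} (hg : IsSO g) {u : Vpq p q} (hu0 : form p q u u = 0) (τ : ℍ)
    (v : Fin 2 → ℝ) :
    charKernel f α g u ((1 : ℝ) +ᵥ τ) v = charKernel f α g u τ ![v 0 - v 1, v 1] := by
  rw [charKernel, charKernel, one_vadd_im]
  congr 1
  refine tsum_congr fun x => ?_
  rw [charTerm, charTerm, hf.mod_T, weilT, kerFn_vadd α hg, e_qf_rep hL]
  simp only [Matrix.cons_val_zero, Matrix.cons_val_one]
  have hq : qf ((x : Vpq p q) + v 1 • u) = qf (x : Vpq p q) + v 1 * form p q x u := by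
    rw [qf_add, qf_smul, qf.eq_def u, hu0]
    simp
  rw [hq]
  have h1 : e (((v 0 - v 1) * form p q x u : ℝ) : ℂ) = e (qf (x : Vpq p q) : ℝ) *
      e (-(1 * (qf (x : Vpq p q) + v 1 * form p q x u)) : ℝ) *
        e ((v 0 * form p q x u : ℝ) : ℂ) := by
    rw [← e_add, ← e_add]
    congr 1
    push_cast
    ring
  rw [h1]
  ring

theorem integral_kerFn (α : Fin q → Fin p) {g : Vpq p q ≃ₗ[ℝ] Vpq p q} (hg : IsSO g) (τ : ℍ)
    (ξ : Vpq p q) :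
    ∫ v, kerFn α g (ModularGroup.S • τ) v * e ((-form p q v ξ : ℝ) : ℂ) =
      fourierConst p q τ * kerFn α g τ ξ := by
  rw [kerFn_eq α hg, ← integral_gaussFn]
  have hmp : MeasurePreserving g (volume : Measure (Vpq p q)) volume := by
    have h1 : LinearMap.det (g : Vpq p q →ₗ[ℝ] Vpq p q) ≠ 0 := by rw [hg.2]; exact one_ne_zero
    refine ⟨(LinearMap.continuous_of_finiteDimensional
      (g : Vpq p q →ₗ[ℝ] Vpq p q)).measurable, ?_⟩
    have := Real.map_linearMap_volume_pi_eq_smul_volume_pi h1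
    rw [hg.2] at this
    simpa using this
  have hemb : MeasurableEmbedding g :=
    (g.toContinuousLinearEquiv.toHomeomorph).measurableEmbedding
  rw [← hmp.integral_comp hemb fun X => gaussFn α (ModularGroup.S • τ) X *
    e ((-form p q X (g ξ) : ℝ) : ℂ)]
  refine integral_congr_ae (Filter.Eventually.of_forall fun v => ?_)
  simp only
  rw [kerFn_eq α hg, hg.1]

theorem weilS_mk [Fintype (Quo (dual L) L)] (φ : GrpAlg (dual L) L) (x : dual L) :
    weilS L φ (Submodule.Quotient.mk x) =
      e (((q : ℂ) - p) / 8) / (Real.sqrt (Nat.card (Quo (dual L) L)) : ℂ) *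
      ∑ γ, e (-(form p q x (rep γ)) : ℝ) * φ γ := by
  rw [weilS, finsum_eq_sum_of_fintype]
  congr 1
  refine Finset.sum_congr rfl fun γ _ => ?_
  congr 1
  have h : (-x : Vpq p q) ∈ dual L := (dual L).neg_mem x.2
  have h2 := e_form_congr ((dual L).neg_mem (rep_mem γ)) (rep_mk_sub_mem (A := L) x)
  simp only [map_neg, LinearMap.neg_apply] at h2
  rw [form_comm (x : Vpq p q)]
  exact_mod_cast h2

/-- Poisson summation over L' is applied for each component f_γ; the dual sums over γ + L together
run through L' again. A translation by bu becomes a character and the character in a becomes a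
translation, so the characteristics are exchanged. -/
theorem charKernel_S [DiscreteTopology L] [IsZLattice ℝ L] (hL : IsEven L) (hf : IsCuspForm L f)
    (α : Fin q → Fin p) {g : Vpq p q ≃ₗ[ℝ] Vpq p q} (hg : IsSO g) {u : Vpq p q}
    (hu0 : form p q u u = 0) (τ : ℍ) (v : Fin 2 → ℝ) :
    charKernel f α g u (ModularGroup.S • τ) v = charKernel f α g u τ ![v 1, -v 0] := by
  have := finite_quo L hL
  have := Fintype.ofFinite (Quo (dual L) L)
  set σ := ModularGroup.S • τ with hσ
  obtain ⟨N, hN, hsumN⟩ := summable_dual hL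
  -- The character e(-(x,γ)) from the matrix of S is absorbed into the function to be transformed;
  -- it shifts the dual variable l to γ + l.
  set F : Quo (dual L) L → Vpq p q → ℂ := fun γ x => kerFn α g σ (x + v 1 • u) *
    e ((v 0 * form p q x u - form p q x (rep γ) : ℝ) : ℂ) with hF
  have hFc : ∀ γ, Continuous (F γ) := fun γ => by
    have h1 := continuous_kerFn α hg σ
    have h2 : ∀ y, Continuous fun x => form p q x y := fun y =>
      continuous_form.comp (continuous_id.prodMk continuous_const)
    have h3 := h2 u
    have h4 := h2 (rep γ)
    simp only [hF]
    fun_prop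
  obtain ⟨C, hC, hdec⟩ := exists_kerFn_decay α hg σ N
  have hFd : ∀ γ, ∃ C, ∀ x, ‖F γ x‖ ≤ C / (1 + ‖x‖) ^ N := fun γ => by
    refine ⟨C * (1 + ‖v 1 • u‖) ^ N, fun x => ?_⟩
    simp only [hF, norm_mul, norm_e_ofReal, mul_one]
    refine (hdec _).trans ?_
    rw [div_le_div_iff₀ (by positivity) (by positivity), mul_assoc, ← mul_pow]
    gcongr
    linarith [one_add_norm_le x (v 1 • u)]
  have hFi : ∀ γ (l : L), ∫ x, F γ x * e ((-form p q x l : ℝ) : ℂ) =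
      fourierConst p q τ * (kerFn α g τ (quoEquiv hL.le_dual (γ, l) + (-v 0) • u) *
        e ((v 1 * form p q (quoEquiv hL.le_dual (γ, l)) u : ℝ) : ℂ)) := by
    intro γ l
    set y : Vpq p q := (quoEquiv hL.le_dual (γ, l)).1 with hy
    have hyr : y = rep γ + l := rfl
    rw [← mul_assoc, ← integral_kerFn α hg, ← integral_mul_const,
      ← integral_add_right_eq_self (fun x => kerFn α g (ModularGroup.S • τ) x *
        e ((-form p q x (y + (-v 0) • u) : ℝ) : ℂ) * e ((v 1 * form p q y u : ℝ) : ℂ)) (v 1 • u)]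
    refine integral_congr_ae (Filter.Eventually.of_forall fun x => ?_)
    simp only [hF]
    rw [mul_assoc, mul_assoc, ← e_add, ← e_add]
    congr 2
    rw [hyr]
    simp only [map_add, LinearMap.add_apply, map_smul, LinearMap.smul_apply, smul_eq_mul,
      map_neg, hu0, form_comm u, neg_smul]
    push_cast
    ring
  have hS : Summable fun x : dual L => charTerm f α g u τ ![v 1, -v 0] x :=
    summable_charTerm hL f α hg u τ _
  have hG : Summable fun x : dual L => kerFn α g τ (x + (-v 0) • u) *
      e ((v 1 * form p q x u : ℝ) : ℂ) := by
    have := summable_charTerm hL (fun _ _ => (1 : ℂ)) α hg u τ ![v 1, -v 0]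
    exact this.congr fun x => by simp [charTerm]
  have hPs : ∀ γ, Summable fun l : L => ∫ x, F γ x * e ((-form p q x l : ℝ) : ℂ) := by
    intro γ
    simp_rw [hFi]
    refine Summable.mul_left _ ?_
    have := ((quoEquiv hL.le_dual).summable_iff.2 hG)
    exact this.comp_injective (i := fun l : L => (γ, l)) fun a b h => by simpa using h
  have hPois := fun γ => poisson_dual L hL (hFc γ) hN (hFd γ) (hPs γ)
  have hFsum : ∀ γ, Summable fun x : dual L => F γ x := fun γ => by
    obtain ⟨C, hC⟩ := hFd γ
    refine Summable.of_norm_bounded (hsumN.mul_left C) fun x => ?_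
    rw [mul_one_div]
    exact hC x
  have hcard : (Real.sqrt (Nat.card (Quo (dual L) L)) : ℂ) ≠ 0 := by
    have := card_quo_pos L hL
    exact_mod_cast (Real.sqrt_pos.2 (by exact_mod_cast this)).ne'
  have hterm : ∀ x : dual L, charTerm f α g u σ v x =
      ((τ : ℂ) ^ (((p : ℂ) + q) / 2) * (e (((q : ℂ) - p) / 8) /
        (Real.sqrt (Nat.card (Quo (dual L) L)) : ℂ))) * ∑ γ, f τ γ * F γ x := by
    intro x
    rw [charTerm, hf.mod_S]
    simp only [weilS_mk]
    simp only [Finset.mul_sum, Finset.sum_mul]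
    refine Finset.sum_congr rfl fun γ _ => ?_
    simp only [hF, sub_eq_add_neg, Complex.ofReal_add, e_add]
    ring
  rw [charKernel, charKernel, ← fourierConst_mul (p := p) (q := q) τ, ← hσ]
  simp_rw [hterm]
  rw [tsum_mul_left, Summable.tsum_finsetSum fun γ _ => (hFsum γ).mul_left _]
  simp_rw [tsum_mul_left, hPois, hFi, tsum_mul_left]
  rw [tsum_dual_eq_sum hL hS]
  simp only [Finset.mul_sum]
  refine Finset.sum_congr rfl fun γ _ => ?_
  have : ∑' l : L, charTerm f α g u τ ![v 1, -v 0] (quoEquiv hL.le_dual (γ, l)) =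
      f τ γ * ∑' l : L, kerFn α g τ (quoEquiv hL.le_dual (γ, l) + (-v 0) • u) *
        e ((v 1 * form p q (quoEquiv hL.le_dual (γ, l)) u : ℝ) : ℂ) := by
    rw [← tsum_mul_left]
    refine tsum_congr fun l => ?_
    rw [charTerm, quoEquiv_mk]
    simp [mul_assoc]
  rw [this]
  field_simp

end

section

variable {p q : ℕ}
variable {L : Submodule ℤ (Vpq p q)} {f : ℍ → GrpAlg (dual L) L}

/-! ### Fourier coefficients with respect to the characteristics -/

/-- The `n`-th Fourier coefficient of the kernel with characteristics. -/
def charCoeff (f : ℍ → GrpAlg (dual L) L) (α : Fin q → Fin p) (g : Vpq p q ≃ₗ[ℝ] Vpq p q)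
    (u : Vpq p q) (τ : ℍ) (n : Fin 2 → ℤ) : ℂ :=
  ∫ x in {x : Fin 2 → ℝ | ∀ i, x i ∈ Set.Ioc (0 : ℝ) (0 + 1)},
    e ((-∑ i, n i * x i : ℝ) : ℂ) * charKernel f α g u τ x

theorem mFourierCoeff_eq_integral_box {ι : Type*} [Fintype ι] {P : (ι → ℝ) → ℂ}
    {G : C(UnitAddTorus ι, ℂ)} (hG : ∀ x : ι → ℝ, G (fun i => (x i : UnitAddCircle)) = P x)
    (n : ι → ℤ) : UnitAddTorus.mFourierCoeff G n =
      ∫ x in {x : ι → ℝ | ∀ i, x i ∈ Set.Ioc (0 : ℝ) (0 + 1)},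
        e ((-∑ i, n i * x i : ℝ) : ℂ) * P x := by
  rw [UnitAddTorus.mFourierCoeff_eq_integral _ _ 0]
  simp only [Pi.zero_apply]
  refine integral_congr_ae (Filter.Eventually.of_forall fun x => ?_)
  simp only
  rw [hG, smul_eq_mul, mFourier_coe]
  simp

/-- A continuous surjective endomorphism of a compact group preserves Haar measure, so only the
character has to be pulled back. -/
theorem mFourierCoeff_comp {ι : Type*} [Fintype ι] (φ : UnitAddTorus ι →+ UnitAddTorus ι)
    (hφ : Continuous φ) (hφs : Function.Surjective φ) (G : C(UnitAddTorus ι, ℂ)) {n n' : ι → ℤ}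
    (h : ∀ t, UnitAddTorus.mFourier (-n) t = UnitAddTorus.mFourier (-n') (φ t)) :
    UnitAddTorus.mFourierCoeff (fun t => G (φ t)) n = UnitAddTorus.mFourierCoeff G n' := by
  have hmp : MeasurePreserving φ (Measure.pi fun _ : ι => AddCircle.haarAddCircle (T := 1))
      (Measure.pi fun _ : ι => AddCircle.haarAddCircle (T := 1)) :=
    AddMonoidHom.measurePreserving hφ hφs rfl
  rw [UnitAddTorus.mFourierCoeff, UnitAddTorus.mFourierCoeff]
  have hm := integral_map (f := fun t => UnitAddTorus.mFourier (-n') t • G t) hmp.aemeasurable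
    (Continuous.aestronglyMeasurable (by fun_prop))
  rw [hmp.map_eq] at hm
  refine Eq.trans ?_ hm.symm
  simp only [h]
  rfl

/-- The automorphism `(a,b) ↦ (a-b,b)`. -/
def torusT : UnitAddTorus (Fin 2) →+ UnitAddTorus (Fin 2) where
  toFun t := ![t 0 - t 1, t 1]
  map_zero' := by ext i; fin_cases i <;> simp
  map_add' s t := by ext i; fin_cases i <;> simp [add_sub_add_comm]

/-- The automorphism `(a,b) ↦ (b,-a)`. -/
def torusS : UnitAddTorus (Fin 2) →+ UnitAddTorus (Fin 2) where
  toFun t := ![t 1, -t 0]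
  map_zero' := by ext i; fin_cases i <;> simp
  map_add' s t := by ext i; fin_cases i <;> simp [add_comm]

theorem exists_coe_eq {ι : Type*} (t : UnitAddTorus ι) :
    ∃ x : ι → ℝ, (fun i => (x i : UnitAddCircle)) = t := by
  choose x hx using fun i => QuotientAddGroup.mk_surjective (t i)
  exact ⟨x, funext hx⟩

theorem torusT_coe (x : Fin 2 → ℝ) : torusT (fun i => (x i : UnitAddCircle)) =
    fun i => ((![x 0 - x 1, x 1] i : ℝ) : UnitAddCircle) := by
  ext i; fin_cases i <;> simp [torusT]

theorem torusS_coe (x : Fin 2 → ℝ) : torusS (fun i => (x i : UnitAddCircle)) =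
    fun i => ((![x 1, -x 0] i : ℝ) : UnitAddCircle) := by
  ext i; fin_cases i <;> simp [torusS]

theorem continuous_torusT : Continuous torusT := by
  refine continuous_pi fun i => ?_
  fin_cases i <;> simp [torusT] <;> fun_prop

theorem continuous_torusS : Continuous torusS := by
  refine continuous_pi fun i => ?_
  fin_cases i <;> simp [torusS] <;> fun_prop

theorem surjective_torusT : Function.Surjective torusT := fun t =>
  ⟨![t 0 + t 1, t 1], by ext i; fin_cases i <;> simp [torusT]⟩

theorem surjective_torusS : Function.Surjective torusS := fun t =>
  ⟨![-t 1, t 0], by ext i; fin_cases i <;> simp [torusS]⟩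

variable [DiscreteTopology L] [IsZLattice ℝ L]

theorem exists_charTorus (hL : IsEven L) (f : ℍ → GrpAlg (dual L) L)
    (α : Fin q → Fin p) {g : Vpq p q ≃ₗ[ℝ] Vpq p q} (hg : IsSO g) {u : Vpq p q} (hu : u ∈ L)
    (hu0 : form p q u u = 0) (τ : ℍ) : ∃ G : C(UnitAddTorus (Fin 2), ℂ),
      (∀ x : Fin 2 → ℝ, G (fun i => (x i : UnitAddCircle)) = charKernel f α g u τ x) ∧
      ∀ n, UnitAddTorus.mFourierCoeff G n = charCoeff f α g u τ n := by
  obtain ⟨G, hG⟩ := exists_torus_lift (continuous_charKernel hL f α hg u τ)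
    (charKernel_add_int hL f α g hu hu0 τ)
  exact ⟨G, hG, mFourierCoeff_eq_integral_box hG⟩

theorem charCoeff_T (hL : IsEven L) (hf : IsCuspForm L f)
    (α : Fin q → Fin p) {g : Vpq p q ≃ₗ[ℝ] Vpq p q} (hg : IsSO g) {u : Vpq p q} (hu : u ∈ L)
    (hu0 : form p q u u = 0) (τ : ℍ) (n : Fin 2 → ℤ) :
    charCoeff f α g u ((1 : ℝ) +ᵥ τ) n = charCoeff f α g u τ ![n 0, n 0 + n 1] := by
  obtain ⟨G, hG, hGc⟩ := exists_charTorus hL f α hg hu hu0 τ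
  obtain ⟨G', hG', hGc'⟩ := exists_charTorus hL f α hg hu hu0 ((1 : ℝ) +ᵥ τ)
  rw [← hGc, ← hGc', ← mFourierCoeff_comp torusT continuous_torusT surjective_torusT G (n := n)]
  · congr 1
    ext t
    obtain ⟨x, rfl⟩ := exists_coe_eq t
    rw [hG', torusT_coe, hG, charKernel_T hL hf α hg hu0]
  · intro t
    obtain ⟨x, rfl⟩ := exists_coe_eq t
    rw [torusT_coe, mFourier_coe, mFourier_coe]
    simp [Fin.sum_univ_two]
    congr 1
    ring

theorem charCoeff_S (hL : IsEven L) (hf : IsCuspForm L f)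
    (α : Fin q → Fin p) {g : Vpq p q ≃ₗ[ℝ] Vpq p q} (hg : IsSO g) {u : Vpq p q} (hu : u ∈ L)
    (hu0 : form p q u u = 0) (τ : ℍ) (n : Fin 2 → ℤ) :
    charCoeff f α g u (ModularGroup.S • τ) n = charCoeff f α g u τ ![n 1, -n 0] := by
  obtain ⟨G, hG, hGc⟩ := exists_charTorus hL f α hg hu hu0 τ
  obtain ⟨G', hG', hGc'⟩ := exists_charTorus hL f α hg hu hu0 (ModularGroup.S • τ)
  rw [← hGc, ← hGc', ← mFourierCoeff_comp torusS continuous_torusS surjective_torusS G (n := n)]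
  · congr 1
    ext t
    obtain ⟨x, rfl⟩ := exists_coe_eq t
    rw [hG', torusS_coe, hG, charKernel_S hL hf α hg hu0]
  · intro t
    obtain ⟨x, rfl⟩ := exists_coe_eq t
    rw [torusS_coe, mFourier_coe, mFourier_coe]
    simp [Fin.sum_univ_two]
    congr 1
    ring

/-- S and T act on the characteristics by torus automorphisms, hence dually on the characters; on
row vectors this is right multiplication, which is compatible with products. -/
theorem charCoeff_smul (hL : IsEven L) (hf : IsCuspForm L f)
    (α : Fin q → Fin p) {g : Vpq p q ≃ₗ[ℝ] Vpq p q} (hg : IsSO g) {u : Vpq p q} (hu : u ∈ L)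
    (hu0 : form p q u u = 0) (γ : SL(2, ℤ)) : ∀ (τ : ℍ) (n : Fin 2 → ℤ),
    charCoeff f α g u (γ • τ) n = charCoeff f α g u τ (Matrix.vecMul n γ) := by
  have hγ : γ ∈ Subgroup.closure {ModularGroup.S, ModularGroup.T} := by
    rw [SpecialLinearGroup.SL2Z_generators]; trivial
  induction hγ using Subgroup.closure_induction with
  | mem x hx =>
    intro τ n
    rcases hx with rfl | rfl
    · rw [charCoeff_S hL hf α hg hu hu0]
      congr 1
      ext i
      fin_cases i <;> simp [ModularGroup.S, Matrix.vecMul, dotProduct, Fin.sum_univ_two]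
    · rw [UpperHalfPlane.modular_T_smul, charCoeff_T hL hf α hg hu hu0]
      congr 1
      ext i
      fin_cases i <;> simp [ModularGroup.T, Matrix.vecMul, dotProduct, Fin.sum_univ_two]
  | one => intro τ n; simp
  | mul x y _ _ hx hy =>
    intro τ n
    rw [mul_smul, hx, hy, Matrix.vecMul_vecMul, Matrix.SpecialLinearGroup.coe_mul]
  | inv x _ hx =>
    intro τ n
    have := hx (x⁻¹ • τ) (Matrix.vecMul n (x⁻¹ : SL(2, ℤ)))
    rw [smul_inv_smul, Matrix.vecMul_vecMul, ← Matrix.SpecialLinearGroup.coe_mul,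
      inv_mul_cancel] at this
    rw [this]
    simp

/-- The Fourier series at the origin. Its summability is supplied later, for almost every τ, by the
integrability of the unfolded terms. -/
theorem hasSum_charCoeff (hL : IsEven L) (f : ℍ → GrpAlg (dual L) L)
    (α : Fin q → Fin p) {g : Vpq p q ≃ₗ[ℝ] Vpq p q} (hg : IsSO g) {u : Vpq p q} (hu : u ∈ L)
    (hu0 : form p q u u = 0) (τ : ℍ) (hs : Summable (charCoeff f α g u τ)) :
    HasSum (charCoeff f α g u τ) (kernel L f α g τ) := by
  obtain ⟨G, hG, hGc⟩ := exists_charTorus hL f α hg hu hu0 τ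
  have hGc' := funext hGc
  have h := UnitAddTorus.hasSum_mFourier_series_apply_of_summable (f := G) (hGc' ▸ hs) 0
  have h0 := hG 0
  rw [hGc'] at h
  rw [kernel_eq_charKernel hL f α hg u, ← h0]
  have hz : (fun i : Fin 2 => (((0 : Fin 2 → ℝ) i : ℝ) : UnitAddCircle)) = 0 := by ext; simp
  rw [hz]
  refine h.congr_fun fun x => ?_
  simp [UnitAddTorus.mFourier]

end

section

variable {p q : ℕ}

/-! ### The reduced polynomials -/

theorem hasDerivAt_eval_line (l X : Vpq p q) (R : MvPolynomial (Idx p q) ℝ) (s : ℝ) :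
    HasDerivAt (fun s : ℝ => MvPolynomial.eval (X + s • l) R)
      (MvPolynomial.eval (X + s • l) (dirDeriv l R)) s := by
  induction R using MvPolynomial.induction_on with
  | C a =>
    simp only [MvPolynomial.eval_C, dirDeriv, MvPolynomial.pderiv_C, mul_zero,
      Finset.sum_const_zero, map_zero]
    exact hasDerivAt_const _ _
  | add P Q hP hQ =>
    have h : dirDeriv l (P + Q) = dirDeriv l P + dirDeriv l Q := by
      simp only [dirDeriv, map_add, mul_add, Finset.sum_add_distrib]
    simp only [map_add, h]
    exact hP.add hQ
  | mul_X P i hP =>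
    have h : dirDeriv l (MvPolynomial.X i : MvPolynomial (Idx p q) ℝ) = MvPolynomial.C (l i) := by
      simp [dirDeriv, MvPolynomial.pderiv_X, Pi.single_apply, -Fintype.sum_sum_type]
    have h1 : HasDerivAt (fun s : ℝ => X i + s * l i) (l i) s := by
      simpa using ((hasDerivAt_id s).mul_const (l i)).const_add (X i)
    simp only [map_mul, dirDeriv_mul, map_add, h, MvPolynomial.eval_C, MvPolynomial.eval_X]
    exact hP.mul h1

/-- Invariance along lines can be tested by evaluation, which is how the reduced polynomials are
understood. -/
theorem dirDeriv_eq_zero_iff (l : Vpq p q) (R : MvPolynomial (Idx p q) ℝ) :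
    dirDeriv l R = 0 ↔
      ∀ X (s : ℝ), MvPolynomial.eval (X + s • l) R = MvPolynomial.eval X R := by
  constructor
  · intro h X s
    have h1 : ∀ s, HasDerivAt (fun s : ℝ => MvPolynomial.eval (X + s • l) R) 0 s := fun s => by
      have := hasDerivAt_eval_line l X R s
      rwa [h, map_zero] at this
    have := is_const_of_deriv_eq_zero (fun s => (h1 s).differentiableAt) (fun s => (h1 s).deriv) s 0
    simpa using this
  · intro h
    apply MvPolynomial.funext
    intro X
    have h1 := hasDerivAt_eval_line l X R 0
    simp_rw [h] at h1
    rw [map_zero]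
    have := h1.unique (hasDerivAt_const _ _)
    simpa using this

theorem expLap_add_smul {l : Vpq p q} {R : MvPolynomial (Idx p q) ℝ} (h : dirDeriv l R = 0)
    (y : ℝ) (X : Vpq p q) (s : ℝ) : expLap y R (X + s • l) = expLap y R X := by
  rw [expLap, expLap]
  refine tsum_congr fun m => ?_
  congr 1
  refine (dirDeriv_eq_zero_iff l _).1 ?_ X s
  rw [dirDeriv_lap_iterate, h, lap_iterate_zero]

variable {g : Vpq p q ≃ₗ[ℝ] Vpq p q} {u : Vpq p q}

theorem apply_projZperp (g : Vpq p q ≃ₗ[ℝ] Vpq p q) (v : Vpq p q) :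
    g (projZperp g v) = basePos (g v) := by simp [projZperp]

theorem apply_projZ (g : Vpq p q ≃ₗ[ℝ] Vpq p q) (v : Vpq p q) :
    g (projZ g v) = baseNeg (g v) := by simp [projZ]

theorem projZperp_add_projZ (g : Vpq p q ≃ₗ[ℝ] Vpq p q) (v : Vpq p q) :
    projZperp g v + projZ g v = v := by
  apply g.injective
  rw [map_add, apply_projZperp, apply_projZ]
  ext i; cases i <;> simp [basePos, baseNeg]

theorem form_projZperp_projZ (hg : IsSO g) (v w : Vpq p q) :
    form p q (projZperp g v) (projZ g w) = 0 := by
  rw [← hg.1, apply_projZ, apply_projZperp]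
  simp [form, basePos, baseNeg]

theorem normZperp_eq_sum (hg : IsSO g) (u : Vpq p q) :
    normZperp g u = ∑ i, (g (projZperp g u) i) ^ 2 := by
  rw [normZperp, ← hg.1, apply_projZperp]
  simp [form, basePos, sq]

theorem normZ_eq_neg (hg : IsSO g) (hu0 : form p q u u = 0) : normZ g u = -normZperp g u := by
  have h : form p q (projZperp g u + projZ g u) (projZperp g u + projZ g u) = 0 := by
    rw [projZperp_add_projZ, hu0]
  simp only [map_add, LinearMap.add_apply, form_projZperp_projZ hg,
    form_comm (projZ g u) (projZperp g u)] at h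
  simp only [normZ, normZperp]
  linarith

/-- The form is definite on z^⊥ and on z. If u_{z^⊥}² = 0 then u_z² = 0 too by isotropy, so both
components vanish. -/
theorem normZperp_pos (hg : IsSO g) (hu0 : form p q u u = 0) (hu : u ≠ 0) :
    0 < normZperp g u := by
  have h0 : 0 ≤ normZperp g u := by
    rw [normZperp_eq_sum hg]
    exact Finset.sum_nonneg fun _ _ => sq_nonneg _
  refine lt_of_le_of_ne h0 fun h => hu ?_
  have h1 : ∀ j, g u (Sum.inl j) = 0 := fun j => by
    have := (Finset.sum_eq_zero_iff_of_nonneg (fun _ _ => sq_nonneg _)).1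
      ((normZperp_eq_sum hg u).symm.trans h.symm) (Sum.inl j) (Finset.mem_univ _)
    simpa [apply_projZperp, basePos] using this
  have h2 : ∑ i, g u (Sum.inr i) ^ 2 = 0 := by
    have := normZ_eq_neg hg hu0
    rw [← h, normZ, ← hg.1, apply_projZ] at this
    simpa [form, baseNeg, sq] using this
  apply g.injective
  rw [map_zero]
  ext i
  rcases i with j | i
  · exact h1 j
  · have := (Finset.sum_eq_zero_iff_of_nonneg (fun _ _ => sq_nonneg _)).1 h2 i (Finset.mem_univ _)
    simpa using this

/-- The reduced polynomials depend only on the projection to `g^#(V)`. -/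
theorem eval_redPoly_congr (P : MvPolynomial (Idx p q) ℝ) (hg : IsSO g) {X Y : Vpq p q}
    (h : gSharp g u (g.symm X) = gSharp g u (g.symm Y)) (k : ℕ) :
    MvPolynomial.eval X (redPoly P g u k) = MvPolynomial.eval Y (redPoly P g u k) := by
  have e2 : ∀ (x : Vpq p q) i, ∑ j, gSharp g u (g.symm (Pi.single j 1)) i * x j
      = gSharp g u (g.symm x) i := by
    intro x i
    have hx : x = ∑ j, x j • (Pi.single j (1 : ℝ) : Vpq p q) := by
      ext i; simp [Finset.sum_apply, Pi.single_apply, -Fintype.sum_sum_type]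
    have : ∑ j, x j • gSharp g u (g.symm (Pi.single j 1)) = gSharp g u (g.symm x) := by
      simp only [gSharp_symm hg]
      conv_rhs => rw [hx]
      simp only [map_sum, map_smul, LinearMap.sum_apply, LinearMap.smul_apply, smul_sub,
        Finset.sum_sub_distrib, Finset.sum_div, Finset.sum_smul, smul_eq_mul, smul_smul,
        mul_div_assoc]
    rw [← this]
    simp [Finset.sum_apply, mul_comm, -Fintype.sum_sum_type]
  rw [redPoly, ← Polynomial.coeff_map, ← Polynomial.coeff_map]
  congr 1
  have key : ∀ X : Vpq p q, Polynomial.map (MvPolynomial.eval X) (MvPolynomial.aeval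
      (fun i : Idx p q => Polynomial.C (∑ j : Idx p q,
        MvPolynomial.C (gSharp g u (g.symm (Pi.single j 1)) i) * MvPolynomial.X j)
      + Polynomial.X * Polynomial.C (MvPolynomial.C (g (projZperp g u) i / normZperp g u))) P) =
      MvPolynomial.eval₂ Polynomial.C (fun i => Polynomial.C (gSharp g u (g.symm X) i) +
        Polynomial.X * Polynomial.C (g (projZperp g u) i / normZperp g u)) P := by
    intro X
    rw [MvPolynomial.aeval_def, ← Polynomial.coe_mapRingHom, MvPolynomial.hom_eval₂]
    congr 1
    · ext a
      simp [Polynomial.algebraMap_apply]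
    · ext1 i
      simp only [Polynomial.coe_mapRingHom, Polynomial.map_add, Polynomial.map_mul,
        Polynomial.map_C, Polynomial.map_X, MvPolynomial.eval_C]
      rw [← e2 X i]
      simp only [map_sum, map_mul, MvPolynomial.eval_C, MvPolynomial.eval_X]
  rw [key, key, h]

theorem gSharp_eq (hg : IsSO g) (u v : Vpq p q) :
    gSharp g u v = g v - (form p q v (projZperp g u) / normZperp g u) • g (projZperp g u)
      - (form p q v (projZ g u) / normZ g u) • g (projZ g u) := by
  have := gSharp_symm hg u (g v)
  rwa [LinearEquiv.symm_apply_apply, hg.1, hg.1] at this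

theorem gSharp_add_smul_projZperp (hg : IsSO g) (h : normZperp g u ≠ 0) (v : Vpq p q) (s : ℝ) :
    gSharp g u (v + s • projZperp g u) = gSharp g u v := by
  rw [gSharp_eq hg, gSharp_eq hg]
  have h1 : form p q (projZperp g u) (projZperp g u) = normZperp g u := rfl
  simp only [map_add, map_smul, LinearMap.add_apply, LinearMap.smul_apply, smul_eq_mul,
    form_projZperp_projZ hg, h1, mul_zero, add_zero, add_div, mul_div_assoc, div_self h, mul_one,
    add_smul]
  abel

theorem gSharp_add_smul_projZ (hg : IsSO g) (h : normZ g u ≠ 0) (v : Vpq p q) (s : ℝ) :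
    gSharp g u (v + s • projZ g u) = gSharp g u v := by
  rw [gSharp_eq hg, gSharp_eq hg]
  have h1 : form p q (projZ g u) (projZ g u) = normZ g u := rfl
  simp only [map_add, map_smul, LinearMap.add_apply, LinearMap.smul_apply, smul_eq_mul,
    form_comm (projZ g u) (projZperp g u),
    form_projZperp_projZ hg, h1, mul_zero, add_zero, add_div, mul_div_assoc, div_self h, mul_one,
    add_smul]
  abel

theorem dirDeriv_redPoly_projZperp (P : MvPolynomial (Idx p q) ℝ) (hg : IsSO g)
    (h : normZperp g u ≠ 0) (k : ℕ) : dirDeriv (g (projZperp g u)) (redPoly P g u k) = 0 := by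
  rw [dirDeriv_eq_zero_iff]
  intro X s
  apply eval_redPoly_congr _ hg
  simp only [map_add, map_smul, LinearEquiv.symm_apply_apply]
  exact gSharp_add_smul_projZperp hg h _ _

theorem dirDeriv_redPoly_projZ (P : MvPolynomial (Idx p q) ℝ) (hg : IsSO g)
    (h : normZ g u ≠ 0) (k : ℕ) : dirDeriv (g (projZ g u)) (redPoly P g u k) = 0 := by
  rw [dirDeriv_eq_zero_iff]
  intro X s
  apply eval_redPoly_congr _ hg
  simp only [map_add, map_smul, LinearEquiv.symm_apply_apply]
  exact gSharp_add_smul_projZ hg h _ _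

theorem gSharp_add_smul_self (hg : IsSO g) (hu0 : form p q u u = 0) (h : normZperp g u ≠ 0)
    (v : Vpq p q) (s : ℝ) : gSharp g u (v + s • u) = gSharp g u v := by
  have h' : normZ g u ≠ 0 := by rw [normZ_eq_neg hg hu0]; exact neg_ne_zero.2 h
  conv_lhs => rw [← projZperp_add_projZ g u, smul_add, ← add_assoc]
  rw [projZperp_add_projZ g u, gSharp_add_smul_projZ hg h', gSharp_add_smul_projZperp hg h]

theorem eval_linPoly_projZperp (g : Vpq p q ≃ₗ[ℝ] Vpq p q) (u X : Vpq p q) :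
    MvPolynomial.eval X (linPoly (g (projZperp g u))) = form p q X (g (projZperp g u)) := by
  simp [linPoly, apply_projZperp, basePos, form, mul_comm]

theorem eval_redPoly_gSharp (P : MvPolynomial (Idx p q) ℝ) (hg : IsSO g)
    (h : normZperp g u ≠ 0) (h' : normZ g u ≠ 0) (v : Vpq p q) (k : ℕ) :
    MvPolynomial.eval (gSharp g u v) (redPoly P g u k) =
      MvPolynomial.eval (g v) (redPoly P g u k) := by
  rw [gSharp_eq hg, sub_eq_add_neg, ← neg_smul, sub_eq_add_neg, ← neg_smul,
    (dirDeriv_eq_zero_iff _ _).1 (dirDeriv_redPoly_projZ P hg h' k),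
    (dirDeriv_eq_zero_iff _ _).1 (dirDeriv_redPoly_projZperp P hg h k)]

theorem expLap_redPoly_gSharp (P : MvPolynomial (Idx p q) ℝ) (hg : IsSO g)
    (h : normZperp g u ≠ 0) (h' : normZ g u ≠ 0) (y : ℝ) (v : Vpq p q) (k : ℕ) :
    expLap y (redPoly P g u k) (gSharp g u v) = expLap y (redPoly P g u k) (g v) := by
  rw [gSharp_eq hg, sub_eq_add_neg, ← neg_smul, sub_eq_add_neg, ← neg_smul,
    expLap_add_smul (dirDeriv_redPoly_projZ P hg h' k),
    expLap_add_smul (dirDeriv_redPoly_projZperp P hg h k)]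

/-- The evaluation identity holds at all points, hence as an identity of polynomials, to which the
heat operator can be applied. -/
theorem polyP_eq_sum (α : Fin q → Fin p) (hg : IsSO g) (h : normZperp g u ≠ 0)
    (h' : normZ g u ≠ 0) : polyP α = ∑ k ∈ Finset.range (q + 1),
      linPoly (g (projZperp g u)) ^ k * redPoly (polyP α) g u k := by
  apply MvPolynomial.funext
  intro X
  have := eval_polyP_eq_sum α hg u (g.symm X) h
  rw [LinearEquiv.apply_symm_apply] at this
  rw [this, map_sum]
  refine Finset.sum_congr rfl fun k _ => ?_
  rw [eval_redPoly_gSharp _ hg h h', LinearEquiv.apply_symm_apply, map_mul, map_pow,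
    eval_linPoly_projZperp, ← hg.1, LinearEquiv.apply_symm_apply]

/-- The reduced polynomials are constant along g(u_{z^⊥}), so the heat operator acts on the powers
of that linear form, producing Hermite polynomials, and on the reduced polynomials separately. -/
theorem expLap_polyP_apply (α : Fin q → Fin p) (hg : IsSO g) (h : normZperp g u ≠ 0)
    (h' : normZ g u ≠ 0) (y : ℝ) (v : Vpq p q) :
    expLap y (polyP α) (g v) = ∑ k ∈ Finset.range (q + 1),
      hn (normZperp g u / (4 * Real.pi * y)) (form p q v (projZperp g u)) k *
        expLap y (redPoly (polyP α) g u k) (gSharp g u v) := by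
  rw [polyP_eq_sum α hg h h', expLap_sum]
  refine Finset.sum_congr rfl fun k _ => ?_
  rw [expLap_linPoly_pow_mul _ _ (dirDeriv_redPoly_projZperp _ hg h k), ← normZperp_eq_sum hg,
    eval_linPoly_projZperp, hg.1, ← polyP_eq_sum α hg h h', expLap_redPoly_gSharp _ hg h h']

end

section

variable {p q : ℕ}

/-! ### The elements of `L' ∩ u^⊥` -/

/-- An even lattice with an isotropic vector `u` and auxiliary vectors `u'`, `ζ`. -/
structure IsotropicData (L : Submodule ℤ (Vpq p q)) (u u' ζ : Vpq p q) (N : ℕ) : Prop where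
  even : IsEven L
  mem : u ∈ L
  iso : form p q u u = 0
  mem' : u' ∈ dual L
  form' : form p q u u' = 1
  pos : 0 < N
  dvd : ∀ l ∈ L, ∃ n : ℤ, form p q l u = n * N
  zeta_mem : ζ ∈ L
  zeta_form : form p q ζ u = N

variable {L : Submodule ℤ (Vpq p q)} {u u' ζ : Vpq p q} {N : ℕ} {f : ℍ → GrpAlg (dual L) L}

theorem projM_add (u u' v w : Vpq p q) : projM u u' (v + w) = projM u u' v + projM u u' w := by
  simp only [projM, map_add, LinearMap.add_apply, add_mul, add_smul]
  abel

theorem projM_smul (u u' v : Vpq p q) (c : ℝ) : projM u u' (c • v) = c • projM u u' v := by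
  simp only [projM, map_smul, LinearMap.smul_apply, smul_eq_mul, smul_sub, smul_add, smul_smul,
    mul_assoc]

theorem projM_sub (u u' v w : Vpq p q) : projM u u' (v - w) = projM u u' v - projM u u' w := by
  rw [sub_eq_add_neg, projM_add, ← neg_one_smul ℝ w, projM_smul, neg_one_smul, sub_eq_add_neg]

theorem projM_of_form_eq_zero (u' : Vpq p q) {v : Vpq p q} (h : form p q v u = 0) :
    projM u u' v = v - form p q v u' • u := by
  simp [projM, h]

theorem projM_of_mem_latM {l : Vpq p q} (h : l ∈ latM L u u') : projM u u' l = l := by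
  rw [projM_of_form_eq_zero u' h.2.1, h.2.2]; simp

namespace IsotropicData

theorem form'' (H : IsotropicData L u u' ζ N) : form p q u' u = 1 := by rw [form_comm, H.form']

theorem ne_zero (H : IsotropicData L u u' ζ N) : u ≠ 0 := by
  rintro rfl
  have := H.form'
  simp at this

theorem form_projM (H : IsotropicData L u u' ζ N) (v : Vpq p q) :
    form p q (projM u u' v) u = 0 := by
  simp [projM, H.iso, H.form'']

theorem form_projM' (H : IsotropicData L u u' ζ N) (v : Vpq p q) :
    form p q (projM u u' v) u' = 0 := by
  simp [projM, H.form']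

theorem exists_int_form_u' (H : IsotropicData L u u' ζ N) {l : Vpq p q} (hl : l ∈ L) :
    ∃ n : ℤ, form p q l u' = n := by
  obtain ⟨n, hn⟩ := exists_form_int H.mem' hl
  exact ⟨n, by rw [form_comm, hn]⟩

/-- On u^⊥ the projection only subtracts (w,u')u, an integral multiple of u since u' ∈ L'. -/
theorem projM_mem_latM (H : IsotropicData L u u' ζ N) {w : Vpq p q} (hw : w ∈ L)
    (h0 : form p q w u = 0) :
    projM u u' w ∈ latM L u u' := by
  refine ⟨?_, H.form_projM _, H.form_projM' _⟩
  rw [projM_of_form_eq_zero u' h0]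
  obtain ⟨n, hn⟩ := H.exists_int_form_u' hw
  rw [hn, Int.cast_smul_eq_zsmul]
  exact L.sub_mem hw (L.smul_mem _ H.mem)

theorem projM_mem_dualM (H : IsotropicData L u u' ζ N) {x : Vpq p q} (hx : x ∈ dual L)
    (h0 : form p q x u = 0) :
    projM u u' x ∈ dualM L u u' := by
  refine ⟨mem_dual.2 fun l hl => ?_, H.form_projM _, H.form_projM' _⟩
  obtain ⟨n, hn⟩ := exists_form_int hx hl.1
  refine ⟨n, ?_⟩
  rw [projM_of_form_eq_zero u' h0, map_sub, LinearMap.sub_apply, hn, map_smul,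
    LinearMap.smul_apply, form_comm u l, hl.2.1]
  simp

/-- The chosen representative differs from x by some l ∈ L with (l,u) = nN; the ζ-term in π
subtracts the projection of nζ, and l - nζ ∈ L ∩ u^⊥ projects into M. -/
theorem liesOver_mk (H : IsotropicData L u u' ζ N) {x : dual L} (h0 : form p q x u = 0) :
    LiesOver L u u' ζ N (Submodule.Quotient.mk x) (projM u u' x) := by
  have hl := rep_mk_sub_mem (A := L) x
  set l := rep (Submodule.Quotient.mk x : Quo (dual L) L) - (x : Vpq p q) with hldef
  have hr : rep (Submodule.Quotient.mk x : Quo (dual L) L) = x + l := by rw [hldef]; abel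
  obtain ⟨n, hn⟩ := H.dvd l hl
  have hN : (N : ℝ) ≠ 0 := by exact_mod_cast H.pos.ne'
  have hf : form p q (x + l) u = n * N := by rw [map_add, LinearMap.add_apply, h0, hn, zero_add]
  refine ⟨⟨n, by rw [hr, hf]⟩, ?_⟩
  rw [hr, piM, hf, projM_add, mul_div_cancel_right₀ _ hN, ← projM_smul]
  have : projM u u' x + projM u u' l - projM u u' ((n : ℝ) • ζ) - projM u u' x =
      projM u u' (l - (n : ℝ) • ζ) := by rw [projM_sub u u' l]; abel
  rw [this, Int.cast_smul_eq_zsmul]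
  refine H.projM_mem_latM (L.sub_mem hl (L.smul_mem _ H.zeta_mem)) ?_
  rw [map_sub, LinearMap.sub_apply, hn, map_zsmul, LinearMap.smul_apply, H.zeta_form]
  simp

/-- Subtracting mζ and an element of M keeps the class in L'/L and moves the representative into
u^⊥. So the classes over y are those represented in L' ∩ u^⊥ by vectors projecting to y. -/
theorem exists_of_liesOver (H : IsotropicData L u u' ζ N) {δ : Quo (dual L) L} {y : Vpq p q}
    (h : LiesOver L u u' ζ N δ y) :
    ∃ x : dual L, form p q x u = 0 ∧ Submodule.Quotient.mk x = δ ∧ projM u u' x = y := by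
  obtain ⟨⟨m, hm⟩, hl⟩ := h
  have hN : (N : ℝ) ≠ 0 := by exact_mod_cast H.pos.ne'
  set l := piM u u' ζ N (rep δ) - y with hldef
  have hmem : m • ζ + l ∈ L := L.add_mem (L.smul_mem _ H.zeta_mem) hl.1
  refine ⟨⟨rep δ - (m • ζ + l), (dual L).sub_mem (rep_mem δ) (H.even.le_dual hmem)⟩, ?_, ?_, ?_⟩
  · simp only [map_sub, LinearMap.sub_apply, map_add, LinearMap.add_apply, hm, map_zsmul,
      LinearMap.smul_apply, H.zeta_form, hl.2.1]
    simp
  · conv_rhs => rw [← mk_rep δ]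
    rw [quo_mk_eq_iff]
    simpa using L.neg_mem hmem
  · simp only
    rw [projM_sub, projM_add, projM_of_mem_latM hl, ← Int.cast_smul_eq_zsmul ℝ, projM_smul, hldef,
      piM, hm, mul_div_cancel_right₀ _ hN]
    abel

end IsotropicData

/-- The pairs `(y,δ)` with `δ ∈ L'_0/L` over `y ∈ M'`. -/
abbrev OverIdx (L : Submodule ℤ (Vpq p q)) (u u' ζ : Vpq p q) (N : ℕ) :=
  {z : dualM L u u' × Quo (dual L) L // LiesOver L u u' ζ N z.2 z.1}

/-- `L' ∩ u^⊥`. -/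
abbrev DualPerp (L : Submodule ℤ (Vpq p q)) (u : Vpq p q) := {x : dual L // form p q x u = 0}

namespace IsotropicData

variable (H : IsotropicData L u (u' := u') (ζ := ζ) (N := N))

/-- A representative in `L' ∩ u^⊥` of a class in `(L' ∩ u^⊥)/ℤu`. -/
def lift (z : OverIdx L u u' ζ N) : DualPerp L u :=
  ⟨(H.exists_of_liesOver z.2).choose, (H.exists_of_liesOver z.2).choose_spec.1⟩

theorem mk_lift (z : OverIdx L u u' ζ N) :
    (Submodule.Quotient.mk (H.lift z).1 : Quo (dual L) L) = z.1.2 :=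
  (H.exists_of_liesOver z.2).choose_spec.2.1

theorem projM_lift (z : OverIdx L u u' ζ N) : projM u u' (H.lift z).1 = z.1.1 :=
  (H.exists_of_liesOver z.2).choose_spec.2.2

/-- `x + nu`. -/
def addU (x : DualPerp L u) (n : ℤ) : DualPerp L u :=
  ⟨x.1 + n • ⟨u, H.even.le_dual H.mem⟩, by
    simp only [Submodule.coe_add, Submodule.coe_smul, map_add, LinearMap.add_apply, x.2, map_zsmul,
      LinearMap.smul_apply, H.iso, smul_zero, add_zero]⟩

theorem coe_addU (x : DualPerp L u) (n : ℤ) :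
    ((H.addU x n).1 : Vpq p q) = (x.1 : Vpq p q) + (n : ℝ) • u := by
  simp [addU, Int.cast_smul_eq_zsmul]

theorem mk_addU (x : DualPerp L u) (n : ℤ) :
    (Submodule.Quotient.mk (H.addU x n).1 : Quo (dual L) L) = Submodule.Quotient.mk x.1 := by
  rw [quo_mk_eq_iff, coe_addU, Int.cast_smul_eq_zsmul]
  simpa using L.smul_mem _ H.mem

theorem projM_addU (x : DualPerp L u) (n : ℤ) :
    projM u u' (H.addU x n).1 = projM u u' x.1 := by
  have : projM u u' u = 0 := by
    rw [projM_of_form_eq_zero u' H.iso, H.form']; simp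
  rw [coe_addU, projM_add, projM_smul, this]
  simp

/-- L' ∩ u^⊥ is a disjoint union of translates of ℤu, separated by the projection to M' together
with the class modulo L. -/
theorem bijective_lift :
    Function.Bijective fun z : OverIdx L u u' ζ N × ℤ => H.addU (H.lift z.1) z.2 := by
  constructor
  · rintro ⟨z, n⟩ ⟨z', n'⟩ h
    simp only at h
    have h1 : z = z' := by
      apply Subtype.ext
      apply Prod.ext
      · apply Subtype.ext
        rw [← H.projM_lift, ← H.projM_lift, ← H.projM_addU _ n, h, H.projM_addU]
      · rw [← H.mk_lift, ← H.mk_lift, ← H.mk_addU _ n, h, H.mk_addU]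
    subst h1
    have h2 := congrArg (fun x : DualPerp L u => (x.1 : Vpq p q)) h
    simp only [coe_addU, add_right_inj] at h2
    have h3 := smul_left_injective ℝ H.ne_zero h2
    simp only [Int.cast_inj] at h3
    rw [h3]
  · intro x
    set z : OverIdx L u u' ζ N := ⟨(⟨projM u u' x.1, H.projM_mem_dualM x.1.2 x.2⟩,
      Submodule.Quotient.mk x.1), H.liesOver_mk x.2⟩ with hz
    have h1 := H.mk_lift z
    have h2 := H.projM_lift z
    simp only [hz, quo_mk_eq_iff] at h1 h2
    rw [← hz] at h1 h2
    -- d lies in L ∩ u^⊥ and projects to 0, so d = (d,u')u, and (d,u') is an integer.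
    set d : Vpq p q := (x.1 : Vpq p q) - (H.lift z).1 with hd
    have hdL : d ∈ L := by
      have := L.neg_mem h1
      rwa [neg_sub] at this
    obtain ⟨n, hn⟩ := H.exists_int_form_u' hdL
    have hd0 : form p q d u = 0 := by
      rw [hd, map_sub, LinearMap.sub_apply, x.2, (H.lift z).2, sub_zero]
    have hdM : projM u u' d = 0 := by rw [hd, projM_sub, h2, sub_self]
    rw [projM_of_form_eq_zero u' hd0, hn, sub_eq_zero] at hdM
    refine ⟨(z, n), ?_⟩
    apply Subtype.ext
    apply Subtype.ext
    simp only [coe_addU]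
    rw [← hdM, hd]
    abel

theorem hasSum_overIdx {Φ : DualPerp L u → ℂ} {A : ℂ} {B : OverIdx L u u' ζ N → ℂ}
    (hΦ : HasSum Φ A) (hB : ∀ z, HasSum (fun n => Φ (H.addU (H.lift z) n)) (B z)) :
    HasSum B A := by
  have h := (Equiv.ofBijective _ H.bijective_lift).hasSum_iff.2 hΦ
  exact h.prod_fiberwise hB

end IsotropicData

/-! ### Integration along `u` -/

theorem restrict_box {ι : Type*} [Fintype ι] :
    (volume : Measure (ι → ℝ)).restrict {x : ι → ℝ | ∀ i, x i ∈ Set.Ioc (0 : ℝ) (0 + 1)} =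
      Measure.pi fun _ => volume.restrict (Set.Ioc (0 : ℝ) (0 + 1)) := by
  rw [← Measure.restrict_pi_pi]
  congr 1
  ext x
  simp [Set.mem_pi]

/-- The Fourier integral of the Gaussian along the line `x + ℝu`. -/
def lineInt (α : Fin q → Fin p) (g : Vpq p q ≃ₗ[ℝ] Vpq p q) (u : Vpq p q) (t : ℕ) (τ : ℍ)
    (x : Vpq p q) : ℂ := ∫ b : ℝ, kerFn α g τ (x + b • u) * e ((-(t * b) : ℝ) : ℂ)

variable {α : Fin q → Fin p} {g : Vpq p q ≃ₗ[ℝ] Vpq p q}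

theorem integrable_line (α : Fin q → Fin p) (hg : IsSO g) (hu : u ≠ 0) (t : ℕ) (τ : ℍ)
    (x : Vpq p q) : Integrable fun b : ℝ => kerFn α g τ (x + b • u) * e ((-(t * b) : ℝ) : ℂ) := by
  obtain ⟨C, hC, h⟩ := exists_kerFn_decay α hg τ 2
  have hc := continuous_kerFn α hg τ
  have hu' : 0 < ‖u‖ := norm_pos_iff.2 hu
  refine integrable_of_decay (by fun_prop) (C := C * ((1 + 1 / ‖u‖) * (1 + ‖x‖)) ^ 2) fun b => ?_
  rw [norm_mul, norm_e_ofReal, mul_one]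
  have h1 : 1 + |b| ≤ (1 + ‖x + b • u‖) * ((1 + 1 / ‖u‖) * (1 + ‖x‖)) := by
    have h2 := one_add_norm_le (b • u) x
    rw [norm_smul, Real.norm_eq_abs, add_comm (b • u)] at h2
    have h3 : 1 + |b| ≤ (1 + 1 / ‖u‖) * (1 + |b| * ‖u‖) := by
      have : (1 + 1 / ‖u‖) * (1 + |b| * ‖u‖) = 1 + |b| + (|b| * ‖u‖ + 1 / ‖u‖) := by
        field_simp; ring
      rw [this]
      have : 0 ≤ |b| * ‖u‖ + 1 / ‖u‖ := by positivity
      linarith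
    calc _ ≤ _ := h3
      _ ≤ (1 + 1 / ‖u‖) * ((1 + ‖x + b • u‖) * (1 + ‖x‖)) := by gcongr
      _ = _ := by ring
  calc _ ≤ ((1 + ‖x + b • u‖) * ((1 + 1 / ‖u‖) * (1 + ‖x‖))) ^ 2 *
        (C / (1 + ‖x + b • u‖) ^ 2) := by gcongr; exact h _
    _ = _ := by rw [mul_pow]; field_simp

/-- The integral over a of e(a(x,u)) is 1 or 0 according as the integer (x,u) is zero or not. -/
theorem integral_box_charTerm (f : ℍ → GrpAlg (dual L) L) (α : Fin q → Fin p)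
    (g : Vpq p q ≃ₗ[ℝ] Vpq p q) (hu : u ∈ L) (τ : ℍ) (t : ℕ) (x : dual L) :
    ∫ v in {v : Fin 2 → ℝ | ∀ i, v i ∈ Set.Ioc (0 : ℝ) (0 + 1)},
      e ((-∑ i, (![0, (t : ℤ)] i : ℤ) * v i : ℝ) : ℂ) * charTerm f α g u τ v x =
    if form p q x u = 0 then f τ (Submodule.Quotient.mk x) *
      ∫ b in (0 : ℝ)..1, kerFn α g τ (x + b • u) * e ((-(t * b) : ℝ) : ℂ) else 0 := by
  obtain ⟨m, hm⟩ := exists_form_int x.2 hu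
  rw [restrict_box]
  have h1 : ∀ v : Fin 2 → ℝ, e ((-∑ i, (![0, (t : ℤ)] i : ℤ) * v i : ℝ) : ℂ) *
      charTerm f α g u τ v x = f τ (Submodule.Quotient.mk x) *
      ∏ i, (![fun a : ℝ => e ((m : ℂ) * a),
        fun b : ℝ => kerFn α g τ (x + b • u) * e ((-(t * b) : ℝ) : ℂ)] :
            Fin 2 → ℝ → ℂ) i (v i) := by
    intro v
    simp only [charTerm, Fin.sum_univ_two, Fin.prod_univ_two, Matrix.cons_val_zero,
      Matrix.cons_val_one, hm]
    push_cast
    simp only [zero_mul, zero_add]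
    ring_nf
  simp_rw [h1]
  rw [integral_const_mul, integral_fintype_prod_eq_prod (μ := fun _ : Fin 2 =>
    volume.restrict (Set.Ioc (0 : ℝ) (0 + 1)))]
  simp only [Fin.prod_univ_two, Matrix.cons_val_zero, Matrix.cons_val_one, zero_add]
  rw [← intervalIntegral.integral_of_le zero_le_one, ← intervalIntegral.integral_of_le zero_le_one,
    integral_e_int, hm]
  by_cases h0 : m = 0
  · simp [h0]
  · simp [h0]

theorem countable_dual [DiscreteTopology L] [IsZLattice ℝ L] (hL : IsEven L) :
    Countable (dual L) := by
  have := discreteTopology_dual L hL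
  exact TopologicalSpace.separableSpace_iff_countable.1 inferInstance

theorem hasSum_box [DiscreteTopology L] [IsZLattice ℝ L] (hL : IsEven L)
    (f : ℍ → GrpAlg (dual L) L) (α : Fin q → Fin p) (hg : IsSO g) (u : Vpq p q) (τ : ℍ)
    (n : Fin 2 → ℤ) :
    HasSum (fun x : dual L => ((τ.im ^ wt p q : ℝ) : ℂ) *
      ∫ v in {v : Fin 2 → ℝ | ∀ i, v i ∈ Set.Ioc (0 : ℝ) (0 + 1)},
        e ((-∑ i, n i * v i : ℝ) : ℂ) * charTerm f α g u τ v x) (charCoeff f α g u τ n) := by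
  have := finite_quo L hL
  have := countable_dual hL
  obtain ⟨N, -, hN⟩ := summable_dual hL
  obtain ⟨C, hC, h⟩ := exists_charTerm_bound f α hg u τ N
  have hker := continuous_kerFn α hg τ
  have hbox : MeasurableSet {v : Fin 2 → ℝ | ∀ i, v i ∈ Set.Ioc (0 : ℝ) (0 + 1)} := by
    have : {v : Fin 2 → ℝ | ∀ i, v i ∈ Set.Ioc (0 : ℝ) (0 + 1)} =
        Set.univ.pi fun _ => Set.Ioc (0 : ℝ) (0 + 1) := by ext; simp [Set.mem_pi]
    rw [this]
    exact MeasurableSet.univ_pi fun _ => measurableSet_Ioc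
  have hfin : IsFiniteMeasure ((volume : Measure (Fin 2 → ℝ)).restrict
      {v : Fin 2 → ℝ | ∀ i, v i ∈ Set.Ioc (0 : ℝ) (0 + 1)}) := by
    rw [restrict_box]; infer_instance
  have heq : charCoeff f α g u τ n = ((τ.im ^ wt p q : ℝ) : ℂ) *
      ∫ v in {v : Fin 2 → ℝ | ∀ i, v i ∈ Set.Ioc (0 : ℝ) (0 + 1)},
        e ((-∑ i, n i * v i : ℝ) : ℂ) * ∑' x : dual L, charTerm f α g u τ v x := by
    rw [charCoeff, ← integral_const_mul]
    simp only [charKernel]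
    congr 1
    ext v
    ring
  rw [heq]
  refine HasSum.mul_left _ ?_
  refine hasSum_integral_of_dominated_convergence
    (fun (x : dual L) _ => C * (1 + 1 * ‖u‖) ^ N * (1 / (1 + ‖(x : Vpq p q)‖) ^ N)) (fun x => ?_)
    (fun x => ?_) ?_ ?_ ?_
  · refine Continuous.aestronglyMeasurable ?_
    unfold charTerm
    fun_prop
  · refine ae_restrict_of_forall_mem hbox fun v hv => ?_
    rw [norm_mul, norm_e_ofReal, one_mul]
    refine (h v x).trans ?_
    have := hv 1
    gcongr
    rw [abs_of_pos this.1]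
    simpa using this.2
  · exact Filter.Eventually.of_forall fun _ => hN.mul_left _
  · exact integrable_const _
  · exact Filter.Eventually.of_forall fun v => (summable_charTerm hL f α hg u τ v).hasSum.mul_left _

theorem hasSum_overIdx_charCoeff [DiscreteTopology L] [IsZLattice ℝ L]
    (H : IsotropicData L u u' ζ N) (f : ℍ → GrpAlg (dual L) L) (α : Fin q → Fin p) (hg : IsSO g)
    (τ : ℍ) (t : ℕ) :
    HasSum (fun z : OverIdx L u u' ζ N => ((τ.im ^ wt p q : ℝ) : ℂ) *
      (f τ z.1.2 * lineInt α g u t τ (H.lift z).1)) (charCoeff f α g u τ ![0, (t : ℤ)]) := by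
  classical
  have h := hasSum_box H.even f α hg u τ ![0, (t : ℤ)]
  simp_rw [integral_box_charTerm f α g H.mem τ t] at h
  have h2 := (hasSum_subtype_iff_of_support_subset (s := {x : dual L | form p q x u = 0})
    (by
      intro x hx
      by_contra h0
      simp only [Set.mem_ofPred_eq] at h0
      simp [h0] at hx)).2 h
  refine H.hasSum_overIdx h2 fun z => ?_
  refine HasSum.mul_left _ ?_
  -- The unit intervals belonging to x + nu, n ∈ ℤ, fit together to the whole line; e(-tb) is
  -- unchanged by integral shifts of b.
  have h3 := (integrable_line α hg H.ne_zero t τ (H.lift z).1).hasSum_intervalIntegral_comp_add_int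
  refine (h3.mul_left (f τ z.1.2)).congr_fun fun n => ?_
  have hz := (H.addU (H.lift z) n).2
  simp only [hz, if_true]
  rw [H.mk_addU, H.mk_lift]
  congr 1
  refine intervalIntegral.integral_congr fun b _ => ?_
  simp only [H.coe_addU]
  have e1 : ((H.lift z).1 : Vpq p q) + (n : ℝ) • u + b • u = (H.lift z).1 + (b + n) • u := by
    rw [add_smul]; abel
  rw [e1]
  congr 1
  have : ((-(t * b) : ℝ) : ℂ) = ((-(t * (b + n)) : ℝ) : ℂ) + ((t * n : ℤ) : ℂ) := by
    push_cast; ring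
  rw [this, e_add_int]

end

section

variable {p q : ℕ}
variable {L : Submodule ℤ (Vpq p q)} {u u' ζ : Vpq p q} {N : ℕ} {f : ℍ → GrpAlg (dual L) L}
variable {α : Fin q → Fin p} {g : Vpq p q ≃ₗ[ℝ] Vpq p q}

/-! ### The Fourier coefficients of index `(0,t)` -/

theorem form_projZperp_left (hg : IsSO g) (v w : Vpq p q) :
    form p q (projZperp g v) (projZperp g w) = form p q v (projZperp g w) := by
  conv_rhs => rw [← projZperp_add_projZ g v]
  rw [map_add, LinearMap.add_apply, form_comm (projZ g v), form_projZperp_projZ hg, add_zero]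

theorem form_projZ_left (hg : IsSO g) (v w : Vpq p q) :
    form p q (projZ g v) (projZ g w) = form p q v (projZ g w) := by
  conv_rhs => rw [← projZperp_add_projZ g v]
  rw [map_add, LinearMap.add_apply, form_projZperp_projZ hg, zero_add]

theorem qf_projZperp_eq_add (hg : IsSO g) (h : normZperp g u ≠ 0) (v : Vpq p q) :
    qf (projZperp g v) = qf (projWperp g u v) +
      form p q v (projZperp g u) ^ 2 / (2 * normZperp g u) := by
  have h1 : form p q (projZperp g u) (projZperp g u) = normZperp g u := rfl
  simp only [qf, projWperp, map_sub, map_smul, LinearMap.sub_apply, LinearMap.smul_apply,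
    smul_eq_mul, form_comm (projZperp g u) (projZperp g v), form_projZperp_left hg v u, h1]
  field_simp
  ring

theorem qf_projZ_eq_add (hg : IsSO g) (h : normZ g u ≠ 0) (v : Vpq p q) :
    qf (projZ g v) = qf (projW g u v) + form p q v (projZ g u) ^ 2 / (2 * normZ g u) := by
  have h1 : form p q (projZ g u) (projZ g u) = normZ g u := rfl
  simp only [qf, projW, map_sub, map_smul, LinearMap.sub_apply, LinearMap.smul_apply,
    smul_eq_mul, form_comm (projZ g u) (projZ g v), form_projZ_left hg v u, h1]
  field_simp
  ring

theorem projZperp_add (g : Vpq p q ≃ₗ[ℝ] Vpq p q) (v w : Vpq p q) :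
    projZperp g (v + w) = projZperp g v + projZperp g w := by
  apply g.injective
  simp only [map_add, apply_projZperp]
  ext i; cases i <;> simp [basePos]

theorem projZperp_smul (g : Vpq p q ≃ₗ[ℝ] Vpq p q) (c : ℝ) (v : Vpq p q) :
    projZperp g (c • v) = c • projZperp g v := by
  apply g.injective
  simp only [map_smul, apply_projZperp]
  ext i; cases i <;> simp [basePos]

theorem projZ_eq_sub (g : Vpq p q ≃ₗ[ℝ] Vpq p q) (v : Vpq p q) :
    projZ g v = v - projZperp g v := by
  conv_rhs => rw [← projZperp_add_projZ g v]
  rw [projZperp_add_projZ]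
  exact (eq_sub_of_add_eq' (projZperp_add_projZ g v))

theorem form_self_projZperp (hg : IsSO g) (u : Vpq p q) :
    form p q u (projZperp g u) = normZperp g u := by
  rw [normZperp, form_projZperp_left hg]

theorem form_projZ_eq (g : Vpq p q ≃ₗ[ℝ] Vpq p q) (x u : Vpq p q) :
    form p q x (projZ g u) = form p q x u - form p q x (projZperp g u) := by
  rw [projZ_eq_sub, map_sub]

theorem projWperp_add_smul (hg : IsSO g) (h : normZperp g u ≠ 0) (x : Vpq p q) (b : ℝ) :
    projWperp g u (x + b • u) = projWperp g u x := by
  simp only [projWperp, projZperp_add, projZperp_smul, map_add, map_smul, LinearMap.add_apply,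
    LinearMap.smul_apply, smul_eq_mul, form_self_projZperp hg, add_div, mul_div_assoc, div_self h,
    mul_one, add_smul]
  abel

theorem projW_add_smul (hg : IsSO g) (hu0 : form p q u u = 0) (h : normZperp g u ≠ 0)
    (x : Vpq p q) (b : ℝ) : projW g u (x + b • u) = projW g u x := by
  have h1 : projZ g (x + b • u) = projZ g x + b • projZ g u := by
    simp only [projZ_eq_sub, projZperp_add, projZperp_smul, smul_sub]
    abel
  have h2 : form p q (x + b • u) (projZ g u) / normZ g u =
      form p q x (projZ g u) / normZ g u + b := by
    rw [map_add, LinearMap.add_apply, map_smul, LinearMap.smul_apply, form_projZ_eq g u u, hu0,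
      form_self_projZperp hg, normZ_eq_neg hg hu0, smul_eq_mul]
    field_simp
    ring
  rw [projW, projW, h1, h2, add_smul]
  abel

/-- The part of the Gaussian that depends on `τ` and on the projection to `w ⊕ w^⊥`. -/
def wKer (α : Fin q → Fin p) (g : Vpq p q ≃ₗ[ℝ] Vpq p q) (u : Vpq p q) (t : ℕ) (τ : ℍ)
    (x : Vpq p q) : ℂ :=
  (Real.exp (-(Real.pi * t ^ 2 / (2 * τ.im * normZperp g u))) : ℂ) *
    (∑ h ∈ Finset.range (q + 1), ((t : ℂ) / (2 * Complex.I * τ.im)) ^ h *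
      (expLap τ.im (redPoly (polyP α) g u h) (gSharp g u x) : ℂ)) *
    e (-(starRingEnd ℂ (τ : ℂ) * (qf (projWperp g u x) : ℝ)) - (τ : ℂ) * (qf (projW g u x) : ℝ))

theorem wKer_add_smul (hg : IsSO g) (hu0 : form p q u u = 0) (h : normZperp g u ≠ 0) (t : ℕ)
    (τ : ℍ) (x : Vpq p q) (b : ℝ) : wKer α g u t τ (x + b • u) = wKer α g u t τ x := by
  simp only [wKer, gSharp_add_smul_self hg hu0 h, projWperp_add_smul hg h,
    projW_add_smul hg hu0 h]

/-- The w- and w^⊥-components are constant along the line. For x ⊥ u the pairings with u_z and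
u_{z^⊥} are opposite, and the two squares combine into one real Gaussian in s = (x,u_{z^⊥}) + b
u_{z^⊥}². -/
theorem kerFn_line (hg : IsSO g) (hu0 : form p q u u = 0) (ha : 0 < normZperp g u) (τ : ℍ)
    {x : Vpq p q} (hx : form p q x u = 0) (b : ℝ) :
    kerFn α g τ (x + b • u) =
      e (-(starRingEnd ℂ (τ : ℂ) * (qf (projWperp g u x) : ℝ)) -
        (τ : ℂ) * (qf (projW g u x) : ℝ)) *
      ∑ h ∈ Finset.range (q + 1), (expLap τ.im (redPoly (polyP α) g u h) (gSharp g u x) : ℂ) *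
        (hn ((normZperp g u / (4 * Real.pi * τ.im) : ℝ) : ℂ)
          ((form p q x (projZperp g u) + normZperp g u * b : ℝ) : ℂ) h *
        Complex.exp (-Real.pi * ((2 * τ.im / normZperp g u : ℝ) : ℂ) *
          ((form p q x (projZperp g u) + normZperp g u * b : ℝ) : ℂ) ^ 2)) := by
  have hz := normZ_eq_neg hg hu0
  have hz' : normZ g u ≠ 0 := by rw [hz]; exact neg_ne_zero.2 ha.ne'
  have hfz : form p q (x + b • u) (projZperp g u) =
      form p q x (projZperp g u) + normZperp g u * b := by
    rw [map_add, LinearMap.add_apply, map_smul, LinearMap.smul_apply, form_self_projZperp hg,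
      smul_eq_mul, mul_comm]
  have hfz' : form p q (x + b • u) (projZ g u) =
      -(form p q x (projZperp g u) + normZperp g u * b) := by
    rw [form_projZ_eq, hfz, map_add, LinearMap.add_apply, map_smul, LinearMap.smul_apply, hu0, hx]
    simp
  rw [kerFn, expLap_polyP_apply α hg ha.ne' hz', qf_projZperp_eq_add hg ha.ne',
    qf_projZ_eq_add hg hz', projWperp_add_smul hg ha.ne', projW_add_smul hg hu0 ha.ne', hfz, hfz',
    gSharp_add_smul_self hg hu0 ha.ne', hz]
  set s := form p q x (projZperp g u) + normZperp g u * b with hs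
  have ha' : (normZperp g u : ℂ) ≠ 0 := by exact_mod_cast ha.ne'
  have hdiff : (τ : ℂ) - starRingEnd ℂ (τ : ℂ) = 2 * τ.im * Complex.I := by
    rw [Complex.sub_conj]; push_cast; rfl
  have h1 : e (-(starRingEnd ℂ (τ : ℂ) * ((qf (projWperp g u x) +
        s ^ 2 / (2 * normZperp g u) : ℝ) : ℂ)) -
      (τ : ℂ) * ((qf (projW g u x) + (-s) ^ 2 / (2 * -normZperp g u) : ℝ) : ℂ)) =
      e (-(starRingEnd ℂ (τ : ℂ) * (qf (projWperp g u x) : ℝ)) -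
        (τ : ℂ) * (qf (projW g u x) : ℝ)) *
      Complex.exp (-Real.pi * ((2 * τ.im / normZperp g u : ℝ) : ℂ) * (s : ℂ) ^ 2) := by
    rw [e, e, ← Complex.exp_add]
    congr 1
    push_cast
    field_simp
    linear_combination (Complex.I * (s : ℂ) ^ 2 : ℂ) * hdiff +
      (2 * τ.im * (s : ℂ) ^ 2 : ℂ) * Complex.I_sq
  rw [h1]
  push_cast
  simp only [Finset.sum_mul, Finset.mul_sum, ofReal_hn]
  refine Finset.sum_congr rfl fun h _ => ?_
  push_cast
  ring

theorem one_div_cpow_half {r : ℝ} (hr : 0 < r) :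
    1 / (r : ℂ) ^ (1 / 2 : ℂ) = ((1 / Real.sqrt r : ℝ) : ℂ) := by
  rw [Real.sqrt_eq_rpow, Complex.ofReal_div, Complex.ofReal_cpow hr.le]
  norm_num

theorem lineInt_eq (hg : IsSO g) (hu0 : form p q u u = 0) (ha : 0 < normZperp g u) (t : ℕ) (τ : ℍ)
    {x : Vpq p q} (hx : form p q x u = 0) :
    lineInt α g u t τ x = ((1 / Real.sqrt (2 * normZperp g u * τ.im) : ℝ) : ℂ) *
      e ((t * (form p q x (projZperp g u) / normZperp g u) : ℝ) : ℂ) * wKer α g u t τ x := by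
  set a := normZperp g u with hadef
  set c := form p q x (projZperp g u) with hc
  have hy := τ.im_pos
  have ha' : (a : ℂ) ≠ 0 := by exact_mod_cast ha.ne'
  have hy' : (τ.im : ℂ) ≠ 0 := by exact_mod_cast hy.ne'
  have hpi : (Real.pi : ℂ) ≠ 0 := by exact_mod_cast Real.pi_ne_zero
  have hb : 0 < (((2 * τ.im / a : ℝ) : ℂ)).re := by rw [Complex.ofReal_re]; positivity
  set F : ℝ → ℂ := fun s => ∑ h ∈ Finset.range (q + 1),
    (expLap τ.im (redPoly (polyP α) g u h) (gSharp g u x) : ℂ) *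
      (hn ((a / (4 * Real.pi * τ.im) : ℝ) : ℂ) (s : ℂ) h *
      Complex.exp (-Real.pi * ((2 * τ.im / a : ℝ) : ℂ) * (s : ℂ) ^ 2 -
        2 * Real.pi * Complex.I * ((t / a : ℝ) : ℂ) * s)) with hF
  have h1 : ∀ b : ℝ, kerFn α g τ (x + b • u) * e ((-(t * b) : ℝ) : ℂ) =
      (e (-(starRingEnd ℂ (τ : ℂ) * (qf (projWperp g u x) : ℝ)) -
        (τ : ℂ) * (qf (projW g u x) : ℝ)) * e ((t * (c / a) : ℝ) : ℂ)) * F (c + a * b) := by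
    intro b
    rw [kerFn_line hg hu0 ha τ hx, hF]
    simp only [Finset.mul_sum, Finset.sum_mul]
    refine Finset.sum_congr rfl fun h _ => ?_
    have h2 : Complex.exp (-Real.pi * ((2 * τ.im / a : ℝ) : ℂ) * ((c + a * b : ℝ) : ℂ) ^ 2 -
        2 * Real.pi * Complex.I * ((t / a : ℝ) : ℂ) * ((c + a * b : ℝ) : ℂ)) *
        e ((t * (c / a) : ℝ) : ℂ) =
        Complex.exp (-Real.pi * ((2 * τ.im / a : ℝ) : ℂ) * ((c + a * b : ℝ) : ℂ) ^ 2) *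
        e ((-(t * b) : ℝ) : ℂ) := by
      rw [e, e, ← Complex.exp_add, ← Complex.exp_add]
      congr 1
      push_cast
      field_simp
      ring
    linear_combination (-e (-(starRingEnd ℂ (τ : ℂ) * (qf (projWperp g u x) : ℝ)) -
        (τ : ℂ) * (qf (projW g u x) : ℝ)) *
        (expLap τ.im (redPoly (polyP α) g u h) (gSharp g u x) : ℂ) *
        hn ((a / (4 * Real.pi * τ.im) : ℝ) : ℂ) ((c + a * b : ℝ) : ℂ) h) * h2
  have h3 : ∫ s, F s = ((1 / Real.sqrt (2 * τ.im / a) : ℝ) : ℂ) *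
      (Real.exp (-(Real.pi * t ^ 2 / (2 * τ.im * a))) : ℂ) *
      ∑ h ∈ Finset.range (q + 1), ((t : ℂ) / (2 * Complex.I * τ.im)) ^ h *
        (expLap τ.im (redPoly (polyP α) g u h) (gSharp g u x) : ℂ) := by
    rw [hF, integral_finsetSum _ fun h _ => (integrable_hn_gaussian hb _ _ _).const_mul _,
      Finset.mul_sum]
    refine Finset.sum_congr rfl fun h _ => ?_
    rw [integral_const_mul, integral_hn_gaussian hb, one_div_cpow_half (by positivity)]
    -- The heat operator's variance a/(4πy) is exactly the one removed by the Fourier transform of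
    -- this Gaussian, so the Hermite polynomials become monomials.
    have e1 : ((a / (4 * Real.pi * τ.im) : ℝ) : ℂ) -
        1 / (2 * Real.pi * ((2 * τ.im / a : ℝ) : ℂ)) = 0 := by
      push_cast
      field_simp
      ring
    have e2 : -Complex.I * ((t / a : ℝ) : ℂ) / ((2 * τ.im / a : ℝ) : ℂ) =
        (t : ℂ) / (2 * Complex.I * τ.im) := by
      push_cast
      field_simp
      simp
    have e3 : -Real.pi * ((t / a : ℝ) : ℂ) ^ 2 / ((2 * τ.im / a : ℝ) : ℂ) =
        ((-(Real.pi * t ^ 2 / (2 * τ.im * a)) : ℝ) : ℂ) := by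
      push_cast
      field_simp
    rw [e1, e2, e3, hn_zero_left, ← Complex.ofReal_exp]
    ring
  have h4 : ∫ b, F (c + a * b) = ((1 / a : ℝ) : ℂ) * ∫ s, F s := by
    rw [Measure.integral_comp_mul_left (fun s => F (c + s)) a, integral_add_left_eq_self F c,
      abs_of_pos (inv_pos.2 ha), Complex.real_smul, one_div]
  have h5 : 1 / a * (1 / Real.sqrt (2 * τ.im / a)) = 1 / Real.sqrt (2 * a * τ.im) := by
    have : 2 * a * τ.im = a ^ 2 * (2 * τ.im / a) := by field_simp
    rw [this, Real.sqrt_mul (sq_nonneg a), Real.sqrt_sq ha.le]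
    field_simp
  rw [lineInt]
  simp_rw [h1]
  rw [integral_const_mul, h4, h3, wKer, ← h5, ← hadef]
  push_cast
  ring

/-- The summand, indexed by `y ∈ M'`, of the Fourier coefficient of index `(0,t)`. -/
def unfTerm (L : Submodule ℤ (Vpq p q)) (u u' ζ : Vpq p q) (N : ℕ) (f : ℍ → GrpAlg (dual L) L)
    (α : Fin q → Fin p) (g : Vpq p q ≃ₗ[ℝ] Vpq p q) (t : ℕ) (τ : ℍ) (y : Vpq p q) : ℂ :=
  ((τ.im ^ wt p q / Real.sqrt (2 * normZperp g u * τ.im) : ℝ) : ℂ) *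
    (∑ᶠ (δ : Quo (dual L) L) (_ : LiesOver L u u' ζ N δ y),
      e ((t * form p q (rep δ) u' : ℝ) : ℂ) * f τ δ) *
    e ((t * form p q y (mu g u u') : ℝ) : ℂ) * wKer α g u t τ y

/-- The phase of the line integral depends on the lift x. This splits it into a part depending on
the projection to M' only and (x,u'), which modulo ℤ depends on the class of x only. -/
theorem form_mu (H : IsotropicData L u u' ζ N) (hg : IsSO g) {x : Vpq p q}
    (hx : form p q x u = 0) :
    form p q (projM u u' x) (mu g u u') =
      form p q x (projZperp g u) / normZperp g u - form p q x u' := by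
  have ha := normZperp_pos hg H.iso H.ne_zero
  rw [mu, map_add, map_add, map_neg, H.form_projM', map_smul, map_smul, normZ_eq_neg hg H.iso,
    form_projZ_eq, H.form_projM, projM_of_form_eq_zero u' hx, map_sub, LinearMap.sub_apply,
    map_smul, LinearMap.smul_apply, form_self_projZperp hg]
  simp only [smul_eq_mul]
  field_simp
  ring

theorem finsum_prop_eq_sum_ite {ι M : Type*} [AddCommMonoid M] [Fintype ι] (P : ι → Prop)
    [DecidablePred P] (F : ι → M) : ∑ᶠ (i : ι) (_ : P i), F i = ∑ i, if P i then F i else 0 := by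
  rw [finsum_eq_sum_of_fintype]
  exact Finset.sum_congr rfl fun i _ => finsum_eq_if

theorem hasSum_charCoeff_unfTerm [DiscreteTopology L] [IsZLattice ℝ L]
    (H : IsotropicData L u u' ζ N) (f : ℍ → GrpAlg (dual L) L) (α : Fin q → Fin p) (hg : IsSO g)
    (τ : ℍ) (t : ℕ) :
    HasSum (fun y : dualM L u u' => unfTerm L u u' ζ N f α g t τ y)
      (charCoeff f α g u τ ![0, (t : ℤ)]) := by
  classical
  have := finite_quo L H.even
  have := Fintype.ofFinite (Quo (dual L) L)
  have ha := normZperp_pos hg H.iso H.ne_zero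
  have h := hasSum_overIdx_charCoeff H f α hg τ t
  have h1 : ∀ z : OverIdx L u u' ζ N, ((τ.im ^ wt p q : ℝ) : ℂ) *
      (f τ z.1.2 * lineInt α g u t τ (H.lift z).1) =
      ((τ.im ^ wt p q / Real.sqrt (2 * normZperp g u * τ.im) : ℝ) : ℂ) *
      (e ((t * form p q (rep z.1.2) u' : ℝ) : ℂ) * f τ z.1.2) *
      e ((t * form p q z.1.1 (mu g u u') : ℝ) : ℂ) * wKer α g u t τ z.1.1 := by
    intro z
    have hx := (H.lift z).2
    have hm := H.mk_lift z
    rw [lineInt_eq hg H.iso ha t τ hx]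
    have e1 := form_mu H hg hx
    have e2 : wKer α g u t τ z.1.1 = wKer α g u t τ (H.lift z).1 := by
      rw [← H.projM_lift z, projM_of_form_eq_zero u' hx, sub_eq_add_neg, ← neg_smul,
        wKer_add_smul hg H.iso ha.ne']
    rw [H.projM_lift] at e1
    -- The lift and the chosen representative differ by an element of L, so their pairings with u'
    -- differ by an integer; since t is an integer the phase agrees.
    have hr := rep_mk_sub_mem (A := L) (H.lift z).1
    rw [hm] at hr
    obtain ⟨n, hn⟩ := H.exists_int_form_u' hr
    have e3 : e ((t * (form p q (H.lift z).1 (projZperp g u) / normZperp g u) : ℝ) : ℂ) =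
        e ((t * form p q (rep z.1.2) u' : ℝ) : ℂ) *
        e ((t * form p q z.1.1 (mu g u u') : ℝ) : ℂ) := by
      rw [← e_add, e1]
      rw [map_sub, LinearMap.sub_apply] at hn
      have hn' : form p q (rep z.1.2) u' = form p q (H.lift z).1 u' + n := by linarith
      rw [hn', ← e_add_int _ (t * n)]
      congr 1
      push_cast
      ring
    rw [e3, e2]
    push_cast
    ring
  simp_rw [h1] at h
  set G : dualM L u u' × Quo (dual L) L → ℂ := fun z =>
      ((τ.im ^ wt p q / Real.sqrt (2 * normZperp g u * τ.im) : ℝ) : ℂ) *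
      (e ((t * form p q (rep z.2) u' : ℝ) : ℂ) * f τ z.2) *
      e ((t * form p q z.1 (mu g u u') : ℝ) : ℂ) * wKer α g u t τ z.1 with hG
  have h2 := (hasSum_subtype_iff_indicator (f := G)
    (s := {z | LiesOver L u u' ζ N z.2 z.1})).1 h
  refine h2.prod_fiberwise fun y => ?_
  have h3 := hasSum_fintype fun δ : Quo (dual L) L =>
    Set.indicator {z : dualM L u u' × Quo (dual L) L | LiesOver L u u' ζ N z.2 z.1} G (y, δ)
  convert h3 using 1
  rw [unfTerm, finsum_prop_eq_sum_ite]
  simp only [Finset.mul_sum, Finset.sum_mul]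
  refine Finset.sum_congr rfl fun δ _ => ?_
  by_cases hδ : LiesOver L u u' ζ N δ y
  · rw [Set.indicator_of_mem (by exact hδ), if_pos hδ]
  · rw [Set.indicator_of_notMem (by exact hδ), if_neg hδ]
    simp

end

section

variable {p q : ℕ}
variable {L : Submodule ℤ (Vpq p q)} {u u' ζ : Vpq p q} {N : ℕ} {f : ℍ → GrpAlg (dual L) L}
variable {α : Fin q → Fin p} {g : Vpq p q ≃ₗ[ℝ] Vpq p q}

/-! ### Bounds -/

theorem apply_projWperp_inr (g : Vpq p q ≃ₗ[ℝ] Vpq p q) (u x : Vpq p q) (i : Fin q) :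
    g (projWperp g u x) (Sum.inr i) = 0 := by
  simp [projWperp, apply_projZperp, basePos]

theorem apply_projW_inl (g : Vpq p q ≃ₗ[ℝ] Vpq p q) (u x : Vpq p q) (j : Fin p) :
    g (projW g u x) (Sum.inl j) = 0 := by
  simp [projW, apply_projZ, baseNeg]

theorem qf_projWperp_eq_sum (hg : IsSO g) (u x : Vpq p q) :
    qf (projWperp g u x) = (∑ j, gSharp g u x (Sum.inl j) ^ 2) / 2 := by
  rw [qf, ← hg.1]
  simp [form, gSharp, apply_projWperp_inr, apply_projW_inl, sq]

theorem qf_projW_eq_sum (hg : IsSO g) (u x : Vpq p q) :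
    qf (projW g u x) = -(∑ i, gSharp g u x (Sum.inr i) ^ 2) / 2 := by
  rw [qf, ← hg.1]
  simp [form, gSharp, apply_projWperp_inr, apply_projW_inl, sq]

theorem norm_e_projW (hg : IsSO g) (u x : Vpq p q) (τ : ℍ) :
    ‖e (-(starRingEnd ℂ (τ : ℂ) * (qf (projWperp g u x) : ℝ)) -
      (τ : ℂ) * (qf (projW g u x) : ℝ))‖ =
      Real.exp (-(Real.pi * τ.im * ∑ i, gSharp g u x i ^ 2)) := by
  rw [norm_e, qf_projWperp_eq_sum hg, qf_projW_eq_sum hg]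
  congr 2
  simp only [Complex.sub_im, Complex.neg_im, Complex.im_mul_ofReal, Complex.conj_im,
    UpperHalfPlane.coe_im, Fintype.sum_sum_type]
  ring

theorem exists_expLap_redPoly_bound (α : Fin q → Fin p) (g : Vpq p q ≃ₗ[ℝ] Vpq p q)
    (u : Vpq p q) : ∃ C > 0, ∃ A : ℕ, ∀ h ∈ Finset.range (q + 1), ∀ y > 0, ∀ x : Vpq p q,
      |expLap y (redPoly (polyP α) g u h) x| ≤ C * (1 + 1 / y) ^ A * (1 + ‖x‖) ^ A := by
  choose C hC A hA using fun h => exists_expLap_bound (redPoly (polyP α) g u h)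
  have hS0 : 0 < ∑ h ∈ Finset.range (q + 1), C h := Finset.sum_pos (fun h _ => hC h) (by simp)
  refine ⟨∑ h ∈ Finset.range (q + 1), C h, hS0,
    ∑ h ∈ Finset.range (q + 1), A h, fun h hh y hy x => (hA h y hy x).trans ?_⟩
  have h1 : C h ≤ ∑ h ∈ Finset.range (q + 1), C h :=
    Finset.single_le_sum (fun h _ => (hC h).le) hh
  set S := ∑ h ∈ Finset.range (q + 1), C h with hS
  have h2 : A h ≤ ∑ h ∈ Finset.range (q + 1), A h :=
    Finset.single_le_sum (f := A) (fun _ _ => Nat.zero_le _) hh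
  have h3 : (1 : ℝ) ≤ 1 + 1 / y := by
    have : 0 < 1 / y := by positivity
    linarith
  have h4 : (1 : ℝ) ≤ 1 + ‖x‖ := by linarith [norm_nonneg x]
  gcongr

theorem exists_wKer_bound (α : Fin q → Fin p) (hg : IsSO g) (ha : 0 < normZperp g u) (K : ℕ) :
    ∃ C > 0, ∃ A : ℕ, ∃ c > 0, ∀ (t : ℕ) (τ : ℍ) (x : Vpq p q), ‖wKer α g u t τ x‖ ≤
      C * (1 + 1 / τ.im) ^ A * (1 + τ.im) ^ A * Real.exp (-(c * (1 / τ.im) * (t : ℝ) ^ 2)) *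
        (1 / (1 + ‖gSharp g u x‖) ^ K) * (1 / (1 + (t : ℝ)) ^ 2) := by
  obtain ⟨C₁, hC₁, A₁, h₁⟩ := exists_expLap_redPoly_bound α g u
  obtain ⟨C₂, hC₂, h₂⟩ := exists_pow_mul_exp_bound_uniform (A₁ + K) Real.pi_pos
  set c : ℝ := Real.pi / (4 * normZperp g u) with hc
  have hcpos : 0 < c := by have := Real.pi_pos; positivity
  obtain ⟨C₃, hC₃, h₃⟩ := exists_pow_mul_exp_bound_uniform (q + 2) hcpos
  refine ⟨(q + 1) * C₁ * C₂ * C₃, by positivity, q + 2 + A₁ + (A₁ + K), c, hcpos,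
    fun t τ x => ?_⟩
  have hy := τ.im_pos
  set y := τ.im with hydef
  set r := ‖gSharp g u x‖ with hr
  have hr0 : 0 ≤ r := norm_nonneg _
  have ht0 : (0 : ℝ) ≤ t := Nat.cast_nonneg t
  have h2 := h₂ y hy r hr0
  have h3 := h₃ (1 / y) (by positivity) t ht0
  rw [one_div_one_div] at h3
  have hexp1 : Real.exp (-(Real.pi * y * ∑ i, gSharp g u x i ^ 2)) ≤
      Real.exp (-(Real.pi * y * r ^ 2)) := by
    apply Real.exp_le_exp.2
    have := mul_le_mul_of_nonneg_left (norm_sq_le_sum_sq (gSharp g u x))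
      (mul_pos Real.pi_pos hy).le
    linarith
  -- The Gaussian in t is halved: one half absorbs the powers of t, the other is kept to control y →
  -- 0.
  have hexp2 : Real.exp (-(Real.pi * (t : ℝ) ^ 2 / (2 * y * normZperp g u))) =
      Real.exp (-(c * (1 / y) * (t : ℝ) ^ 2)) * Real.exp (-(c * (1 / y) * (t : ℝ) ^ 2)) := by
    rw [← Real.exp_add, hc]
    congr 1
    field_simp
    ring
  have hsum : ‖∑ h ∈ Finset.range (q + 1), ((t : ℂ) / (2 * Complex.I * y)) ^ h *
      (expLap y (redPoly (polyP α) g u h) (gSharp g u x) : ℂ)‖ ≤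
      (q + 1) * ((1 + (t : ℝ)) ^ q * (1 + 1 / y) ^ q *
        (C₁ * (1 + 1 / y) ^ A₁ * (1 + r) ^ A₁)) := by
    refine (norm_sum_le _ _).trans ?_
    have : ∀ h ∈ Finset.range (q + 1), ‖((t : ℂ) / (2 * Complex.I * y)) ^ h *
        (expLap y (redPoly (polyP α) g u h) (gSharp g u x) : ℂ)‖ ≤
        (1 + (t : ℝ)) ^ q * (1 + 1 / y) ^ q * (C₁ * (1 + 1 / y) ^ A₁ * (1 + r) ^ A₁) := by
      intro h hh
      rw [norm_mul, Complex.norm_real, Real.norm_eq_abs, norm_pow]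
      gcongr
      · have e1 : ‖(t : ℂ) / (2 * Complex.I * y)‖ ≤ (1 + (t : ℝ)) * (1 + 1 / y) := by
          rw [norm_div, norm_mul, norm_mul, Complex.norm_I, Complex.norm_real, Real.norm_eq_abs,
            abs_of_pos hy, Complex.norm_natCast]
          simp only [Complex.norm_ofNat, mul_one]
          have : (t : ℝ) / (2 * y) ≤ t * (1 / y) := by
            rw [div_eq_mul_one_div]
            gcongr
            linarith
          have h5 : 0 < 1 / y := by positivity
          nlinarith
        calc _ ≤ ((1 + (t : ℝ)) * (1 + 1 / y)) ^ h := by gcongr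
          _ ≤ ((1 + (t : ℝ)) * (1 + 1 / y)) ^ q := by
            apply pow_le_pow_right₀
            · have h5 : 0 < 1 / y := by positivity
              nlinarith
            · have := Finset.mem_range.1 hh
              omega
          _ = _ := mul_pow _ _ _
      · exact h₁ h hh y hy _
    refine (Finset.sum_le_card_nsmul _ _ _ this).trans ?_
    rw [Finset.card_range, nsmul_eq_mul]
    push_cast
    exact le_refl _
  rw [wKer, norm_mul, norm_mul, norm_e_projW hg, Complex.norm_real, Real.norm_eq_abs,
    abs_of_pos (Real.exp_pos _), ← hydef, hexp2]
  calc _ ≤ (Real.exp (-(c * (1 / y) * (t : ℝ) ^ 2)) * Real.exp (-(c * (1 / y) * (t : ℝ) ^ 2))) *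
        ((q + 1) * ((1 + (t : ℝ)) ^ q * (1 + 1 / y) ^ q *
        (C₁ * (1 + 1 / y) ^ A₁ * (1 + r) ^ A₁))) * Real.exp (-(Real.pi * y * r ^ 2)) := by gcongr
    _ = (q + 1) * C₁ * (1 + 1 / y) ^ (q + A₁) * Real.exp (-(c * (1 / y) * (t : ℝ) ^ 2)) *
        (1 / (1 + r) ^ K) * (1 / (1 + (t : ℝ)) ^ 2) *
        ((1 + (t : ℝ)) ^ (q + 2) * Real.exp (-(c * (1 / y) * (t : ℝ) ^ 2))) *
        ((1 + r) ^ (A₁ + K) * Real.exp (-(Real.pi * y * r ^ 2))) := by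
      field_simp
      ring
    _ ≤ (q + 1) * C₁ * (1 + 1 / y) ^ (q + A₁) * Real.exp (-(c * (1 / y) * (t : ℝ) ^ 2)) *
        (1 / (1 + r) ^ K) * (1 / (1 + (t : ℝ)) ^ 2) *
        (C₃ * (1 + y) ^ (q + 2)) * (C₂ * (1 + 1 / y) ^ (A₁ + K)) := by gcongr
    _ = (q + 1) * C₁ * C₂ * C₃ * (1 + 1 / y) ^ (q + A₁ + (A₁ + K)) * (1 + y) ^ (q + 2) *
        Real.exp (-(c * (1 / y) * (t : ℝ) ^ 2)) *
        (1 / (1 + r) ^ K) * (1 / (1 + (t : ℝ)) ^ 2) := by ring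
    _ ≤ _ := by
      have h5 : (1 : ℝ) ≤ 1 + 1 / y := by
        have : 0 < 1 / y := by positivity
        linarith
      have h6 : (1 : ℝ) ≤ 1 + y := by linarith
      have h7 : (1 + 1 / y) ^ (q + A₁ + (A₁ + K)) ≤ (1 + 1 / y) ^ (q + 2 + A₁ + (A₁ + K)) :=
        pow_le_pow_right₀ h5 (by omega)
      have h8 : (1 + y) ^ (q + 2) ≤ (1 + y) ^ (q + 2 + A₁ + (A₁ + K)) :=
        pow_le_pow_right₀ h6 (by omega)
      gcongr

theorem rpow_le_pow_mul_pow {y : ℝ} (hy : 0 < y) {r : ℝ} {R : ℕ} (h : |r| ≤ R) :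
    y ^ r ≤ (1 + 1 / y) ^ R * (1 + y) ^ R := by
  have h5 : (1 : ℝ) ≤ 1 + 1 / y := by
    have : 0 < 1 / y := by positivity
    linarith
  have h6 : (1 : ℝ) ≤ 1 + y := by linarith
  have hr := abs_le.1 h
  rcases le_total 0 r with h0 | h0
  · calc y ^ r ≤ (1 + y) ^ r := Real.rpow_le_rpow hy.le (by linarith) h0
      _ ≤ (1 + y) ^ (R : ℝ) := Real.rpow_le_rpow_of_exponent_le h6 hr.2
      _ = (1 + y) ^ R := Real.rpow_natCast _ _
      _ ≤ _ := le_mul_of_one_le_left (by positivity) (one_le_pow₀ h5)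
  · calc y ^ r = (1 / y) ^ (-r) := by
          rw [one_div, Real.inv_rpow hy.le, Real.rpow_neg hy.le, inv_inv]
      _ ≤ (1 + 1 / y) ^ (-r) := Real.rpow_le_rpow (by positivity) (by linarith) (by linarith)
      _ ≤ (1 + 1 / y) ^ (R : ℝ) := Real.rpow_le_rpow_of_exponent_le h5 (by linarith)
      _ = (1 + 1 / y) ^ R := Real.rpow_natCast _ _
      _ ≤ _ := le_mul_of_one_le_right (by positivity) (one_le_pow₀ h6)

/-- Decay at the cusps `0` and `∞` beats all powers of `y`. -/
theorem exists_cusp_bound (A : ℕ) {c ε : ℝ} (hc : 0 < c) (hε : 0 < ε) :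
    ∃ C > 0, ∀ y > 0, ∀ t : ℕ, (1 ≤ t ∨ 1 / 2 ≤ y) →
      (1 + 1 / y) ^ A * (1 + y) ^ A * Real.exp (-(c * (1 / y) * (t : ℝ) ^ 2)) *
        Real.exp (-(ε * y)) ≤ C * (y ^ 2 * Real.exp (-(ε / 2 * y))) := by
  obtain ⟨C₁, hC₁, h₁⟩ := exists_pow_mul_exp_neg_bound (A + 2) hc
  obtain ⟨C₂, hC₂, h₂⟩ := exists_pow_mul_exp_neg_bound A (half_pos hε)
  refine ⟨(C₁ + 3 ^ (A + 2)) * C₂, by positivity, fun y hy t ht => ?_⟩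
  have h1 : (1 + 1 / y) ^ A * Real.exp (-(c * (1 / y) * (t : ℝ) ^ 2)) ≤
      (C₁ + 3 ^ (A + 2)) * y ^ 2 := by
    -- As (1+1/y)y ≥ 1, two extra powers of 1+1/y buy the factor y² that will cancel the density of
    -- dx dy/y².
    have h3 : (1 + 1 / y) ^ A ≤ (1 + 1 / y) ^ (A + 2) * y ^ 2 := by
      rw [pow_add, mul_assoc, ← mul_pow]
      refine le_mul_of_one_le_right (by positivity) (one_le_pow₀ ?_)
      have : (1 + 1 / y) * y = y + 1 := by field_simp
      linarith
    rcases ht with ht | ht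
    · have h4 : Real.exp (-(c * (1 / y) * (t : ℝ) ^ 2)) ≤ Real.exp (-(c * (1 / y))) := by
        apply Real.exp_le_exp.2
        have : (1 : ℝ) ≤ (t : ℝ) ^ 2 := one_le_pow₀ (by exact_mod_cast ht)
        have h5 : 0 < c * (1 / y) := by positivity
        nlinarith
      calc _ ≤ ((1 + 1 / y) ^ (A + 2) * y ^ 2) * Real.exp (-(c * (1 / y))) := by gcongr
        _ = ((1 + 1 / y) ^ (A + 2) * Real.exp (-(c * (1 / y)))) * y ^ 2 := by ring
        _ ≤ C₁ * y ^ 2 := by gcongr; exact h₁ (1 / y) (by positivity)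
        _ ≤ _ := by gcongr; linarith [show (0 : ℝ) < 3 ^ (A + 2) by positivity]
    · have h4 : Real.exp (-(c * (1 / y) * (t : ℝ) ^ 2)) ≤ 1 := by
        apply Real.exp_le_one_iff.2
        have : 0 ≤ c * (1 / y) * (t : ℝ) ^ 2 := by positivity
        linarith
      have h5 : 1 + 1 / y ≤ 3 := by
        have : 1 / y ≤ 2 := by
          rw [div_le_iff₀ hy]; linarith
        linarith
      calc _ ≤ ((1 + 1 / y) ^ (A + 2) * y ^ 2) * 1 := by gcongr
        _ ≤ (3 ^ (A + 2) * y ^ 2) * 1 := by gcongr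
        _ ≤ _ := by rw [mul_one]; gcongr; linarith
  have h2 := h₂ y hy.le
  have h3 : Real.exp (-(ε * y)) = Real.exp (-(ε / 2 * y)) * Real.exp (-(ε / 2 * y)) := by
    rw [← Real.exp_add]; congr 1; ring
  calc _ = ((1 + 1 / y) ^ A * Real.exp (-(c * (1 / y) * (t : ℝ) ^ 2))) *
        ((1 + y) ^ A * Real.exp (-(ε / 2 * y))) * Real.exp (-(ε / 2 * y)) := by rw [h3]; ring
    _ ≤ ((C₁ + 3 ^ (A + 2)) * y ^ 2) * C₂ * Real.exp (-(ε / 2 * y)) := by gcongr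
    _ = _ := by ring

/-- The three factors give integrability over the strip and summability over M' and over t. For t =
0 no Gaussian controls y → 0, so y is kept away from 0. -/
theorem exists_unfTerm_bound [DiscreteTopology L] [IsZLattice ℝ L]
    (H : IsotropicData L u u' ζ N) (hf : IsCuspForm L f) (α : Fin q → Fin p) (hg : IsSO g)
    (K : ℕ) : ∃ C > 0, ∃ ε > 0, ∀ (t : ℕ) (τ : ℍ) (x : Vpq p q), (1 ≤ t ∨ 1 / 2 ≤ τ.im) →
      ‖unfTerm L u u' ζ N f α g t τ x‖ ≤ C * (τ.im ^ 2 * Real.exp (-(ε * τ.im))) *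
        (1 / (1 + ‖gSharp g u x‖) ^ K) * (1 / (1 + (t : ℝ)) ^ 2) := by
  classical
  have := finite_quo L H.even
  have := Fintype.ofFinite (Quo (dual L) L)
  have ha := normZperp_pos hg H.iso H.ne_zero
  obtain ⟨C₁, hC₁, A₁, c, hc, h₁⟩ := exists_wKer_bound α hg ha K
  obtain ⟨C₂, hC₂, A₂, ε, hε, h₂⟩ := hf.exists_bound H.even
  obtain ⟨R, hR⟩ := exists_nat_ge |wt p q - 1 / 2|
  obtain ⟨C₃, hC₃, h₃⟩ := exists_cusp_bound (A₁ + A₂ + R) hc hε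
  set D : ℝ := 1 / Real.sqrt (2 * normZperp g u) with hD
  have hD0 : 0 < D := by positivity
  set M : ℝ := ((Fintype.card (Quo (dual L) L) : ℕ) : ℝ) with hM
  refine ⟨(D * (M + 1) * C₂ * C₁) * C₃, by positivity, ε / 2, by positivity,
    fun t τ x ht => ?_⟩
  have hy := τ.im_pos
  set y := τ.im with hydef
  have hpow : y ^ wt p q / Real.sqrt (2 * normZperp g u * y) ≤
      D * ((1 + 1 / y) ^ R * (1 + y) ^ R) := by
    have e1 : y ^ wt p q / Real.sqrt (2 * normZperp g u * y) = D * y ^ (wt p q - 1 / 2) := by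
      rw [Real.sqrt_mul (by positivity), Real.rpow_sub hy, ← Real.sqrt_eq_rpow, hD]
      field_simp
    rw [e1]
    gcongr
    exact rpow_le_pow_mul_pow hy hR
  have hsum : ‖∑ᶠ (δ : Quo (dual L) L) (_ : LiesOver L u u' ζ N δ x),
      e ((t * form p q (rep δ) u' : ℝ) : ℂ) * f τ δ‖ ≤
      (M + 1) * (C₂ * (1 + 1 / y) ^ A₂ * Real.exp (-(ε * y))) := by
    rw [finsum_prop_eq_sum_ite]
    refine (norm_sum_le _ _).trans ?_
    have : ∀ δ ∈ (Finset.univ : Finset (Quo (dual L) L)),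
        ‖if LiesOver L u u' ζ N δ x then e ((t * form p q (rep δ) u' : ℝ) : ℂ) * f τ δ else 0‖ ≤
        C₂ * (1 + 1 / y) ^ A₂ * Real.exp (-(ε * y)) := by
      intro δ _
      split_ifs
      · rw [norm_mul, norm_e_ofReal, one_mul]
        exact h₂ δ τ
      · rw [norm_zero]; positivity
    refine (Finset.sum_le_card_nsmul _ _ _ this).trans ?_
    rw [nsmul_eq_mul, Finset.card_univ]
    gcongr
    linarith
  have h5 : (1 : ℝ) ≤ 1 + 1 / y := by
    have : 0 < 1 / y := by positivity
    linarith
  have h6 : (1 : ℝ) ≤ 1 + y := by linarith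
  rw [unfTerm, norm_mul, norm_mul, norm_mul, norm_e_ofReal, mul_one, Complex.norm_real,
    Real.norm_eq_abs, abs_of_pos (by positivity)]
  calc _ ≤ (D * ((1 + 1 / y) ^ R * (1 + y) ^ R)) *
        ((M + 1) * (C₂ * (1 + 1 / y) ^ A₂ * Real.exp (-(ε * y)))) *
        (C₁ * (1 + 1 / y) ^ A₁ * (1 + y) ^ A₁ * Real.exp (-(c * (1 / y) * (t : ℝ) ^ 2)) *
        (1 / (1 + ‖gSharp g u x‖) ^ K) * (1 / (1 + (t : ℝ)) ^ 2)) := by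
        gcongr
        exact h₁ t τ x
    _ = (D * (M + 1) * C₂ * C₁) * ((1 + 1 / y) ^ (A₁ + A₂ + R) * (1 + y) ^ (A₁ + R) *
        Real.exp (-(c * (1 / y) * (t : ℝ) ^ 2)) * Real.exp (-(ε * y))) *
        (1 / (1 + ‖gSharp g u x‖) ^ K) * (1 / (1 + (t : ℝ)) ^ 2) := by ring
    _ ≤ (D * (M + 1) * C₂ * C₁) * ((1 + 1 / y) ^ (A₁ + A₂ + R) * (1 + y) ^ (A₁ + A₂ + R) *
        Real.exp (-(c * (1 / y) * (t : ℝ) ^ 2)) * Real.exp (-(ε * y))) *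
        (1 / (1 + ‖gSharp g u x‖) ^ K) * (1 / (1 + (t : ℝ)) ^ 2) := by
        have h8 : (1 + y) ^ (A₁ + R) ≤ (1 + y) ^ (A₁ + A₂ + R) := pow_le_pow_right₀ h6 (by omega)
        gcongr
    _ ≤ (D * (M + 1) * C₂ * C₁) * (C₃ * (y ^ 2 * Real.exp (-(ε / 2 * y)))) *
        (1 / (1 + ‖gSharp g u x‖) ^ K) * (1 / (1 + (t : ℝ)) ^ 2) := by
        have h9 := h₃ y hy t ht
        gcongr
    _ = _ := by ring

/-! ### Summation over `M'` -/

/-- For x ⊥ u the corrections along u_z and u_{z^⊥} have the same coefficient and add up to a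
multiple of u. -/
theorem gSharp_of_form_eq_zero (hg : IsSO g) (hu0 : form p q u u = 0) {x : Vpq p q}
    (hx : form p q x u = 0) :
    gSharp g u x = g (x - (form p q x (projZperp g u) / normZperp g u) • u) := by
  rw [gSharp_eq hg, form_projZ_eq, hx, normZ_eq_neg hg hu0, zero_sub, neg_div_neg_eq, map_sub,
    map_smul, sub_sub, ← smul_add, ← map_add, projZperp_add_projZ]

/-- On M ⊗ ℝ the map g^# is g followed by a shift along g(u); applying g⁻¹ and projecting to M ⊗ ℝ
undoes it, so it is bounded below. -/
theorem IsotropicData.exists_norm_le_gSharp (H : IsotropicData L u u' ζ N) (hg : IsSO g) :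
    ∃ C > 0, ∀ x ∈ dualM L u u', 1 + ‖x‖ ≤ C * (1 + ‖gSharp g u x‖) := by
  set P : Vpq p q →ₗ[ℝ] Vpq p q :=
    { toFun := projM u u'
      map_add' := projM_add u u'
      map_smul' := fun c v => projM_smul u u' v c } with hP
  set Q := LinearMap.toContinuousLinearMap (P.comp (g.symm : Vpq p q →ₗ[ℝ] Vpq p q)) with hQ
  refine ⟨1 + ‖Q‖, by positivity, fun x hx => ?_⟩
  have h1 : Q (gSharp g u x) = x := by
    have h2 : projM u u' x = x := by
      rw [projM_of_form_eq_zero u' hx.2.1, hx.2.2]; simp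
    have h3 : projM u u' u = 0 := by
      rw [projM_of_form_eq_zero u' H.iso, H.form']; simp
    rw [gSharp_of_form_eq_zero hg H.iso hx.2.1]
    simp only [hQ, hP, LinearMap.coe_toContinuousLinearMap', LinearMap.comp_apply,
      LinearEquiv.coe_coe, LinearEquiv.symm_apply_apply, LinearMap.coe_mk, AddHom.coe_mk]
    rw [projM_sub, projM_smul, h2, h3]
    simp
  have h4 := Q.le_opNorm (gSharp g u x)
  rw [h1] at h4
  nlinarith [norm_nonneg Q, norm_nonneg (gSharp g u x)]

/-- The embedding `x ↦ x - ((x,ζ)/N) u` of `M'` into `L'`. -/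
def IsotropicData.emb (H : IsotropicData L u u' ζ N) (x : dualM L u u') : dual L :=
  ⟨(x : Vpq p q) - (form p q x ζ / N) • u, mem_dual.2 fun l hl => by
    have hN : (N : ℝ) ≠ 0 := by exact_mod_cast H.pos.ne'
    obtain ⟨n, hn⟩ := H.dvd l hl
    -- Subtracting nζ brings l into u^⊥, and its projection into M, where x pairs integrally; the
    -- correction along u accounts for n(x,ζ).
    have h0 : form p q (l - n • ζ) u = 0 := by
      rw [map_sub, LinearMap.sub_apply, hn, map_zsmul, LinearMap.smul_apply, H.zeta_form]
      simp
    have hm := H.projM_mem_latM (L.sub_mem hl (L.smul_mem n H.zeta_mem)) h0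
    obtain ⟨k, hk⟩ := exists_form_int x.2.1 hm
    refine ⟨k, ?_⟩
    rw [projM_of_form_eq_zero u' h0, map_sub, map_sub, map_zsmul,
      map_smul (form p q (x : Vpq p q)), x.2.2.1] at hk
    rw [map_sub, LinearMap.sub_apply, map_smul, LinearMap.smul_apply, form_comm u l, hn, ← hk]
    simp only [smul_eq_mul, zsmul_eq_mul]
    field_simp
    ring⟩

theorem IsotropicData.injective_emb (H : IsotropicData L u u' ζ N) :
    Function.Injective H.emb := by
  intro x y h
  have h1 := congrArg (fun z : dual L => projM u u' z) h
  have h3 : projM u u' u = 0 := by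
    rw [projM_of_form_eq_zero u' H.iso, H.form']; simp
  have h2 : ∀ x : dualM L u u', projM u u' x = x := fun x => by
    rw [projM_of_form_eq_zero u' x.2.2.1, x.2.2.2]; simp
  simp only [emb, projM_sub, projM_smul, h3, smul_zero, sub_zero, h2] at h1
  exact Subtype.ext h1

variable [DiscreteTopology L] [IsZLattice ℝ L]

theorem IsotropicData.countable_dualM (H : IsotropicData L u u' ζ N) :
    Countable (dualM L u u') := by
  have := countable_dual H.even
  exact H.injective_emb.countable

/-- M' embeds linearly into the lattice L', so the sum is dominated by the convergent one over L'.
-/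
theorem IsotropicData.exists_summable (H : IsotropicData L u u' ζ N) (hg : IsSO g) :
    ∃ K : ℕ, Summable fun x : dualM L u u' => 1 / (1 + ‖gSharp g u x‖) ^ K := by
  obtain ⟨K, -, hK⟩ := summable_dual H.even
  obtain ⟨C, hC, h⟩ := H.exists_norm_le_gSharp hg
  refine ⟨K, ?_⟩
  set P : Vpq p q →ₗ[ℝ] Vpq p q :=
    LinearMap.id - ((1 / N : ℝ) • (form p q).flip ζ).smulRight u with hP
  set Q := LinearMap.toContinuousLinearMap P with hQ
  have h1 : ∀ x : dualM L u u', ((H.emb x : dual L) : Vpq p q) = Q x := fun x => by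
    simp only [emb, hQ, hP, LinearMap.coe_toContinuousLinearMap', LinearMap.sub_apply,
      LinearMap.id_apply, LinearMap.smulRight_apply, LinearMap.smul_apply,
      smul_eq_mul, one_div_mul_eq_div]
    rfl
  refine Summable.of_nonneg_of_le (fun _ => by positivity) (fun x => ?_)
    ((hK.comp_injective H.injective_emb).mul_left (((1 + ‖Q‖) * C) ^ K))
  simp only [Function.comp]
  rw [mul_one_div, div_le_div_iff₀ (by positivity) (by positivity), one_mul, ← mul_pow]
  gcongr
  have h2 := Q.le_opNorm (x : Vpq p q)
  rw [← h1] at h2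
  have h3 := h x x.2
  calc 1 + ‖((H.emb x : dual L) : Vpq p q)‖ ≤ (1 + ‖Q‖) * (1 + ‖(x : Vpq p q)‖) := by
        nlinarith [norm_nonneg Q, norm_nonneg (x : Vpq p q)]
    _ ≤ (1 + ‖Q‖) * (C * (1 + ‖gSharp g u x‖)) := by gcongr
    _ = _ := by ring

end

section

/-! ### The invariant measure and the fundamental domain -/

theorem measurePreserving_SL (γ : SL(2, ℤ)) :
    MeasurePreserving (fun τ : ℍ => γ • τ) volume volume :=
  measurePreserving_smul (γ : GL (Fin 2) ℝ) volume

theorem volume_re_eq (c : ℝ) : volume {z : ℂ | z.re = c} = 0 := by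
  have h : {z : ℂ | z.re = c} = Complex.measurableEquivRealProd ⁻¹' ({c} ×ˢ Set.univ) := by
    ext z; simp
  rw [h, Complex.volume_preserving_equiv_real_prod.measure_preimage
    ((measurableSet_singleton c).prod MeasurableSet.univ).nullMeasurableSet,
    Measure.volume_eq_prod, Measure.prod_prod]
  simp

/-- The boundary lies in the unit circle and two vertical lines. -/
theorem volume_fd_diff_fdo : volume (ModularGroup.fd \ ModularGroup.fdo) = 0 := by
  rw [UpperHalfPlane.volume_eq_lintegral]
  refine setLIntegral_measure_zero _ _ (measure_mono_null
    (t := Metric.sphere 0 1 ∪ ({z : ℂ | z.re = 1 / 2} ∪ {z : ℂ | z.re = -(1 / 2)})) ?_ ?_)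
  · rintro _ ⟨τ, ⟨h1, h2⟩, rfl⟩
    rcases eq_or_lt_of_le h1.1 with h | h
    · left
      rw [Complex.normSq_eq_norm_sq] at h
      rw [mem_sphere_zero_iff_norm]
      nlinarith [norm_nonneg (τ : ℂ)]
    · right
      have h3 : |τ.re| = 1 / 2 := le_antisymm h1.2 (not_lt.1 fun h3 => h2 ⟨h, h3⟩)
      exact (eq_or_eq_neg_of_abs_eq h3)
  · rw [measure_union_null_iff, measure_union_null_iff]
    exact ⟨Measure.addHaar_sphere _ _ _, volume_re_eq _, volume_re_eq _⟩

theorem measurableSet_fd : MeasurableSet ModularGroup.fd := ModularGroup.isClosed_fd.measurableSet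

/-- Away from the translates of the boundary exactly two elements, γ and -γ, move a given point of
the domain to τ. -/
theorem tsum_indicator_fd {τ : ℍ}
    (hτ : ∀ γ : SL(2, ℤ), γ • τ ∉ ModularGroup.fd \ ModularGroup.fdo) :
    ∑' γ : SL(2, ℤ), Set.indicator {τ : ℍ | γ⁻¹ • τ ∈ ModularGroup.fd}
      (fun _ => (1 : ENNReal)) τ = 2 := by
  obtain ⟨γ₀, h₀⟩ := ModularGroup.exists_smul_mem_fd τ
  have h₁ : γ₀ • τ ∈ ModularGroup.fdo := by
    by_contra h
    exact hτ γ₀ ⟨h₀, h⟩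
  have key : ∀ γ : SL(2, ℤ), γ⁻¹ • τ ∈ ModularGroup.fd ↔ γ = γ₀⁻¹ ∨ γ = -γ₀⁻¹ := by
    intro γ
    constructor
    · intro h
      have h2 : (γ⁻¹ * γ₀⁻¹) • (γ₀ • τ) ∈ ModularGroup.fd := by
        rwa [smul_smul, inv_mul_cancel_right]
      rcases ModularGroup.eq_one_or_neg_one_of_mem_fdo_mem_fd h₁ h2 with h3 | h3
      · left
        rw [inv_mul_eq_one] at h3
        exact h3
      · right
        rw [inv_mul_eq_iff_eq_mul] at h3
        rw [h3]; simp
    · rintro (rfl | rfl)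
      · simpa using h₀
      · have : (-γ₀⁻¹)⁻¹ = -γ₀ := by
          rw [inv_eq_iff_mul_eq_one]; simp
        rw [this, ModularGroup.SL_neg_smul]
        exact h₀
  have hne : γ₀⁻¹ ≠ -γ₀⁻¹ := by
    intro h
    have h2 : (1 : SL(2, ℤ)) = -1 := by
      have := congrArg (fun x => γ₀ * x) h
      simpa using this
    have h3 := congrArg (fun x : SL(2, ℤ) => x 0 0) h2
    simp at h3
  rw [tsum_eq_sum (s := {γ₀⁻¹, -γ₀⁻¹})]
  · rw [Finset.sum_pair hne, Set.indicator_of_mem, Set.indicator_of_mem]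
    · norm_num
    · exact (key _).2 (Or.inr rfl)
    · exact (key _).2 (Or.inl rfl)
  · intro γ hγ
    apply Set.indicator_of_notMem
    intro h
    apply hγ
    simpa using (key γ).1 h

instance countable_SL : Countable SL(2, ℤ) :=
  Function.Injective.countable (f := fun γ : SL(2, ℤ) => ((γ 0 0, γ 0 1), (γ 1 0, γ 1 1)))
    fun γ γ' h => by
      simp only [Prod.mk.injEq] at h
      ext i j
      fin_cases i <;> fin_cases j
      exacts [h.1.1, h.1.2, h.2.1, h.2.2]

/-- The translates of the fundamental domain cover ℍ twice almost everywhere, since -1 acts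
trivially. This is the source of the factor 2. -/
theorem sum_map_smul_fd :
    Measure.sum (fun γ : SL(2, ℤ) => (volume.restrict ModularGroup.fd).map (fun τ : ℍ => γ • τ)) =
      (2 : ENNReal) • (volume : Measure ℍ) := by
  ext s hs
  rw [Measure.sum_apply _ hs, Measure.smul_apply, smul_eq_mul]
  have hmeas : ∀ γ : SL(2, ℤ), MeasurableSet {τ : ℍ | γ⁻¹ • τ ∈ ModularGroup.fd} := fun γ =>
    (measurePreserving_SL γ⁻¹).measurable measurableSet_fd
  have h1 : ∀ γ : SL(2, ℤ), (volume.restrict ModularGroup.fd).map (fun τ : ℍ => γ • τ) s =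
      ∫⁻ τ in s, Set.indicator {τ : ℍ | γ⁻¹ • τ ∈ ModularGroup.fd} (fun _ => (1 : ENNReal)) τ := by
    intro γ
    have hm := (measurePreserving_SL γ).measurable
    rw [Measure.map_apply hm hs, Measure.restrict_apply (hm hs),
      ← (measurePreserving_SL γ⁻¹).measure_preimage
        ((hm hs).inter measurableSet_fd).nullMeasurableSet,
      lintegral_indicator (hmeas γ), setLIntegral_one, Measure.restrict_apply (hmeas γ)]
    congr 1
    ext τ
    simp [and_comm]
  simp_rw [h1]
  rw [← lintegral_tsum fun γ => (measurable_const.indicator (hmeas γ)).aemeasurable]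
  have h2 : ∀ᵐ τ ∂(volume : Measure ℍ),
      ∀ γ : SL(2, ℤ), γ • τ ∉ ModularGroup.fd \ ModularGroup.fdo := by
    rw [ae_all_iff]
    intro γ
    have h3 := (measurePreserving_SL γ).quasiMeasurePreserving.preimage_null volume_fd_diff_fdo
    exact measure_eq_zero_iff_ae_notMem.1 h3
  rw [lintegral_congr_ae (ae_restrict_of_ae (h2.mono fun τ hτ => tsum_indicator_fd hτ)),
    setLIntegral_const]

theorem hasSum_integral_fd_smul {F : ℍ → ℂ} (hF : Integrable F) :
    HasSum (fun γ : SL(2, ℤ) => ∫ τ in ModularGroup.fd, F (γ • τ)) (2 * ∫ τ, F τ) := by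
  have h : Integrable F (Measure.sum fun γ : SL(2, ℤ) =>
      (volume.restrict ModularGroup.fd).map (fun τ : ℍ => γ • τ)) := by
    rw [sum_map_smul_fd]
    exact hF.smul_measure (by simp)
  have h2 := hasSum_integral_measure h
  rw [sum_map_smul_fd, integral_smul_measure] at h2
  have h3 : (fun γ : SL(2, ℤ) => ∫ τ in ModularGroup.fd, F (γ • τ)) = fun γ : SL(2, ℤ) =>
      ∫ τ, F τ ∂((volume.restrict ModularGroup.fd).map (fun τ : ℍ => γ • τ)) := funext fun γ =>
    (integral_map (measurePreserving_SL γ).measurable.aemeasurable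
      (h.1.mono_measure (Measure.le_sum _ γ))).symm
  rw [h3]
  rw [ENNReal.toReal_ofNat, Complex.real_smul] at h2
  exact_mod_cast h2

theorem lintegral_fd_smul (F : ℍ → ENNReal) (hF : AEMeasurable F) :
    ∑' γ : SL(2, ℤ), ∫⁻ τ in ModularGroup.fd, F (γ • τ) = 2 * ∫⁻ τ, F τ := by
  have h := lintegral_sum_measure F (fun γ : SL(2, ℤ) =>
      (volume.restrict ModularGroup.fd).map (fun τ : ℍ => γ • τ))
  have hm : AEMeasurable F (Measure.sum (fun γ : SL(2, ℤ) =>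
      (volume.restrict ModularGroup.fd).map (fun τ : ℍ => γ • τ))) := by
    rw [sum_map_smul_fd]
    exact hF.smul_measure _
  rw [sum_map_smul_fd, lintegral_smul_measure] at h
  rw [← smul_eq_mul, h]
  refine tsum_congr fun γ => ?_
  rw [lintegral_map' (hm.mono_measure (Measure.le_sum _ γ))
    (measurePreserving_SL γ).measurable.aemeasurable]

/-! ### Coordinates on the upper half-plane -/

/-- The integrand in the coordinates `(x,y)`. -/
def coordFn (F : ℍ → ℂ) (z : ℝ × ℝ) : ℂ :=
  ((1 / z.2 ^ 2 : ℝ) : ℂ) * F (UpperHalfPlane.ofComplex (z.1 + z.2 * Complex.I))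

theorem measurePreserving_coe :
    MeasurePreserving UpperHalfPlane.coe (volume.comap UpperHalfPlane.coe)
      (volume.restrict {z : ℂ | 0 < z.im}) := by
  refine ⟨UpperHalfPlane.measurable_coe, ?_⟩
  rw [UpperHalfPlane.measurableEmbedding_coe.map_comap]
  congr 1
  ext z
  simp

theorem measurePreserving_coord :
    MeasurePreserving Complex.measurableEquivRealProd (volume.restrict {z : ℂ | 0 < z.im})
      (volume.restrict (Set.univ ×ˢ Set.Ioi (0 : ℝ))) := by
  have h := Complex.volume_preserving_equiv_real_prod.restrict_preimage
    (MeasurableSet.univ.prod (measurableSet_Ioi (a := (0 : ℝ))))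
  have hset : {z : ℂ | 0 < z.im} =
      Complex.measurableEquivRealProd ⁻¹' (Set.univ ×ˢ Set.Ioi (0 : ℝ)) := by
    ext z
    simp
  rw [hset]
  exact h

theorem density_smul (F : ℍ → ℂ) (τ : ℍ) :
    ((1 / NNReal.mk τ.im τ.im_pos.le : NNReal) ^ 2) • F τ =
      coordFn F (Complex.measurableEquivRealProd τ) := by
  rw [coordFn]
  have : ((Complex.measurableEquivRealProd (τ : ℂ)).1 : ℂ) +
      (Complex.measurableEquivRealProd (τ : ℂ)).2 * Complex.I = (τ : ℂ) := by
    exact Complex.re_add_im (τ : ℂ)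
  rw [this, UpperHalfPlane.ofComplex_apply, NNReal.smul_def, Complex.real_smul]
  simp

theorem measurable_density : Measurable fun τ : ℍ =>
    (1 / NNReal.mk τ.im τ.im_pos.le : NNReal) ^ 2 := by
  have h : Measurable fun τ : ℍ => (NNReal.mk τ.im τ.im_pos.le : NNReal) :=
    (UpperHalfPlane.continuous_im.subtype_mk _).measurable
  exact (measurable_const.div h).pow_const 2

theorem integrable_iff_coordFn (F : ℍ → ℂ) :
    Integrable F ↔ IntegrableOn (coordFn F) (Set.univ ×ˢ Set.Ioi (0 : ℝ)) := by
  rw [UpperHalfPlane.volume_def, integrable_withDensity_iff_integrable_smul measurable_density,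
    IntegrableOn, ← measurePreserving_coord.integrable_comp_emb
      Complex.measurableEquivRealProd.measurableEmbedding,
    ← measurePreserving_coe.integrable_comp_emb UpperHalfPlane.measurableEmbedding_coe]
  simp_rw [density_smul]
  rfl

theorem integral_eq_coordFn (F : ℍ → ℂ) :
    ∫ τ, F τ = ∫ z in Set.univ ×ˢ Set.Ioi (0 : ℝ), coordFn F z := by
  rw [UpperHalfPlane.volume_def, integral_withDensity_eq_integral_smul measurable_density,
    ← measurePreserving_coord.integral_comp
      Complex.measurableEquivRealProd.measurableEmbedding,
    ← measurePreserving_coe.integral_comp UpperHalfPlane.measurableEmbedding_coe]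
  simp_rw [density_smul]

/-- The strip `a ≤ Re τ < b`. -/
def strip (a b : ℝ) : Set ℍ := {τ | τ.re ∈ Set.Ico a b}

theorem measurableSet_strip (a b : ℝ) : MeasurableSet (strip a b) :=
  UpperHalfPlane.continuous_re.measurable measurableSet_Ico

theorem coordFn_indicator (F : ℍ → ℂ) (a b : ℝ) {z : ℝ × ℝ}
    (hz : z ∈ (Set.univ : Set ℝ) ×ˢ Set.Ioi (0 : ℝ)) :
    coordFn ((strip a b).indicator F) z = (Set.Ico a b ×ˢ Set.univ).indicator (coordFn F) z := by
  have hz2 : 0 < z.2 := hz.2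
  have h1 : 0 < ((z.1 : ℂ) + z.2 * Complex.I).im := by simpa using hz2
  have h2 : UpperHalfPlane.ofComplex (z.1 + z.2 * Complex.I) ∈ strip a b ↔
      z ∈ Set.Ico a b ×ˢ (Set.univ : Set ℝ) := by
    rw [UpperHalfPlane.ofComplex_apply_of_im_pos h1]
    have h3 : UpperHalfPlane.re ⟨(z.1 : ℂ) + z.2 * Complex.I, h1⟩ = z.1 := by
      change ((z.1 : ℂ) + z.2 * Complex.I).re = z.1
      simp
    simp only [strip, Set.mem_ofPred_eq, h3, Set.mem_prod, Set.mem_univ, and_true]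
  by_cases h : z ∈ Set.Ico a b ×ˢ (Set.univ : Set ℝ)
  · rw [Set.indicator_of_mem h, coordFn, coordFn, Set.indicator_of_mem (h2.2 h)]
  · rw [Set.indicator_of_notMem h, coordFn, Set.indicator_of_notMem (fun h3 => h (h2.1 h3)),
      mul_zero]

theorem integrableOn_strip_iff (F : ℍ → ℂ) (a b : ℝ) :
    IntegrableOn F (strip a b) ↔
      Integrable (coordFn F)
        ((volume.restrict (Set.Ico a b)).prod (volume.restrict (Set.Ioi (0 : ℝ)))) := by
  rw [← integrable_indicator_iff (measurableSet_strip a b), integrable_iff_coordFn,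
    integrableOn_congr_fun (fun z hz => coordFn_indicator F a b hz)
      (MeasurableSet.univ.prod measurableSet_Ioi),
    integrableOn_indicator_iff (measurableSet_Ico.prod MeasurableSet.univ),
    Measure.prod_restrict, Set.prod_inter_prod, Set.inter_univ, Set.univ_inter,
    IntegrableOn, Measure.volume_eq_prod]

theorem setIntegral_strip {F : ℍ → ℂ} {a b : ℝ} (hab : a ≤ b) (hF : IntegrableOn F (strip a b)) :
    ∫ τ in strip a b, F τ = ∫ y in Set.Ioi (0 : ℝ), ∫ x in a..b, coordFn F (x, y) := by
  have h := (integrableOn_strip_iff F a b).1 hF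
  rw [← integral_indicator (measurableSet_strip a b), integral_eq_coordFn,
    setIntegral_congr_fun (MeasurableSet.univ.prod measurableSet_Ioi)
      (fun z hz => coordFn_indicator F a b hz),
    setIntegral_indicator (measurableSet_Ico.prod MeasurableSet.univ), Set.prod_inter_prod,
    Set.inter_univ, Set.univ_inter, Measure.volume_eq_prod, ← Measure.prod_restrict,
    integral_prod_symm _ h]
  refine integral_congr_ae (Filter.Eventually.of_forall fun y => ?_)
  simp only
  rw [intervalIntegral.integral_of_le hab, integral_Ico_eq_integral_Ioc]

/-- The factor y² cancels the density y⁻² of the invariant measure. -/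
theorem integrableOn_im_sq_mul_exp (a b : ℝ) {ε : ℝ} (hε : 0 < ε) :
    IntegrableOn (fun τ : ℍ => τ.im ^ 2 * Real.exp (-(ε * τ.im))) (strip a b) := by
  have h : IntegrableOn (fun τ : ℍ => ((τ.im ^ 2 * Real.exp (-(ε * τ.im)) : ℝ) : ℂ))
      (strip a b) := by
    rw [integrableOn_strip_iff]
    have h1 : Integrable (fun y : ℝ => ((Real.exp (-(ε * y)) : ℝ) : ℂ))
        (volume.restrict (Set.Ioi (0 : ℝ))) := by
      have := exp_neg_integrableOn_Ioi 0 hε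
      simp only [neg_mul] at this
      exact this.ofReal
    have h2 : Integrable (fun _ : ℝ => (1 : ℂ)) (volume.restrict (Set.Ico a b)) :=
      integrable_const _
    have h3 := h2.mul_prod h1
    refine h3.congr ?_
    rw [Measure.prod_restrict]
    refine ae_restrict_of_forall_mem (measurableSet_Ico.prod measurableSet_Ioi) fun z hz => ?_
    have hz2 : 0 < z.2 := hz.2
    have h4 : 0 < ((z.1 : ℂ) + z.2 * Complex.I).im := by simpa using hz2
    have h5 : UpperHalfPlane.im ⟨(z.1 : ℂ) + z.2 * Complex.I, h4⟩ = z.2 := by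
      change ((z.1 : ℂ) + z.2 * Complex.I).im = z.2
      simp
    simp only [coordFn, UpperHalfPlane.ofComplex_apply_of_im_pos h4, ← Complex.ofReal_mul,
      one_mul, h5]
    congr 1
    field_simp
  exact h.re

end

section

variable {p q : ℕ}

/-! ### Termwise integration -/

section Termwise

variable {X ι : Type*} [MeasurableSpace X] {μ : Measure X} [Countable ι] {F : ι → X → ℂ}

/-- By Tonelli the sum of the norms has finite integral, hence is finite almost everywhere. -/
theorem ae_summable_of_tsum_lintegral (hF : ∀ i, AEStronglyMeasurable (F i) μ)
    (h : ∑' i, ∫⁻ a, ‖F i a‖ₑ ∂μ ≠ ⊤) : ∀ᵐ a ∂μ, Summable fun i => F i a := by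
  rw [← lintegral_tsum fun i => (hF i).enorm] at h
  have h1 : AEMeasurable (fun a => ∑' i, ‖F i a‖ₑ) μ :=
    AEMeasurable.tsum fun i => (hF i).enorm
  filter_upwards [ae_lt_top' h1 h] with a ha
  exact (tsum_enorm_ne_top_iff_summable_norm.1 ha.ne).of_norm

theorem integrable_tsum_of_tsum_lintegral (hF : ∀ i, AEStronglyMeasurable (F i) μ)
    (h : ∑' i, ∫⁻ a, ‖F i a‖ₑ ∂μ ≠ ⊤) : Integrable (fun a => ∑' i, F i a) μ := by
  refine ⟨?_, ?_⟩
  · refine aestronglyMeasurable_of_tendsto_ae (Filter.atTop : Filter (Finset ι))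
      (f := fun s a => ∑ i ∈ s, F i a) (fun s => ?_) ?_
    · exact Finset.aestronglyMeasurable_fun_sum s fun i _ => hF i
    · filter_upwards [ae_summable_of_tsum_lintegral hF h] with a ha
      exact ha.hasSum
  · refine lt_of_le_of_lt (lintegral_mono fun a => enorm_tsum_le_tsum_enorm) ?_
    rw [lintegral_tsum fun i => (hF i).enorm]
    exact h.lt_top

theorem hasSum_integral_of_tsum_lintegral (hF : ∀ i, AEStronglyMeasurable (F i) μ)
    (h : ∑' i, ∫⁻ a, ‖F i a‖ₑ ∂μ ≠ ⊤) :
    HasSum (fun i => ∫ a, F i a ∂μ) (∫ a, ∑' i, F i a ∂μ) := by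
  have hi : ∀ i, ∫⁻ a, ‖F i a‖ₑ ∂μ ≠ ⊤ := fun i => ENNReal.ne_top_of_tsum_ne_top h i
  refine hasSum_integral_of_summable_integral_norm (fun i => ⟨hF i, (hi i).lt_top⟩) ?_
  simp_rw [integral_norm_eq_lintegral_enorm (hF _)]
  exact ENNReal.summable_toReal h

end Termwise

/-- Integration over the fundamental domain of a sum over `SL(2,ℤ)`. -/
theorem unfold_fd {ι : Type*} [Countable ι] {A : ι → ℍ → ℂ}
    (hA : ∀ i, AEStronglyMeasurable (A i) volume) (h : ∑' i, ∫⁻ τ, ‖A i τ‖ₑ ≠ ⊤) :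
    (∀ᵐ τ ∂volume.restrict ModularGroup.fd,
      Summable fun x : SL(2, ℤ) × ι => A x.2 (x.1 • τ)) ∧
    IntegrableOn (fun τ => ∑' x : SL(2, ℤ) × ι, A x.2 (x.1 • τ)) ModularGroup.fd ∧
    HasSum (fun i => 2 * ∫ τ, A i τ)
      (∫ τ in ModularGroup.fd, ∑' x : SL(2, ℤ) × ι, A x.2 (x.1 • τ)) := by
  have hF : ∀ x : SL(2, ℤ) × ι, AEStronglyMeasurable (fun τ => A x.2 (x.1 • τ))
      (volume.restrict ModularGroup.fd) := fun x =>
    ((hA x.2).comp_measurePreserving (measurePreserving_SL x.1)).restrict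
  have hs : ∑' x : SL(2, ℤ) × ι, ∫⁻ τ in ModularGroup.fd, ‖A x.2 (x.1 • τ)‖ₑ ≠ ⊤ := by
    rw [ENNReal.tsum_prod (f := fun (γ : SL(2, ℤ)) i =>
      ∫⁻ τ in ModularGroup.fd, ‖A i (γ • τ)‖ₑ), ENNReal.tsum_comm]
    have h1 : ∀ i, ∑' γ : SL(2, ℤ), ∫⁻ τ in ModularGroup.fd, ‖A i (γ • τ)‖ₑ =
        2 * ∫⁻ τ, ‖A i τ‖ₑ := fun i => lintegral_fd_smul (fun τ => ‖A i τ‖ₑ) (hA i).enorm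
    simp_rw [h1]
    rw [ENNReal.tsum_mul_left]
    exact ENNReal.mul_ne_top (by simp) h
  refine ⟨ae_summable_of_tsum_lintegral hF hs, integrable_tsum_of_tsum_lintegral hF hs, ?_⟩
  have h2 := hasSum_integral_of_tsum_lintegral hF hs
  have h3 := (Equiv.prodComm ι SL(2, ℤ)).hasSum_iff.2 h2
  refine h3.prod_fiberwise fun i => ?_
  exact hasSum_integral_fd_smul ⟨hA i, (ENNReal.ne_top_of_tsum_ne_top h i).lt_top⟩

/-! ### Primitive vectors and the strip -/

/-- The pairs `(γ, t)` such that `γτ` lies in the unit strip. -/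
abbrev StripIdx (τ : ℍ) := {x : SL(2, ℤ) × ℕ // x.1 • τ ∈ strip 0 1}

/-- The vector `t · (0,1)γ`, for `t ≥ 1`. -/
def rowVec (x : SL(2, ℤ) × ℕ) : Fin 2 → ℤ :=
  Matrix.vecMul ![0, ((x.2 + 1 : ℕ) : ℤ)] (x.1 : Matrix (Fin 2) (Fin 2) ℤ)

theorem rowVec_apply (x : SL(2, ℤ) × ℕ) (i : Fin 2) : rowVec x i = (x.2 + 1) * x.1 1 i := by
  simp [rowVec, Matrix.vecMul, dotProduct, Fin.sum_univ_two]

/-- The bottom row of γ is coprime, so the gcd recovers the multiple; t is stored as t - 1, whence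
the + 1. -/
theorem gcd_rowVec (x : SL(2, ℤ) × ℕ) : Int.gcd (rowVec x 0) (rowVec x 1) = x.2 + 1 := by
  rw [rowVec_apply, rowVec_apply, Int.gcd_mul_left,
    Int.isCoprime_iff_gcd_eq_one.1 (ModularGroup.bottom_row_coprime x.1)]
  omega

theorem eq_T_zpow_mul {γ γ' : SL(2, ℤ)} (h : ∀ i, γ 1 i = γ' 1 i) :
    ∃ n : ℤ, γ' = ModularGroup.T ^ n * γ := by
  have hd := γ.det_coe
  have hd' := γ'.det_coe
  rw [Matrix.det_fin_two] at hd hd'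
  have h0 := h 0
  have h1 := h 1
  rw [← h0, ← h1] at hd'
  -- The upper right entry of γ'γ⁻¹.
  refine ⟨γ' 0 1 * γ 0 0 - γ' 0 0 * γ 0 1, ?_⟩
  ext i j
  rw [Matrix.SpecialLinearGroup.coe_mul, ModularGroup.coe_T_zpow, Matrix.mul_apply,
    Fin.sum_univ_two]
  fin_cases i <;> fin_cases j <;> simp [← h0, ← h1]
  · linear_combination (-γ' 0 0) * hd + γ 0 0 * hd'
  · linear_combination (-γ' 0 1) * hd + γ 0 1 * hd'

/-- A nonzero n is its gcd times a primitive vector, and a primitive vector is the bottom row of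
some γ, unique up to powers of T. These translate Re γτ by integers, so the strip selects one. The
vectors n and -n arise from γ and -γ. -/
theorem bijective_rowVec (τ : ℍ) : Function.Bijective
    (fun x : StripIdx τ => (⟨rowVec x.1, by
      rw [Finset.mem_singleton]
      intro h
      have h1 := gcd_rowVec x.1
      simp [h] at h1⟩ : {n : Fin 2 → ℤ // n ∉ ({0} : Finset (Fin 2 → ℤ))})) := by
  constructor
  · rintro ⟨⟨γ, t⟩, hx⟩ ⟨⟨γ', t'⟩, hx'⟩ h
    have h1 : rowVec (γ, t) = rowVec (γ', t') := congrArg Subtype.val h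
    have ht : t = t' := by
      have h2 := gcd_rowVec (γ, t)
      have h3 := gcd_rowVec (γ', t')
      rw [← h1, h2] at h3
      simpa using h3
    subst ht
    have h4 : ∀ i, γ 1 i = γ' 1 i := fun i => by
      have h5 := congrFun h1 i
      rw [rowVec_apply, rowVec_apply] at h5
      exact mul_left_cancel₀ (by positivity) h5
    obtain ⟨n, rfl⟩ := eq_T_zpow_mul h4
    have hn : n = 0 := by
      simp only [strip, Set.mem_ofPred_eq, mul_smul, ModularGroup.re_T_zpow_smul, Set.mem_Ico]
        at hx hx'
      have h5 : (-1 : ℝ) < n := by linarith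
      have h6 : (n : ℝ) < 1 := by linarith
      have h7 : -1 < n := by exact_mod_cast h5
      have h8 : n < 1 := by exact_mod_cast h6
      omega
    subst hn
    exact Subtype.ext (by simp)
  · rintro ⟨n, hn⟩
    have hn0 : Int.gcd (n 0) (n 1) ≠ 0 := by
      intro h
      rw [Int.gcd_eq_zero_iff] at h
      apply hn
      rw [Finset.mem_singleton]
      ext i
      fin_cases i
      exacts [h.1, h.2]
    obtain ⟨d, a, b, hd, hco, ha, hb⟩ := Int.exists_gcd_one' (Nat.pos_of_ne_zero hn0)
    obtain ⟨γ, -, hγ⟩ := ModularGroup.bottom_row_surj (R := ℤ)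
      (show ![a, b] ∈ {cd : Fin 2 → ℤ | IsCoprime (cd 0) (cd 1)} from
        Int.isCoprime_iff_gcd_eq_one.2 hco)
    have hγ' : ∀ i, (ModularGroup.T ^ (-⌊(γ • τ).re⌋) * γ) 1 i = γ 1 i := fun i => by
      rw [Matrix.SpecialLinearGroup.coe_mul, ModularGroup.coe_T_zpow, Matrix.mul_apply,
        Fin.sum_univ_two]
      simp
    -- T^{-⌊Re γτ⌋} brings γτ into the strip and leaves the bottom row alone.
    refine ⟨⟨(ModularGroup.T ^ (-⌊(γ • τ).re⌋) * γ, d - 1), ?_⟩, Subtype.ext ?_⟩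
    · simp only [strip, Set.mem_ofPred_eq, mul_smul, ModularGroup.re_T_zpow_smul, Set.mem_Ico]
      push_cast
      constructor
      · linarith [Int.floor_le (γ • τ).re]
      · linarith [Int.lt_floor_add_one (γ • τ).re]
    · ext i
      have h2 := congrFun hγ i
      simp only at h2
      have h3 : (((d - 1 : ℕ) : ℤ) + 1) = d := by omega
      simp only [rowVec_apply, hγ', h2, h3]
      fin_cases i
      · simp [ha, mul_comm]
      · simp [hb, mul_comm]

variable {L : Submodule ℤ (Vpq p q)} {u u' ζ : Vpq p q} {N : ℕ} {f : ℍ → GrpAlg (dual L) L}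
  {g : Vpq p q ≃ₗ[ℝ] Vpq p q}

theorem continuous_unfTerm [DiscreteTopology L] [IsZLattice ℝ L] (hL : IsEven L)
    (hf : IsCuspForm L f) (α : Fin q → Fin p) (ha : 0 < normZperp g u) (t : ℕ) (x : Vpq p q) :
    Continuous fun τ => unfTerm L u u' ζ N f α g t τ x := by
  classical
  have := finite_quo L hL
  have := Fintype.ofFinite (Quo (dual L) L)
  have him : Continuous fun τ : ℍ => τ.im := UpperHalfPlane.continuous_im
  have him0 : ∀ τ : ℍ, τ.im ≠ 0 := fun τ => τ.im_pos.ne'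
  have him0' : ∀ τ : ℍ, (τ.im : ℂ) ≠ 0 := fun τ => by exact_mod_cast him0 τ
  have hs : ∀ τ : ℍ, Real.sqrt (2 * normZperp g u * τ.im) ≠ 0 := fun τ => by
    have := τ.im_pos
    positivity
  unfold unfTerm wKer
  simp only [finsum_prop_eq_sum_ite]
  refine ((Continuous.mul ?_ ?_).mul continuous_const).mul ((Continuous.mul ?_ ?_).mul ?_)
  · refine Complex.continuous_ofReal.comp (Continuous.div ?_ ?_ hs)
    · exact him.rpow_const fun τ => Or.inl (him0 τ)
    · exact (continuous_const.mul him).sqrt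
  · refine continuous_finsetSum _ fun δ _ => ?_
    split_ifs
    · exact continuous_const.mul (hf.continuous δ)
    · exact continuous_const
  · refine Complex.continuous_ofReal.comp (Real.continuous_exp.comp (Continuous.neg
      (continuous_const.div ((continuous_const.mul him).mul continuous_const) fun τ => ?_)))
    exact mul_ne_zero (mul_ne_zero two_ne_zero (him0 τ)) ha.ne'
  · refine continuous_finsetSum _ fun h _ => Continuous.mul (Continuous.pow ?_ _) ?_
    · refine continuous_const.div (continuous_const.mul (Complex.continuous_ofReal.comp him))
        fun τ => ?_
      exact mul_ne_zero (mul_ne_zero two_ne_zero Complex.I_ne_zero) (him0' τ)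
    · refine Complex.continuous_ofReal.comp ?_
      exact (continuousOn_expLap_left _ _).comp_continuous him fun τ => τ.im_pos
  · refine continuous_e.comp ?_
    have hc : Continuous fun τ : ℍ => (τ : ℂ) := UpperHalfPlane.continuous_coe
    exact ((Complex.continuous_conj.comp hc).mul continuous_const).neg.sub
      (hc.mul continuous_const)

end

section

variable {p q : ℕ}
variable {L : Submodule ℤ (Vpq p q)} {u u' ζ : Vpq p q} {N : ℕ} {f : ℍ → GrpAlg (dual L) L}
  {g : Vpq p q ≃ₗ[ℝ] Vpq p q}

/-! ### Unfolding -/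

theorem tsum_lintegral_ne_top {X ι : Type*} [MeasurableSpace X] {μ : Measure X} {S : Set X}
    (hS : MeasurableSet S) {F : ι → X → ℂ} {w : ι → ℝ} (hw : Summable w) (hw0 : ∀ i, 0 ≤ w i)
    {G : X → ℝ} (hG : IntegrableOn G S μ) (h : ∀ i, ∀ a ∈ S, ‖F i a‖ ≤ w i * G a) :
    ∑' i, ∫⁻ a in S, ‖F i a‖ₑ ∂μ ≠ ⊤ := by
  have h1 : ∀ i, ∫⁻ a in S, ‖F i a‖ₑ ∂μ ≤ ENNReal.ofReal (w i) * ∫⁻ a in S, ‖G a‖ₑ ∂μ := by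
    intro i
    rw [← lintegral_const_mul' _ _ ENNReal.ofReal_ne_top]
    refine setLIntegral_mono' hS fun a ha => ?_
    rw [← ofReal_norm, ← ofReal_norm, ← ENNReal.ofReal_mul (hw0 i)]
    refine ENNReal.ofReal_le_ofReal ((h i a ha).trans ?_)
    gcongr
    · exact hw0 i
    · exact Real.le_norm_self _
  refine ne_top_of_le_ne_top ?_ (ENNReal.tsum_le_tsum h1)
  rw [ENNReal.tsum_mul_right]
  exact ENNReal.mul_ne_top hw.tsum_ofReal_ne_top hG.2.ne

theorem lintegral_enorm_indicator {X : Type*} [MeasurableSpace X] {μ : Measure X} {S : Set X}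
    (hS : MeasurableSet S) (F : X → ℂ) :
    ∫⁻ a, ‖S.indicator F a‖ₑ ∂μ = ∫⁻ a in S, ‖F a‖ₑ ∂μ := by
  rw [← lintegral_indicator hS]
  simp_rw [enorm_indicator_eq_indicator_enorm]

variable [DiscreteTopology L] [IsZLattice ℝ L]

theorem exists_unfTerm_weight (H : IsotropicData L u u' ζ N) (hf : IsCuspForm L f)
    (α : Fin q → Fin p) (hg : IsSO g) :
    ∃ ε > 0, ∃ w : dualM L u u' → ℝ, Summable w ∧ (∀ y, 0 ≤ w y) ∧
      ∀ (t : ℕ) (τ : ℍ) (y : dualM L u u'), (1 ≤ t ∨ 1 / 2 ≤ τ.im) →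
        ‖unfTerm L u u' ζ N f α g t τ y‖ ≤
          (1 / (1 + (t : ℝ)) ^ 2) * w y * (τ.im ^ 2 * Real.exp (-(ε * τ.im))) := by
  obtain ⟨K, hK⟩ := H.exists_summable hg
  obtain ⟨C, hC, ε, hε, h⟩ := exists_unfTerm_bound H hf α hg K
  refine ⟨ε, hε, fun y => C * (1 / (1 + ‖gSharp g u y‖) ^ K), hK.mul_left C,
    fun y => by positivity, fun t τ y ht => (h t τ y ht).trans (le_of_eq (by ring))⟩

theorem summable_one_div_add_two_sq : Summable fun t : ℕ => 1 / (1 + ((t + 1 : ℕ) : ℝ)) ^ 2 := by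
  have h := (summable_nat_add_iff 2).2 (Real.summable_one_div_nat_pow.2 (le_refl 2))
  refine h.congr fun t => ?_
  push_cast
  ring_nf

theorem tsum_lintegral_unfTerm (H : IsotropicData L u u' ζ N) (hf : IsCuspForm L f)
    (α : Fin q → Fin p) (hg : IsSO g) :
    ∑' i : ℕ × dualM L u u', ∫⁻ τ in strip 0 1, ‖unfTerm L u u' ζ N f α g (i.1 + 1) τ i.2‖ₑ ≠
      ⊤ := by
  obtain ⟨ε, hε, w, hw, hw0, h⟩ := exists_unfTerm_weight H hf α hg
  refine tsum_lintegral_ne_top (measurableSet_strip 0 1)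
    (w := fun i : ℕ × dualM L u u' => (1 / (1 + ((i.1 + 1 : ℕ) : ℝ)) ^ 2) * w i.2)
    (summable_one_div_add_two_sq.mul_of_nonneg hw (fun t => by positivity) hw0)
    (fun i => mul_nonneg (by positivity) (hw0 _)) (integrableOn_im_sq_mul_exp 0 1 hε)
    fun i τ _ => h _ τ _ (Or.inl (by omega))

theorem fd_subset_strip : ModularGroup.fd ⊆ strip (-1) 1 := by
  rintro τ ⟨-, h⟩
  rw [abs_le] at h
  exact ⟨by linarith, by linarith⟩

theorem half_le_im_of_mem_fd {τ : ℍ} (h : τ ∈ ModularGroup.fd) : 1 / 2 ≤ τ.im := by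
  have h1 := ModularGroup.three_le_four_mul_im_sq_of_mem_fd h
  nlinarith [τ.im_pos]

theorem tsum_lintegral_unfTerm_zero (H : IsotropicData L u u' ζ N) (hf : IsCuspForm L f)
    (α : Fin q → Fin p) (hg : IsSO g) :
    ∑' y : dualM L u u', ∫⁻ τ in ModularGroup.fd, ‖unfTerm L u u' ζ N f α g 0 τ y‖ₑ ≠ ⊤ := by
  obtain ⟨ε, hε, w, hw, hw0, h⟩ := exists_unfTerm_weight H hf α hg
  refine tsum_lintegral_ne_top measurableSet_fd hw hw0
    ((integrableOn_im_sq_mul_exp (-1) 1 hε).mono_set fd_subset_strip)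
    fun y τ hτ => (h 0 τ y (Or.inr (half_le_im_of_mem_fd hτ))).trans (le_of_eq (by simp))

theorem integrableOn_charCoeff_zero (H : IsotropicData L u u' ζ N) (hf : IsCuspForm L f)
    (α : Fin q → Fin p) (hg : IsSO g) :
    IntegrableOn (fun τ => charCoeff f α g u τ 0) ModularGroup.fd := by
  have := H.countable_dualM
  have ha := normZperp_pos hg H.iso H.ne_zero
  have h := integrable_tsum_of_tsum_lintegral (fun y : dualM L u u' =>
    (continuous_unfTerm H.even hf α ha 0 (y : Vpq p q)).aestronglyMeasurable.restrict)
    (tsum_lintegral_unfTerm_zero H hf α hg)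
  refine h.congr (Filter.Eventually.of_forall fun τ => ?_)
  have h2 := hasSum_charCoeff_unfTerm H f α hg τ 0
  have h3 : (![0, ((0 : ℕ) : ℤ)] : Fin 2 → ℤ) = 0 := by
    ext i; fin_cases i <;> simp
  rw [h3] at h2
  exact h2.tsum_eq

/-- The kernel, unfolded at a point. -/
theorem hasSum_unfold_kernel (H : IsotropicData L u u' ζ N) (hf : IsCuspForm L f)
    (α : Fin q → Fin p) (hg : IsSO g) (τ : ℍ)
    (hs : Summable fun x : SL(2, ℤ) × ℕ × dualM L u u' => (strip 0 1).indicator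
      (fun τ => unfTerm L u u' ζ N f α g (x.2.1 + 1) τ x.2.2) (x.1 • τ)) :
    ∑' x : SL(2, ℤ) × ℕ × dualM L u u', (strip 0 1).indicator
      (fun τ => unfTerm L u u' ζ N f α g (x.2.1 + 1) τ x.2.2) (x.1 • τ) =
      kernel L f α g τ - charCoeff f α g u τ 0 := by
  have h1 := (Equiv.prodAssoc SL(2, ℤ) ℕ (dualM L u u')).hasSum_iff.2 hs.hasSum
  -- The sum over M' at γτ is C_{(0,t)}(γτ), which equivariance identifies with C_{(0,t)γ}(τ).
  have h2 : HasSum (fun x : SL(2, ℤ) × ℕ => Set.indicator {x | x.1 • τ ∈ strip 0 1}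
      (fun x => charCoeff f α g u τ (rowVec x)) x) _ := h1.prod_fiberwise fun x => by
    by_cases hx : x.1 • τ ∈ strip 0 1
    · rw [Set.indicator_of_mem (by exact hx)]
      have h3 := hasSum_charCoeff_unfTerm H f α hg (x.1 • τ) (x.2 + 1)
      rw [charCoeff_smul H.even hf α hg H.mem H.iso] at h3
      exact h3.congr_fun fun y => Set.indicator_of_mem hx
        (fun τ => unfTerm L u u' ζ N f α g (x.2 + 1) τ y)
    · rw [Set.indicator_of_notMem (by exact hx)]
      exact hasSum_zero.congr_fun fun y => Set.indicator_of_notMem hx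
        (fun τ => unfTerm L u u' ζ N f α g (x.2 + 1) τ y)
  have h4 := hasSum_subtype_iff_indicator.2 h2
  have h5 := (Equiv.ofBijective _ (bijective_rowVec τ)).hasSum_iff (f := fun n :
    {n : Fin 2 → ℤ // n ∉ ({0} : Finset (Fin 2 → ℤ))} => charCoeff f α g u τ n) |>.1 h4
  -- Restoring n = 0 gives summability over all of ℤ², and with it the convergence of the Fourier
  -- series to the kernel.
  have h6 := (Finset.hasSum_compl_iff (f := charCoeff f α g u τ) {0}).1 h5
  have h7 := (hasSum_charCoeff H.even f α hg H.mem H.iso τ h6.summable).unique h6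
  rw [h7, Finset.sum_singleton]
  simp

theorem unfold_kernel (H : IsotropicData L u u' ζ N) (hf : IsCuspForm L f)
    (α : Fin q → Fin p) (hg : IsSO g) :
    IntegrableOn (kernel L f α g) ModularGroup.fd ∧
    HasSum (fun i : ℕ × dualM L u u' =>
        2 * ∫ τ in strip 0 1, unfTerm L u u' ζ N f α g (i.1 + 1) τ i.2)
      (defInt L f α g - ∫ τ in ModularGroup.fd, charCoeff f α g u τ 0) := by
  have := H.countable_dualM
  have ha := normZperp_pos hg H.iso H.ne_zero
  have h := unfold_fd (A := fun (i : ℕ × dualM L u u') => (strip 0 1).indicator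
    fun τ => unfTerm L u u' ζ N f α g (i.1 + 1) τ i.2)
    (fun i => (continuous_unfTerm H.even hf α ha (i.1 + 1)
      (i.2 : Vpq p q)).aestronglyMeasurable.indicator (measurableSet_strip 0 1))
    (by
      simp_rw [lintegral_enorm_indicator (measurableSet_strip 0 1)]
      exact tsum_lintegral_unfTerm H hf α hg)
  obtain ⟨h1, h2, h3⟩ := h
  have h0 := integrableOn_charCoeff_zero H hf α hg
  have h4 : (fun τ => ∑' x : SL(2, ℤ) × ℕ × dualM L u u', (strip 0 1).indicator
      (fun τ => unfTerm L u u' ζ N f α g (x.2.1 + 1) τ x.2.2) (x.1 • τ))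
      =ᵐ[volume.restrict ModularGroup.fd]
      fun τ => kernel L f α g τ - charCoeff f α g u τ 0 :=
    h1.mono fun τ hτ => hasSum_unfold_kernel H hf α hg τ hτ
  have h5 := Integrable.congr h2 h4
  -- Convergence of the defining integral is a by-product: the kernel is the unfolded sum plus C₀,
  -- both integrable.
  have h6 : IntegrableOn (kernel L f α g) ModularGroup.fd := by
    have h7 := h5.add h0
    refine h7.congr (Filter.Eventually.of_forall fun τ => ?_)
    simp
  refine ⟨h6, ?_⟩
  rw [integral_congr_ae h4, integral_sub h6 h0] at h3
  simp_rw [integral_indicator (measurableSet_strip 0 1)] at h3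
  exact h3

end

section

variable {p q : ℕ}
variable {L : Submodule ℤ (Vpq p q)} {u u' ζ : Vpq p q} {N : ℕ} {f : ℍ → GrpAlg (dual L) L}
  {g : Vpq p q ≃ₗ[ℝ] Vpq p q}

/-! ### The constant term -/

theorem latM_le_dualM (hL : IsEven L) (u u' : Vpq p q) : latM L u u' ≤ dualM L u u' := by
  rintro x ⟨hx, h1, h2⟩
  exact ⟨mem_dual.2 fun y hy => exists_form_int (hL.le_dual hx) hy.1, h1, h2⟩

theorem liesOver_add_iff {δ : Quo (dual L) L} {x l : Vpq p q} (hl : l ∈ latM L u u') :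
    LiesOver L u u' ζ N δ (x + l) ↔ LiesOver L u u' ζ N δ x := by
  refine and_congr_right fun _ => ?_
  rw [← sub_sub]
  exact ⟨fun h => by simpa using (latM L u u').add_mem h hl, fun h => (latM L u u').sub_mem h hl⟩

theorem rep_injOn_liesOver (δ : Quo (dual L) L) {γ γ' : Quo (dualM L u u') (latM L u u')}
    (h : LiesOver L u u' ζ N δ (rep γ)) (h' : LiesOver L u u' ζ N δ (rep γ')) : γ = γ' := by
  rw [← mk_rep γ, ← mk_rep γ', quo_mk_eq_iff]
  simpa using (latM L u u').sub_mem h'.2 h.2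

/-- Each of the finitely many classes δ lies over at most one class of M'/M, so the scalar product
is a finite sum. -/
theorem finite_support_FM [Finite (Quo (dual L) L)] (τ : ℍ) :
    (Function.support (FM L u u' ζ N f τ)).Finite := by
  refine Set.Finite.subset (Set.finite_iUnion (ι := Quo (dual L) L) (f := fun δ =>
    {γ | LiesOver L u u' ζ N δ (rep γ)}) fun δ => Set.Subsingleton.finite fun γ h γ' h' =>
      rep_injOn_liesOver δ h h') fun γ hγ => ?_
  by_contra hc
  rw [Set.mem_iUnion, not_exists] at hc
  apply hγ
  rw [FM]
  refine finsum_eq_zero_of_forall_eq_zero fun δ => ?_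
  have : IsEmpty (LiesOver L u u' ζ N δ (rep γ)) := ⟨fun h => hc δ h⟩
  exact finsum_of_isEmpty _

theorem wKer_zero (α : Fin q → Fin p) (τ : ℍ) (x : Vpq p q) :
    wKer α g u 0 τ x = starRingEnd ℂ ((expLap τ.im (redPoly (polyP α) g u 0) (gSharp g u x) : ℂ) *
      e ((τ : ℂ) * (qf (projWperp g u x) : ℝ) +
        starRingEnd ℂ (τ : ℂ) * (qf (projW g u x) : ℝ))) := by
  rw [wKer, Finset.sum_eq_single 0]
  · rw [map_mul, conj_e]
    simp only [Complex.conj_ofReal, map_add, map_mul, Complex.conj_conj]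
    simp
    left
    congr 1
    ring
  · intro h _ hh
    simp [hh]
  · simp

theorem constFactor (ha : 0 < normZperp g u) (τ : ℍ) :
    τ.im ^ wt p q / Real.sqrt (2 * normZperp g u * τ.im) =
      τ.im ^ (((p : ℝ) + q) / 2) / (Real.sqrt 2 * Real.sqrt (normZperp g u)) *
        τ.im ^ (((q : ℝ) - 1) / 2) := by
  have hy := τ.im_pos
  have h1 : wt p q = ((p : ℝ) + q) / 2 + ((q : ℝ) - 1) / 2 + 1 / 2 := by rw [wt]; ring
  rw [Real.sqrt_mul (by positivity), Real.sqrt_mul (by positivity), h1, Real.rpow_add hy,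
    Real.rpow_add hy, ← Real.sqrt_eq_rpow]
  field_simp

variable [DiscreteTopology L] [IsZLattice ℝ L]

/-- The coefficient n = 0 is the case t = 0 of the line integrals, where only h = 0 survives;
grouping M' into cosets of M gives the theta function. -/
theorem constKernel_eq (H : IsotropicData L u u' ζ N) (f : ℍ → GrpAlg (dual L) L)
    (α : Fin q → Fin p) (hg : IsSO g) (τ : ℍ) :
    constKernel L u u' ζ N f α g τ = charCoeff f α g u τ 0 := by
  have := finite_quo L H.even
  have ha := normZperp_pos hg H.iso H.ne_zero
  have hle := latM_le_dualM H.even u u'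
  have h0 : (![0, ((0 : ℕ) : ℤ)] : Fin 2 → ℤ) = 0 := by
    ext i; fin_cases i <;> simp
  have h1 := hasSum_charCoeff_unfTerm H f α hg τ 0
  rw [h0] at h1
  set c : ℂ := ((τ.im ^ (((p : ℝ) + q) / 2) / (Real.sqrt 2 * Real.sqrt (normZperp g u)) : ℝ) : ℂ)
    with hc
  set b : ℂ := ((τ.im ^ (((q : ℝ) - 1) / 2) : ℝ) : ℂ) with hb
  set G : Vpq p q → ℂ := fun x =>
    (expLap τ.im (redPoly (polyP α) g u 0) (gSharp g u x) : ℂ) *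
      e ((τ : ℂ) * (qf (projWperp g u x) : ℝ) +
        starRingEnd ℂ (τ : ℂ) * (qf (projW g u x) : ℝ)) with hG
  have h2 : ∀ z : Quo (dualM L u u') (latM L u u') × latM L u u',
      unfTerm L u u' ζ N f α g 0 τ (quoEquiv hle z) =
        c * FM L u u' ζ N f τ z.1 * (b * starRingEnd ℂ (G (rep z.1 + z.2))) := by
    intro z
    rw [coe_quoEquiv, unfTerm, constFactor ha, wKer_zero, FM]
    simp only [liesOver_add_iff z.2.2, Nat.cast_zero, zero_mul, Complex.ofReal_zero, e_zero,
      one_mul, mul_one]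
    rw [Complex.ofReal_mul, ← hc, ← hb]
    ring
  have h3 := (quoEquiv hle).hasSum_iff.2 h1
  have h4 := h3.prod_fiberwise fun γ => (h3.summable.prod_factor γ).hasSum
  have h5 : ∀ γ, ∑' l : latM L u u', ((fun y : dualM L u u' => unfTerm L u u' ζ N f α g 0 τ y) ∘
      quoEquiv hle) (γ, l) = c * (FM L u u' ζ N f τ γ *
        starRingEnd ℂ (thetaM L u u' (redPoly (polyP α) g u 0) g τ γ)) := by
    intro γ
    simp only [Function.comp_apply, h2]
    rw [tsum_mul_left, tsum_mul_left, thetaM, map_mul, Complex.conj_ofReal, ← hb,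
      Complex.conj_tsum]
    ring
  simp_rw [h5] at h4
  rw [← h4.tsum_eq, tsum_mul_left, constKernel, scal, tsum_eq_finsum]
  refine (finite_support_FM (f := f) (u := u) (u' := u') (ζ := ζ) (N := N) τ).subset fun γ hγ => ?_
  intro h
  apply hγ
  simp only [h, zero_mul]

end

section

variable {p q : ℕ}
variable {L : Submodule ℤ (Vpq p q)} {u u' ζ : Vpq p q} {N : ℕ} {f : ℍ → GrpAlg (dual L) L}
  {g : Vpq p q ≃ₗ[ℝ] Vpq p q}

/-! ### The integral over `y` -/

/-- For x ⊥ u the contributions of u_z and u_{z^⊥} to q(x) cancel. -/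
theorem qf_projWperp_add_qf_projW (hg : IsSO g) (hu0 : form p q u u = 0)
    (ha : 0 < normZperp g u) {x : Vpq p q} (hx : form p q x u = 0) :
    qf (projWperp g u x) + qf (projW g u x) = qf x := by
  have hz : normZ g u ≠ 0 := by rw [normZ_eq_neg hg hu0]; exact neg_ne_zero.2 ha.ne'
  have h1 := qf_projZperp_eq_add hg ha.ne' x
  have h2 := qf_projZ_eq_add hg hz x
  rw [normZ_eq_neg hg hu0, form_projZ_eq, hx] at h2
  have h3 : qf (projZperp g x) + qf (projZ g x) = qf x := by
    conv_rhs => rw [← projZperp_add_projZ g x]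
    simp only [qf, map_add, LinearMap.add_apply, form_projZperp_projZ hg,
      form_comm (projZ g x) (projZperp g x)]
    ring
  have h4 : (0 - form p q x (projZperp g u)) ^ 2 / (2 * -normZperp g u) =
      -(form p q x (projZperp g u) ^ 2 / (2 * normZperp g u)) := by
    field_simp
    ring
  rw [h4] at h2
  linarith

theorem qf_le_qf_projWperp (hg : IsSO g) (hu0 : form p q u u = 0)
    (ha : 0 < normZperp g u) {x : Vpq p q} (hx : form p q x u = 0) :
    qf x ≤ qf (projWperp g u x) := by
  rw [← qf_projWperp_add_qf_projW hg hu0 ha hx, qf_projW_eq_sum hg]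
  have : 0 ≤ ∑ i, gSharp g u x (Sum.inr i) ^ 2 := Finset.sum_nonneg fun _ _ => sq_nonneg _
  linarith

theorem continuousOn_yKernel (u : Vpq p q) (α : Fin q → Fin p) (g : Vpq p q ≃ₗ[ℝ] Vpq p q)
    (ha : 0 < normZperp g u) (lam : Vpq p q) (t h : ℕ) :
    ContinuousOn (yKernel u α g lam t h) (Set.Ioi 0) := by
  unfold yKernel
  refine ContinuousOn.mul (ContinuousOn.mul ?_ ?_) (continuousOn_expLap_left _ _)
  · exact continuousOn_id.rpow_const fun y hy => Or.inl (ne_of_gt hy)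
  · refine Real.continuous_exp.comp_continuousOn (ContinuousOn.sub (by fun_prop)
      (ContinuousOn.div (by fun_prop) (by fun_prop) fun y hy => ?_))
    have hy : 0 < y := hy
    positivity

/-- The factor e^{-c/y} controls y → 0 and λ_{w^⊥}² > 0 controls y → ∞. -/
theorem integrableOn_yKernel (u : Vpq p q) (α : Fin q → Fin p)
    (ha : 0 < normZperp g u) {lam : Vpq p q} (hl : 0 < qf (projWperp g u lam)) {t : ℕ}
    (ht : 1 ≤ t) (h : ℕ) : IntegrableOn (yKernel u α g lam t h) (Set.Ioi 0) := by
  obtain ⟨C₁, hC₁, A₁, h₁⟩ := exists_expLap_bound (redPoly (polyP α) g u h)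
  obtain ⟨R, hR⟩ := exists_nat_ge |(q : ℝ) + ((p : ℝ) - 5) / 2 - h|
  set a := normZperp g u with hadef
  set B := qf (projWperp g u lam) with hB
  set x := gSharp g u ((1 / (t : ℝ)) • lam) with hx
  have ht0 : (0 : ℝ) < t := by exact_mod_cast ht
  set c : ℝ := Real.pi * (t : ℝ) ^ 2 / (2 * a) with hc
  set d : ℝ := 4 * Real.pi * B / (t : ℝ) ^ 2 with hd
  have hc0 : 0 < c := by positivity
  have hd0 : 0 < d := by positivity
  obtain ⟨C₂, hC₂, h₂⟩ := exists_pow_mul_exp_neg_bound (R + A₁) hc0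
  obtain ⟨C₃, hC₃, h₃⟩ := exists_pow_mul_exp_neg_bound R (half_pos hd0)
  have hint : IntegrableOn (fun y : ℝ => C₁ * (1 + ‖x‖) ^ A₁ * C₂ * C₃ *
      Real.exp (-(d / 2 * y))) (Set.Ioi 0) := by
    have := exp_neg_integrableOn_Ioi 0 (half_pos hd0)
    simp only [neg_mul] at this
    exact this.const_mul _
  refine Integrable.mono' hint
    ((continuousOn_yKernel u α g ha lam t h).aestronglyMeasurable measurableSet_Ioi) ?_
  refine ae_restrict_of_forall_mem measurableSet_Ioi fun y hy => ?_
  have hy : 0 < y := hy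
  have e1 : Real.exp (-(2 * Real.pi * y * form p q (projWperp g u lam) (projWperp g u lam) /
      (t : ℝ) ^ 2) - Real.pi * (t : ℝ) ^ 2 / (2 * y * a)) =
      Real.exp (-(d / 2 * y)) * Real.exp (-(d / 2 * y)) * Real.exp (-(c * (1 / y))) := by
    rw [← Real.exp_add, ← Real.exp_add]
    congr 1
    have : form p q (projWperp g u lam) (projWperp g u lam) = 2 * B := by rw [hB, qf]; ring
    rw [this, hc, hd]
    field_simp
    ring
  rw [yKernel, ← hadef, e1, Real.norm_eq_abs, abs_mul, abs_mul, ← hx,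
    abs_of_pos (Real.rpow_pos_of_pos hy _),
    abs_of_pos (by positivity :
      0 < Real.exp (-(d / 2 * y)) * Real.exp (-(d / 2 * y)) * Real.exp (-(c * (1 / y))))]
  calc _ ≤ ((1 + 1 / y) ^ R * (1 + y) ^ R) *
        (Real.exp (-(d / 2 * y)) * Real.exp (-(d / 2 * y)) * Real.exp (-(c * (1 / y)))) *
        (C₁ * (1 + 1 / y) ^ A₁ * (1 + ‖x‖) ^ A₁) := by
        gcongr
        · exact rpow_le_pow_mul_pow hy hR
        · exact h₁ y hy x
    _ = C₁ * (1 + ‖x‖) ^ A₁ * ((1 + 1 / y) ^ (R + A₁) * Real.exp (-(c * (1 / y)))) *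
        ((1 + y) ^ R * Real.exp (-(d / 2 * y))) * Real.exp (-(d / 2 * y)) := by ring
    _ ≤ C₁ * (1 + ‖x‖) ^ A₁ * C₂ * C₃ * Real.exp (-(d / 2 * y)) := by
        gcongr
        · exact h₂ _ (by positivity)
        · exact h₃ _ hy.le

/-! ### The integral over `x` -/

/-- The factor of the coefficient that depends on the Fourier coefficients of `f`. -/
def arithFactor (L : Submodule ℤ (Vpq p q)) (u u' ζ : Vpq p q) (N : ℕ)
    (f : ℍ → GrpAlg (dual L) L) (t : ℕ) (x : Vpq p q) : ℂ :=
  ∑ᶠ (δ : Quo (dual L) L) (_ : LiesOver L u u' ζ N δ x),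
    e ((t : ℕ) * (form p q (rep δ) u' : ℝ)) * fcoeff f δ (qf x)

/-- A representative v ∈ u^⊥ has q(v) = q(projection of v), because it differs from it by a multiple
of u. So q(x) is an admissible exponent for f_δ. -/
theorem IsotropicData.qf_of_liesOver (H : IsotropicData L u u' ζ N) {δ : Quo (dual L) L}
    {x : Vpq p q} (h : LiesOver L u u' ζ N δ x) : ∃ m : ℤ, qf x = m + qf (rep δ) := by
  obtain ⟨v, hv, rfl, rfl⟩ := H.exists_of_liesOver h
  have h1 : qf (projM u u' v) = qf (v : Vpq p q) := by
    rw [projM_of_form_eq_zero u' hv]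
    simp only [qf, map_sub, map_smul, LinearMap.sub_apply, LinearMap.smul_apply, hv,
      form_comm u (v : Vpq p q), H.iso]
    simp
  have h2 := e_qf_rep H.even v
  have h3 : e ((qf (v : Vpq p q) -
      qf (rep (Submodule.Quotient.mk v : Quo (dual L) L)) : ℝ)) = 1 := by
    rw [Complex.ofReal_sub, sub_eq_add_neg, e_add, ← h2, mul_comm, e_neg_mul_self]
  obtain ⟨m, hm⟩ := (e_eq_one_iff _).1 h3
  exact ⟨m, by rw [h1]; linarith⟩

theorem arithFactor_eq_zero (H : IsotropicData L u u' ζ N) (hf : IsCuspForm L f) (t : ℕ)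
    {x : Vpq p q} (hx : qf x ≤ 0) : arithFactor L u u' ζ N f t x = 0 := by
  classical
  refine finsum_eq_zero_of_forall_eq_zero fun δ => ?_
  rw [finsum_eq_if, ite_eq_right_iff]
  intro h
  rw [hf.fcoeff_eq_zero δ (H.qf_of_liesOver h) hx, mul_zero]

/-- The point `iy` of the upper half-plane. -/
def imPt (y : ℝ) (hy : 0 < y) : ℍ := ⟨y * Complex.I, by simpa using hy⟩

theorem ofComplex_eq_vadd (x : ℝ) {y : ℝ} (hy : 0 < y) :
    UpperHalfPlane.ofComplex ((x : ℂ) + y * Complex.I) = x +ᵥ imPt y hy := by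
  have h : ((x : ℂ) + y * Complex.I) = ((x +ᵥ imPt y hy : ℍ) : ℂ) := by
    rw [UpperHalfPlane.coe_vadd]
    rfl
  rw [h, UpperHalfPlane.ofComplex_apply]

theorem im_vadd_imPt (x : ℝ) {y : ℝ} (hy : 0 < y) : (x +ᵥ imPt y hy).im = y := by
  rw [UpperHalfPlane.vadd_im]
  change (y * Complex.I : ℂ).im = y
  simp

/-- Writing τ̄ = τ - 2iy separates the holomorphic phase e(-q(x)τ), which extracts a Fourier
coefficient of f, from a real factor depending on y only. -/
theorem e_projW (hg : IsSO g) (hu0 : form p q u u = 0) (ha : 0 < normZperp g u) {x : Vpq p q}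
    (hx : form p q x u = 0) (τ : ℍ) :
    e (-(starRingEnd ℂ (τ : ℂ) * (qf (projWperp g u x) : ℝ)) - (τ : ℂ) * (qf (projW g u x) : ℝ)) =
      e (-((qf x : ℝ) * (τ : ℂ))) *
        (Real.exp (-(4 * Real.pi * τ.im * qf (projWperp g u x))) : ℝ) := by
  rw [← qf_projWperp_add_qf_projW hg hu0 ha hx]
  set A := qf (projWperp g u x)
  set B := qf (projW g u x)
  have h1 : starRingEnd ℂ (τ : ℂ) = τ - 2 * τ.im * Complex.I := by
    apply Complex.ext <;> simp
    ring
  have h2 : ((Real.exp (-(4 * Real.pi * τ.im * A)) : ℝ) : ℂ) = e (2 * τ.im * Complex.I * A) := by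
    rw [e, Complex.ofReal_exp]
    congr 1
    push_cast
    linear_combination (-4 * Real.pi * τ.im * A : ℂ) * Complex.I_sq
  rw [h2, ← e_add, h1]
  congr 1
  push_cast
  ring

variable [DiscreteTopology L] [IsZLattice ℝ L]

theorem projWperp_smul (g : Vpq p q ≃ₗ[ℝ] Vpq p q) (u : Vpq p q) (c : ℝ) (x : Vpq p q) :
    projWperp g u (c • x) = c • projWperp g u x := by
  rw [projWperp, projWperp, projZperp_smul, map_smul, LinearMap.smul_apply, smul_sub, smul_smul,
    smul_eq_mul, mul_div_assoc]

theorem unfTerm_factor (ha : 0 < normZperp g u) (α : Fin q → Fin p)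
    {t : ℕ} (ht : 1 ≤ t) (x : Vpq p q) (h : ℕ) {y : ℝ} (hy : 0 < y) :
    1 / y ^ 2 * (y ^ wt p q / Real.sqrt (2 * normZperp g u * y)) *
      Real.exp (-(Real.pi * t ^ 2 / (2 * y * normZperp g u))) *
      Real.exp (-(4 * Real.pi * y * qf (projWperp g u x))) * (1 / y) ^ h *
      expLap y (redPoly (polyP α) g u h) (gSharp g u x) =
    1 / Real.sqrt (2 * normZperp g u) * yKernel u α g ((t : ℝ) • x) t h y := by
  have ht0 : (t : ℝ) ≠ 0 := by exact_mod_cast (by omega : t ≠ 0)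
  -- The excess over the exponent in `yKernel`: 1/2 for the square root, 2 for the measure, h for
  -- the power of 1/y.
  have h1 : wt p q = ((q : ℝ) + ((p : ℝ) - 5) / 2 - h) + 1 / 2 + ((2 : ℕ) : ℝ) + (h : ℝ) := by
    rw [wt]; push_cast; ring
  have h2 : form p q (projWperp g u ((t : ℝ) • x)) (projWperp g u ((t : ℝ) • x)) =
      t ^ 2 * (2 * qf (projWperp g u x)) := by
    rw [projWperp_smul, qf, map_smul, map_smul, LinearMap.smul_apply, smul_eq_mul, smul_eq_mul]
    ring
  have h3 : 2 * Real.pi * y * (t ^ 2 * (2 * qf (projWperp g u x))) / (t : ℝ) ^ 2 =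
      4 * Real.pi * y * qf (projWperp g u x) := by
    field_simp
    ring
  rw [yKernel, h2, smul_smul, one_div_mul_cancel ht0, one_smul, h3,
    sub_eq_add_neg (-(4 * Real.pi * y * qf (projWperp g u x))), Real.exp_add,
    Real.sqrt_mul (by positivity : 0 ≤ 2 * normZperp g u), h1, Real.rpow_add hy, Real.rpow_add hy,
    Real.rpow_add hy, Real.rpow_natCast, Real.rpow_natCast, ← Real.sqrt_eq_rpow]
  field_simp
  rw [← mul_pow, mul_one_div_cancel hy.ne', one_pow, one_mul]

theorem integral_coordFn_unfTerm (H : IsotropicData L u u' ζ N) (hf : IsCuspForm L f)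
    (α : Fin q → Fin p) (hg : IsSO g) {t : ℕ} (ht : 1 ≤ t) {x : Vpq p q} (hx : form p q x u = 0)
    {y : ℝ} (hy : 0 < y) :
    ∫ s in (0 : ℝ)..1, coordFn (fun τ => unfTerm L u u' ζ N f α g t τ x) (s, y) =
      e ((t * form p q x (mu g u u') : ℝ) : ℂ) * ((1 / Real.sqrt (2 * normZperp g u) : ℝ) : ℂ) *
      ∑ h ∈ Finset.range (q + 1), ((t : ℂ) / (2 * Complex.I)) ^ h * arithFactor L u u' ζ N f t x *
        (yKernel u α g ((t : ℝ) • x) t h y : ℂ) := by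
  classical
  have := finite_quo L H.even
  have := Fintype.ofFinite (Quo (dual L) L)
  have ha := normZperp_pos hg H.iso H.ne_zero
  set τ := imPt y hy with hτ
  set K : ℂ := e ((t * form p q x (mu g u u') : ℝ) : ℂ) *
    ((1 / y ^ 2 * (y ^ wt p q / Real.sqrt (2 * normZperp g u * y)) *
      Real.exp (-(Real.pi * t ^ 2 / (2 * y * normZperp g u))) *
      Real.exp (-(4 * Real.pi * y * qf (projWperp g u x))) : ℝ) : ℂ) *
    ∑ h ∈ Finset.range (q + 1), ((t : ℂ) / (2 * Complex.I * y)) ^ h *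
      (expLap y (redPoly (polyP α) g u h) (gSharp g u x) : ℂ) with hK
  have h1 : ∀ s : ℝ, coordFn (fun τ => unfTerm L u u' ζ N f α g t τ x) (s, y) =
      K * ∑ δ : Quo (dual L) L, if LiesOver L u u' ζ N δ x then
        e ((t : ℕ) * (form p q (rep δ) u' : ℝ)) *
          (f (s +ᵥ τ) δ * e (-((qf x : ℝ) * (s + (τ : ℂ))))) else 0 := by
    intro s
    have h2 : ∀ δ : Quo (dual L) L, (if LiesOver L u u' ζ N δ x then
        e ((t : ℕ) * (form p q (rep δ) u' : ℝ)) *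
          (f (s +ᵥ τ) δ * e (-((qf x : ℝ) * (s + (τ : ℂ))))) else 0) =
        (if LiesOver L u u' ζ N δ x then
        e ((t * form p q (rep δ) u' : ℝ) : ℂ) * f (s +ᵥ τ) δ else 0) *
          e (-((qf x : ℝ) * (s + (τ : ℂ)))) := by
      intro δ
      split_ifs
      · push_cast; ring
      · simp
    simp_rw [h2]
    rw [← Finset.sum_mul, coordFn]
    simp only [ofComplex_eq_vadd s hy]
    rw [unfTerm, wKer, im_vadd_imPt, e_projW hg H.iso ha hx, im_vadd_imPt,
      finsum_prop_eq_sum_ite, UpperHalfPlane.coe_vadd, hK]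
    push_cast
    ring
  have h3 : ∀ δ : Quo (dual L) L, Continuous fun s : ℝ =>
      f (s +ᵥ τ) δ * e (-((qf x : ℝ) * (s + (τ : ℂ)))) := fun δ => by
    refine Continuous.mul ?_ (by fun_prop)
    refine (hf.continuous δ).comp ?_
    rw [UpperHalfPlane.isEmbedding_coe.continuous_iff]
    change Continuous fun s : ℝ => ((s +ᵥ τ : ℍ) : ℂ)
    simp only [UpperHalfPlane.coe_vadd]
    fun_prop
  simp_rw [h1]
  rw [intervalIntegral.integral_const_mul, intervalIntegral.integral_finsetSum]
  · have h4 : ∑ δ : Quo (dual L) L, (∫ s in (0 : ℝ)..1, if LiesOver L u u' ζ N δ x then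
        e ((t : ℕ) * (form p q (rep δ) u' : ℝ)) *
          (f (s +ᵥ τ) δ * e (-((qf x : ℝ) * (s + (τ : ℂ))))) else 0) =
        arithFactor L u u' ζ N f t x := by
      rw [arithFactor, finsum_prop_eq_sum_ite]
      refine Finset.sum_congr rfl fun δ _ => ?_
      split_ifs with hδ
      · rw [intervalIntegral.integral_const_mul, hf.integral_eq_fcoeff δ τ (H.qf_of_liesOver hδ)]
      · simp
    rw [h4, hK, Finset.mul_sum, Finset.sum_mul, Finset.mul_sum]
    refine Finset.sum_congr rfl fun h _ => ?_
    have h5 := congrArg (fun r : ℝ => (r : ℂ)) (unfTerm_factor ha α ht x h hy)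
    simp only [Complex.ofReal_mul (1 / Real.sqrt (2 * normZperp g u))] at h5
    have h6 : ((t : ℂ) / (2 * Complex.I * y)) ^ h =
        ((t : ℂ) / (2 * Complex.I)) ^ h * (((1 / y) ^ h : ℝ) : ℂ) := by
      rw [Complex.ofReal_pow, ← mul_pow]
      congr 1
      push_cast
      rw [div_mul_div_comm, mul_one]
    calc _ = e ((t * form p q x (mu g u u') : ℝ) : ℂ) *
        (((t : ℂ) / (2 * Complex.I)) ^ h) * arithFactor L u u' ζ N f t x *
        (((1 / Real.sqrt (2 * normZperp g u) : ℝ) : ℂ) *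
          (yKernel u α g ((t : ℝ) • x) t h y : ℂ)) := by
          rw [← h5, h6]
          push_cast
          ring
      _ = _ := by ring
  · intro δ _
    split_ifs
    · exact (continuous_const.mul (h3 δ)).intervalIntegrable _ _
    · exact intervalIntegrable_const

theorem integral_unfTerm (H : IsotropicData L u u' ζ N) (hf : IsCuspForm L f)
    (α : Fin q → Fin p) (hg : IsSO g) {t : ℕ} (ht : 1 ≤ t) {x : Vpq p q}
    (hx : x ∈ dualM L u u') :
    2 * ∫ τ in strip 0 1, unfTerm L u u' ζ N f α g t τ x =
      ((Real.sqrt 2 / Real.sqrt (normZperp g u) : ℝ) : ℂ) *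
      (∑ h ∈ Finset.range (q + 1), ((t : ℂ) / (2 * Complex.I)) ^ h * arithFactor L u u' ζ N f t x *
        ((∫ y in Set.Ioi (0 : ℝ), yKernel u α g ((t : ℝ) • x) t h y : ℝ) : ℂ)) *
      e ((t * form p q x (mu g u u') : ℝ) : ℂ) := by
  have ha := normZperp_pos hg H.iso H.ne_zero
  have hint : IntegrableOn (fun τ => unfTerm L u u' ζ N f α g t τ x) (strip 0 1) := by
    obtain ⟨ε, hε, w, -, -, h⟩ := exists_unfTerm_weight H hf α hg
    refine Integrable.mono' ((integrableOn_im_sq_mul_exp 0 1 hε).const_mul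
      (1 / (1 + (t : ℝ)) ^ 2 * w ⟨x, hx⟩))
      (continuous_unfTerm H.even hf α ha t x).aestronglyMeasurable.restrict
      (Filter.Eventually.of_forall fun τ => h t τ ⟨x, hx⟩ (Or.inl ht))
  rw [setIntegral_strip zero_le_one hint,
    setIntegral_congr_fun measurableSet_Ioi
      fun y hy => integral_coordFn_unfTerm H hf α hg ht hx.2.1 hy, integral_const_mul]
  -- The 2 is the double covering by ±γ.
  have h1 : Real.sqrt 2 / Real.sqrt (normZperp g u) = 2 * (1 / Real.sqrt (2 * normZperp g u)) := by
    rw [Real.sqrt_mul (by norm_num)]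
    have : Real.sqrt 2 * Real.sqrt 2 = 2 := Real.mul_self_sqrt (by norm_num)
    field_simp
    linarith
  have h2 : ∫ y in Set.Ioi (0 : ℝ), ∑ h ∈ Finset.range (q + 1),
      ((t : ℂ) / (2 * Complex.I)) ^ h * arithFactor L u u' ζ N f t x *
        (yKernel u α g ((t : ℝ) • x) t h y : ℂ) =
      ∑ h ∈ Finset.range (q + 1), ((t : ℂ) / (2 * Complex.I)) ^ h * arithFactor L u u' ζ N f t x *
        ((∫ y in Set.Ioi (0 : ℝ), yKernel u α g ((t : ℝ) • x) t h y : ℝ) : ℂ) := by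
    -- If q(x) ≤ 0 the arithmetic factor vanishes and no convergence of the integrals is needed.
    rcases le_or_gt (qf x) 0 with h0 | h0
    · simp [arithFactor_eq_zero H hf t h0]
    · rw [integral_finsetSum]
      · refine Finset.sum_congr rfl fun h _ => ?_
        rw [integral_const_mul, integral_complex_ofReal]
      · intro h _
        refine Integrable.const_mul (Integrable.ofReal (integrableOn_yKernel u α ha ?_ ht h)) _
        have ht0 : (0 : ℝ) < t := by exact_mod_cast ht
        rw [projWperp_smul, qf_smul]
        have := h0.trans_le (qf_le_qf_projWperp hg H.iso ha hx.2.1)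
        positivity
  rw [h2, h1]
  push_cast
  ring

end

section

variable {p q : ℕ}
variable {L : Submodule ℤ (Vpq p q)} {u u' ζ : Vpq p q} {N : ℕ} {f : ℍ → GrpAlg (dual L) L}
  {g : Vpq p q ≃ₗ[ℝ] Vpq p q}

/-! ### The Fourier expansion -/

/-- The summand of index `t` of the coefficient of index `lam`. -/
def divTerm (L : Submodule ℤ (Vpq p q)) (u u' ζ : Vpq p q) (N : ℕ)
    (f : ℍ → GrpAlg (dual L) L) (α : Fin q → Fin p) (lam : Vpq p q)
    (g : Vpq p q ≃ₗ[ℝ] Vpq p q) (t : ℕ) : ℂ :=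
  ((Real.sqrt 2 / Real.sqrt (normZperp g u) : ℝ) : ℂ) *
    ∑ h ∈ Finset.range (q + 1), ((t : ℂ) / (2 * Complex.I)) ^ h *
      arithFactor L u u' ζ N f t ((1 / (t : ℝ)) • lam) *
      ((∫ y in Set.Ioi (0 : ℝ), yKernel u α g lam t h y : ℝ) : ℂ)

theorem qf_one_div_smul (t : ℕ) (x : Vpq p q) : qf ((1 / (t : ℝ)) • x) = qf x / (t : ℝ) ^ 2 := by
  rw [qf_smul]
  ring

theorem unfCoeff_eq (L : Submodule ℤ (Vpq p q)) (u u' ζ : Vpq p q) (N : ℕ)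
    (f : ℍ → GrpAlg (dual L) L) (α : Fin q → Fin p) (lam : Vpq p q)
    (g : Vpq p q ≃ₗ[ℝ] Vpq p q) : unfCoeff L u u' ζ N f α lam g =
      ∑' t : Divs L u u' lam, divTerm L u u' ζ N f α lam g t := by
  simp only [unfCoeff, divTerm, arithFactor, qf_one_div_smul]

/-- The pairs `(lam,t)` with `t ∣ lam`, as pairs `(t - 1, lam / t)`. -/
def divPair (z : Σ lam : dualM L u u', Divs L u u' (lam : Vpq p q)) : ℕ × dualM L u u' :=
  ((z.2 : ℕ) - 1, ⟨(1 / ((z.2 : ℕ) : ℝ)) • (z.1 : Vpq p q), z.2.2.2⟩)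

/-- The substitution λ = tx turns the sum over t ≥ 1 and x ∈ M' into a sum over λ and its divisors.
-/
theorem bijective_divPair (L : Submodule ℤ (Vpq p q)) (u u' : Vpq p q) :
    Function.Bijective (divPair (L := L) (u := u) (u' := u')) := by
  constructor
  · rintro ⟨⟨lam, hl⟩, t, ht⟩ ⟨⟨lam', hl'⟩, t', ht'⟩ h
    simp only [divPair, Prod.mk.injEq, Subtype.mk.injEq] at h
    obtain ⟨h1, h2⟩ := h
    have h3 : t = t' := by
      have := ht.1
      have := ht'.1
      omega
    subst h3
    have ht0 : (1 / (t : ℝ)) ≠ 0 := one_div_ne_zero (by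
      exact_mod_cast (by have := ht.1; omega : t ≠ 0))
    have h4 : lam = lam' := smul_right_injective _ ht0 h2
    subst h4
    rfl
  · rintro ⟨t, x, hx⟩
    have ht0 : ((t + 1 : ℕ) : ℝ) ≠ 0 := by positivity
    have h1 : (1 / ((t + 1 : ℕ) : ℝ)) • ((t + 1 : ℕ) : ℝ) • x = x := by
      rw [smul_smul, one_div_mul_cancel ht0, one_smul]
    have h2 : ((t + 1 : ℕ) : ℝ) • x ∈ dualM L u u' := by
      rw [Nat.cast_smul_eq_nsmul]
      exact (dualM L u u').smul_of_tower_mem (t + 1) hx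
    refine ⟨⟨⟨((t + 1 : ℕ) : ℝ) • x, h2⟩, ⟨t + 1, by omega, ?_⟩⟩, ?_⟩
    · simp only [h1]
      exact hx
    · simp only [divPair, h1, Nat.add_sub_cancel]

theorem divTerm_eq_zero (H : IsotropicData L u u' ζ N) (hf : IsCuspForm L f) (α : Fin q → Fin p)
    (g : Vpq p q ≃ₗ[ℝ] Vpq p q) {lam : Vpq p q} (hl : qf lam ≤ 0) (t : ℕ) :
    divTerm L u u' ζ N f α lam g t = 0 := by
  have h1 : qf ((1 / (t : ℝ)) • lam) ≤ 0 := by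
    rw [qf_one_div_smul]
    exact div_nonpos_of_nonpos_of_nonneg hl (sq_nonneg _)
  simp only [divTerm, arithFactor_eq_zero H hf t h1, mul_zero, zero_mul,
    Finset.sum_const_zero]

theorem unfCoeff_eq_zero (H : IsotropicData L u u' ζ N) (hf : IsCuspForm L f)
    (α : Fin q → Fin p) (g : Vpq p q ≃ₗ[ℝ] Vpq p q) {lam : Vpq p q} (hl : qf lam ≤ 0) :
    unfCoeff L u u' ζ N f α lam g = 0 := by
  rw [unfCoeff_eq]
  simp [divTerm_eq_zero H hf α g hl]

theorem qf_zero : qf (0 : Vpq p q) = 0 := by simp [qf]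

theorem coeff_zero (H : IsotropicData L u u' ζ N) (hf : IsCuspForm L f)
    (α : Fin q → Fin p) (g : Vpq p q ≃ₗ[ℝ] Vpq p q) :
    coeff L u u' ζ N f α 0 g = constTerm L u u' ζ N f α g := by
  rw [coeff, if_pos rfl, unfCoeff_eq_zero H hf α g qf_zero.le, add_zero]

theorem coeff_eq_zero (H : IsotropicData L u u' ζ N) (hf : IsCuspForm L f)
    (α : Fin q → Fin p) (g : Vpq p q ≃ₗ[ℝ] Vpq p q) {lam : Vpq p q} (h0 : lam ≠ 0)
    (hl : qf lam ≤ 0) : coeff L u u' ζ N f α lam g = 0 := by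
  rw [coeff, if_neg h0, unfCoeff_eq_zero H hf α g hl, add_zero]

section

variable [DiscreteTopology L] [IsZLattice ℝ L]

theorem hasSum_unfCoeff (H : IsotropicData L u u' ζ N) (hf : IsCuspForm L f)
    (α : Fin q → Fin p) (hg : IsSO g) :
    HasSum (fun lam : dualM L u u' => unfCoeff L u u' ζ N f α lam g *
      e (form p q lam (mu g u u') : ℝ)) (defInt L f α g - constTerm L u u' ζ N f α g) := by
  have h1 := (unfold_kernel H hf α hg).2
  simp_rw [← constKernel_eq H f α hg] at h1
  have h2 := (Equiv.ofBijective _ (bijective_divPair L u u')).hasSum_iff.2 h1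
  have h3 : ∀ z : (Σ lam : dualM L u u', Divs L u u' (lam : Vpq p q)),
      ((fun i : ℕ × dualM L u u' => 2 * ∫ τ in strip 0 1,
        unfTerm L u u' ζ N f α g (i.1 + 1) τ i.2) ∘
          Equiv.ofBijective _ (bijective_divPair L u u')) z =
      divTerm L u u' ζ N f α z.1 g z.2 * e (form p q z.1 (mu g u u') : ℝ) := by
    rintro ⟨lam, t, ht, hd⟩
    have ht0 : (t : ℝ) ≠ 0 := by exact_mod_cast (by omega : t ≠ 0)
    simp only [Function.comp_apply, Equiv.ofBijective_apply, divPair]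
    rw [Nat.sub_add_cancel ht, integral_unfTerm H hf α hg ht hd, divTerm, smul_smul,
      mul_one_div_cancel ht0, one_smul, map_smul, LinearMap.smul_apply, smul_eq_mul, ← mul_assoc,
      mul_one_div_cancel ht0, one_mul]
  have h4 := h2.congr_fun fun z => (h3 z).symm
  refine h4.sigma fun lam => ?_
  rw [unfCoeff_eq, ← tsum_mul_right]
  exact (h4.summable.sigma_factor lam).hasSum

theorem hasSum_coeff (H : IsotropicData L u u' ζ N) (hf : IsCuspForm L f)
    (α : Fin q → Fin p) (hg : IsSO g) :
    HasSum (fun lam : dualM L u u' => coeff L u u' ζ N f α lam g *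
      e (form p q lam (mu g u u') : ℝ)) (defInt L f α g) := by
  classical
  have h1 := (hasSum_ite_eq (0 : dualM L u u') (constTerm L u u' ζ N f α g)).add
    (hasSum_unfCoeff H hf α hg)
  rw [add_sub_cancel] at h1
  refine h1.congr_fun fun lam => ?_
  rw [coeff, add_mul]
  congr 1
  by_cases h : lam = 0
  · subst h
    simp [e_zero]
  · have h' : (lam : Vpq p q) ≠ 0 := fun hc => h (Subtype.ext hc)
    rw [if_neg h, if_neg h', zero_mul]

end

/-! ### Invariance under Eichler transformations -/

section Eichler

variable {g' : Vpq p q ≃ₗ[ℝ] Vpq p q}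

theorem normZperp_congr (hg : IsSO g) (hg' : IsSO g') (h : g' u = g u) :
    normZperp g' u = normZperp g u := by
  rw [normZperp, normZperp, ← hg'.1 (projZperp g' u), ← hg.1 (projZperp g u), apply_projZperp,
    apply_projZperp, h]

theorem normZ_congr (hg : IsSO g) (hg' : IsSO g') (h : g' u = g u) : normZ g' u = normZ g u := by
  rw [normZ, normZ, ← hg'.1 (projZ g' u), ← hg.1 (projZ g u), apply_projZ, apply_projZ, h]

/-- The orthogonal projection g^# ∘ g⁻¹ only removes the components along the two parts of g(u), so
it depends on g through g(u). -/
theorem gSharp_symm_congr (hg : IsSO g) (hg' : IsSO g') (h : g' u = g u) (x : Vpq p q) :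
    gSharp g' u (g'.symm x) = gSharp g u (g.symm x) := by
  rw [gSharp_symm hg, gSharp_symm hg', normZ_congr hg hg' h, normZperp_congr hg hg' h,
    apply_projZperp, apply_projZperp, apply_projZ, apply_projZ, h]

theorem redPoly_congr (hg : IsSO g) (hg' : IsSO g') (h : g' u = g u)
    (P : MvPolynomial (Idx p q) ℝ) (k : ℕ) : redPoly P g' u k = redPoly P g u k := by
  simp only [redPoly, gSharp_symm_congr hg hg' h, normZperp_congr hg hg' h, apply_projZperp, h]

theorem apply_eichler_self (hu0 : form p q u u = 0) {v : Vpq p q} (hv : form p q v u = 0)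
    (h : ∀ x, g' x = g (eichler u v x)) : g' u = g u := by
  rw [h, eichler, hu0, form_comm u v, hv]
  simp

/-- On u^⊥ the transformation E(u,v) adds a multiple of u, which g^# does not see. -/
theorem gSharp_eichler (hg : IsSO g) (hg' : IsSO g') (hu0 : form p q u u = 0)
    (ha : normZperp g u ≠ 0) {v : Vpq p q} (hv : form p q v u = 0)
    (h : ∀ x, g' x = g (eichler u v x)) {x : Vpq p q} (hx : form p q x u = 0) :
    gSharp g' u x = gSharp g u x := by
  have h1 := gSharp_symm_congr hg hg' (apply_eichler_self hu0 hv h) (g' x)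
  rw [LinearEquiv.symm_apply_apply, h, LinearEquiv.symm_apply_apply, eichler, hx, zero_smul,
    mul_zero, zero_smul, sub_zero, sub_zero, gSharp_add_smul_self hg hu0 ha] at h1
  exact h1

theorem yKernel_eichler (α : Fin q → Fin p) (hg : IsSO g) (hg' : IsSO g')
    (hu0 : form p q u u = 0) (ha : normZperp g u ≠ 0) {v : Vpq p q} (hv : form p q v u = 0)
    (h : ∀ x, g' x = g (eichler u v x)) {x : Vpq p q} (hx : form p q x u = 0) (t k : ℕ) :
    yKernel u α g' x t k = yKernel u α g x t k := by
  have hgu := apply_eichler_self hu0 hv h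
  have h1 : ∀ g : Vpq p q ≃ₗ[ℝ] Vpq p q,
      form p q (projWperp g u x) (projWperp g u x) = 2 * qf (projWperp g u x) := fun g => by
    rw [qf]; ring
  have h2 : form p q ((1 / (t : ℝ)) • x) u = 0 := by
    rw [map_smul, LinearMap.smul_apply, hx, smul_zero]
  funext y
  rw [yKernel, yKernel, h1, h1, qf_projWperp_eq_sum hg, qf_projWperp_eq_sum hg',
    gSharp_eichler hg hg' hu0 ha hv h hx, gSharp_eichler hg hg' hu0 ha hv h h2,
    redPoly_congr hg hg' hgu, normZperp_congr hg hg' hgu]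

theorem constKernel_eichler (ζ : Vpq p q) (N : ℕ) (f : ℍ → GrpAlg (dual L) L) (α : Fin q → Fin p)
    (hg : IsSO g) (hg' : IsSO g')
    (hu0 : form p q u u = 0) (ha : normZperp g u ≠ 0) {v : Vpq p q} (hv : form p q v u = 0)
    (h : ∀ x, g' x = g (eichler u v x)) (τ : ℍ) :
    constKernel L u u' ζ N f α g' τ = constKernel L u u' ζ N f α g τ := by
  have hgu := apply_eichler_self hu0 hv h
  have h1 : thetaM L u u' (redPoly (polyP α) g' u 0) g' τ =
      thetaM L u u' (redPoly (polyP α) g u 0) g τ := by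
    funext γ
    refine congrArg (fun z : ℂ => ((τ.im ^ (((q : ℝ) - 1) / 2) : ℝ) : ℂ) * z)
      (tsum_congr fun l => ?_)
    have hx : form p q (rep γ + l) u = 0 := by
      rw [map_add, LinearMap.add_apply, (rep_mem γ).2.1, l.2.2.1, add_zero]
    rw [qf_projWperp_eq_sum hg, qf_projWperp_eq_sum hg', qf_projW_eq_sum hg,
      qf_projW_eq_sum hg', gSharp_eichler hg hg' hu0 ha hv h hx, redPoly_congr hg hg' hgu]
  rw [constKernel, constKernel, h1, normZperp_congr hg hg' hgu]

theorem coeff_eichler (H : IsotropicData L u u' ζ N) (f : ℍ → GrpAlg (dual L) L)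
    (α : Fin q → Fin p) (hg : IsSO g) (hg' : IsSO g') {v : Vpq p q} (hv : form p q v u = 0)
    (h : ∀ x, g' x = g (eichler u v x)) {lam : Vpq p q} (hl : form p q lam u = 0) :
    coeff L u u' ζ N f α lam g' = coeff L u u' ζ N f α lam g := by
  have ha := (normZperp_pos hg H.iso H.ne_zero).ne'
  have hgu := apply_eichler_self H.iso hv h
  rw [coeff, coeff, constTerm, constTerm, unfCoeff, unfCoeff]
  simp only [constKernel_eichler ζ N f α hg hg' H.iso ha hv h,
    yKernel_eichler α hg hg' H.iso ha hv h hl, normZperp_congr hg hg' hgu]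

end Eichler

/-! ### Splitting off a hyperbolic plane -/

/-- When u' ∈ L, every l ∈ L becomes an element of M after subtracting integral multiples of u' and
u, both orthogonal to x. -/
theorem IsotropicData.mem_dual_of_mem_dualM (H : IsotropicData L u u' ζ N) (hu' : u' ∈ L)
    {x : Vpq p q} (hx : x ∈ dualM L u u') : x ∈ dual L := by
  refine mem_dual.2 fun l hl => ?_
  obtain ⟨n, hn⟩ := exists_form_int (H.even.le_dual hl) H.mem
  have h1 : l - n • u' ∈ L := L.sub_mem hl (L.smul_mem n hu')
  have h2 : form p q (l - n • u') u = 0 := by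
    rw [map_sub, LinearMap.sub_apply, hn, map_zsmul, LinearMap.smul_apply, H.form'']
    simp
  obtain ⟨m, hm⟩ := exists_form_int hx.1 (H.projM_mem_latM h1 h2)
  refine ⟨m, ?_⟩
  rw [projM_of_form_eq_zero u' h2, map_sub, map_sub, map_zsmul, map_smul, hx.2.1, hx.2.2] at hm
  simpa using hm

/-- When u' ∈ L, a lift v of x pairs integrally with u', so v - x is an integral multiple of u and
the class over x is unique. -/
theorem IsotropicData.liesOver_iff (H : IsotropicData L u u' ζ N) (hu' : u' ∈ L) {x : Vpq p q}
    (hx : x ∈ dualM L u u') (δ : Quo (dual L) L) : LiesOver L u u' ζ N δ x ↔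
      δ = Submodule.Quotient.mk ⟨x, H.mem_dual_of_mem_dualM hu' hx⟩ := by
  constructor
  · intro h
    obtain ⟨v, hv, rfl, hv2⟩ := H.exists_of_liesOver h
    rw [quo_mk_eq_iff]
    change (v : Vpq p q) - x ∈ L
    obtain ⟨n, hn⟩ := exists_form_int v.2 hu'
    rw [← hv2, projM_of_form_eq_zero u' hv, sub_sub_cancel]
    rw [hn, Int.cast_smul_eq_zsmul]
    exact L.smul_mem n H.mem
  · rintro rfl
    have h1 := H.liesOver_mk (x := ⟨x, H.mem_dual_of_mem_dualM hu' hx⟩) hx.2.1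
    rwa [projM_of_form_eq_zero u' hx.2.1, hx.2.2, zero_smul, sub_zero] at h1

/-- One class remains, and its phase e(t(δ,u')) is 1 because u' ∈ L. -/
theorem IsotropicData.arithFactor_eq_vecCoeff (H : IsotropicData L u u' ζ N) (hu' : u' ∈ L)
    (f : ℍ → GrpAlg (dual L) L) (t : ℕ) {x : Vpq p q} (hx : x ∈ dualM L u u') :
    arithFactor L u u' ζ N f t x = vecCoeff L f x (qf x) := by
  have hd := H.mem_dual_of_mem_dualM hu' hx
  rw [arithFactor, vecCoeff, dif_pos hd]
  simp only [H.liesOver_iff hu' hx]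
  rw [finsum_eq_single _ (Submodule.Quotient.mk ⟨x, hd⟩) fun δ hδ => by simp [hδ]]
  obtain ⟨n, hn⟩ := exists_form_int
    (rep_mem (Submodule.Quotient.mk ⟨x, hd⟩ : Quo (dual L) L)) hu'
  have h1 : ((t : ℂ) * ((n : ℝ) : ℂ)) = ((t * n : ℤ) : ℂ) := by push_cast; rfl
  simp only [eq_self, finsum_true, hn, h1, e_int, one_mul]

theorem coeff_eq_splitCoeff (H : IsotropicData L u u' ζ N) (hu' : u' ∈ L)
    (f : ℍ → GrpAlg (dual L) L) (α : Fin q → Fin p) (g : Vpq p q ≃ₗ[ℝ] Vpq p q) {lam : Vpq p q}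
    (hl : 0 < qf lam) :
    coeff L u u' ζ N f α lam g = splitCoeff L u u' f α lam g := by
  have h0 : lam ≠ 0 := fun h => by rw [h, qf_zero] at hl; exact lt_irrefl _ hl
  rw [coeff, if_neg h0, zero_add, unfCoeff_eq, splitCoeff, ← tsum_mul_left]
  refine tsum_congr fun t => ?_
  rw [divTerm, H.arithFactor_eq_vecCoeff hu' f _ t.2.2, qf_one_div_smul]

end

end KM

end

/-! ### The Fourier expansion of the lift -/

theorem theorem1p2 (p q : ℕ) (L : Submodule ℤ (KM.Vpq p q)) [DiscreteTopology L] [IsZLattice ℝ L]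
    (hL : KM.IsEven L) (u u' ζ : KM.Vpq p q) (N : ℕ)
    -- `u ∈ L` isotropic and `u' ∈ L'` with `(u,u') = 1`; this forces `u` to be primitive
    (hu : u ∈ L) (hu0 : KM.form p q u u = 0)
    (hu' : u' ∈ KM.dual L) (huu' : KM.form p q u u' = 1)
    -- `(u,L) = Nℤ`, and `ζ ∈ L` with `(ζ,u) = N`
    (hN : 0 < N) (hNdvd : ∀ l ∈ L, ∃ n : ℤ, KM.form p q l u = n * N)
    (hζ : ζ ∈ L) (hζN : KM.form p q ζ u = N)
    (f : ℍ → KM.GrpAlg (KM.dual L) L) (hf : KM.IsCuspForm L f) (α : Fin q → Fin p) :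
    -- the defining integral and the constant term converge
    (∀ g, KM.IsSO g →
      MeasureTheory.IntegrableOn (KM.kernel L f α g) ModularGroup.fd ∧
      MeasureTheory.IntegrableOn (KM.constKernel L u u' ζ N f α g) ModularGroup.fd) ∧
    -- the integrals over `y` converge
    (∀ g, KM.IsSO g → ∀ lam ∈ KM.dualM L u u', 0 < KM.qf lam →
      ∀ t : KM.Divs L u u' lam, ∀ h ≤ q,
        MeasureTheory.IntegrableOn (KM.yKernel u α g lam t h) (Set.Ioi 0)) ∧
    -- the expansion of `I_α`
    (∀ g, KM.IsSO g →
      HasSum (fun lam : KM.dualM L u u' =>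
        KM.coeff L u u' ζ N f α lam g * KM.e (KM.form p q lam (KM.mu g u u') : ℝ))
        (KM.defInt L f α g)) ∧
    -- it is a Fourier expansion: its coefficients are invariant under all Eichler
    -- transformations `E(u,v)`, `v ∈ M ⊗ ℝ`
    (∀ g g', KM.IsSO g → KM.IsSO g' → ∀ v, KM.form p q v u = 0 → KM.form p q v u' = 0 →
      (∀ x, g' x = g (KM.eichler u v x)) → ∀ lam ∈ KM.dualM L u u',
        KM.coeff L u u' ζ N f α lam g' = KM.coeff L u u' ζ N f α lam g) ∧
    -- the coefficient of index `0` is the constant term, and the other coefficients of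
    -- non-positive norm vanish
    (∀ g, KM.IsSO g → KM.coeff L u u' ζ N f α 0 g = KM.constTerm L u u' ζ N f α g) ∧
    (∀ g, KM.IsSO g → ∀ lam ∈ KM.dualM L u u', lam ≠ 0 → KM.qf lam ≤ 0 →
      KM.coeff L u u' ζ N f α lam g = 0) ∧
    -- the case `L = M ⊕ U` with `u`, `u'` the standard generators of `U`
    (u' ∈ L → KM.form p q u' u' = 0 → ∀ g, KM.IsSO g →
      HasSum (fun lam : {lam : KM.dualM L u u' // 0 ≤ KM.qf (lam : KM.Vpq p q)} =>
        KM.coeff L u u' ζ N f α (lam : KM.dualM L u u') g *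
          KM.e (KM.form p q (lam : KM.dualM L u u') (KM.mu g u u') : ℝ))
        (KM.defInt L f α g) ∧
      ∀ lam ∈ KM.dualM L u u', 0 < KM.qf lam →
        KM.coeff L u u' ζ N f α lam g = KM.splitCoeff L u u' f α lam g) := by
  have H : KM.IsotropicData L u u' ζ N := ⟨hL, hu, hu0, hu', huu', hN, hNdvd, hζ, hζN⟩
  refine ⟨fun g hg => ⟨(KM.unfold_kernel H hf α hg).1, ?_⟩, fun g hg lam hlam hl t h _ => ?_,
    fun g hg => KM.hasSum_coeff H hf α hg,
    fun g g' hg hg' v hv _ h lam hlam => KM.coeff_eichler H f α hg hg' hv h hlam.2.1,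
    fun g _ => KM.coeff_zero H hf α g,
    fun g _ lam _ h0 hl => KM.coeff_eq_zero H hf α g h0 hl,
    fun hu'L _ g hg => ⟨?_, fun lam _ hl => KM.coeff_eq_splitCoeff H hu'L f α g hl⟩⟩
  · have h := KM.integrableOn_charCoeff_zero H hf α hg
    simp_rw [← KM.constKernel_eq H f α hg] at h
    exact h
  · have ha := KM.normZperp_pos hg H.iso H.ne_zero
    exact KM.integrableOn_yKernel u α ha
      (hl.trans_le (KM.qf_le_qf_projWperp hg H.iso ha hlam.2.1)) t.2.1 h
  -- Terms with q(λ) < 0 vanish, so the sum over M' may be restricted.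
  · refine (hasSum_subtype_iff_of_support_subset (s := {lam : KM.dualM L u u' |
      0 ≤ KM.qf (lam : KM.Vpq p q)}) fun lam hlam => ?_).2 (KM.hasSum_coeff H hf α hg)
    by_contra hc
    have hc' : KM.qf (lam : KM.Vpq p q) < 0 := not_le.1 hc
    refine hlam ?_
    have h0 : (lam : KM.Vpq p q) ≠ 0 := fun h0 => by
      rw [h0, KM.qf_zero] at hc'
      exact lt_irrefl _ hc'
    simp only [KM.coeff_eq_zero H hf α g h0 hc'.le, zero_mul]
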